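/- **Second Reduction Lemma.** A *simply connected region* is a finite nonempty union of closed unit squares of the lattice $\mathbb Z^2$ with connected interior which is simply connected (equivalently, whose complement in the plane is connected). A *Wang tile* is a unit square with a color on each of its four sides; it may be translated but not rotated or reflected. A *colored* region has a color on every unit edge of its boundary. A *tiling* of a colored region $\Gamma$ by a set $W$ of Wang tiles places a tile of $W$ on each unit square of $\Gamma$ so that the two tiles at each interior edge have the same color there, and the tile at each boundary edge has the color prescribed by $\Gamma$. A tiling of a region by a set $R$ of rectangles with positive integer side lengths is a set of lattice translates (without rotations) of members of $R$ with pairwise disjoint interiors and union equal to the region. Let $W$ be a set of at most $k$ Wang tiles, and let $B$ be a set of $c$ colors (those permitted on the boundary of regions; the tiles of $W$ may also use other colors). Then there are a set $R$ of at most $8(k+4c)^2$ rectangles and a map $\Gamma\mapsto\Gamma'$ from the simply connected regions with boundary colors in $B$ to the simply connected regions such that, for every such $\Gamma$: 1. $\Gamma$ has a tiling by $W$ if and only if $\Gamma'$ has a tiling by $R$; 2. the reduction is parsimonious: there is a bijection between the tilings of $\Gamma$ by $W$ and the tilings of $\Gamma'$ by $R$, so their numbers are equal. Moreover, the map $\Gamma\mapsto\Gamma'$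 is computable in linear time: there are a multi-stack Turing machine and a constant $K$ (depending only on $W$ and $B$) such that, given any list of the unit squares of $\Gamma$ (coordinates in binary, each square together with the colors of those of its sides that lie on the boundary of $\Gamma$), the machine outputs a list of the unit squares of $\Gamma'$ in at most $K(n+1)$ steps, where $n$ is the length of the input. The lists may be in any order and may contain repetitions. -/

import Mathlib

namespace WangRect

/-- A closed unit square of the integer lattice, named by its lower left corner: the cell `(x, y)`
is the square `[x, x+1] × [y, y+1]`. -/
abbrev Cell : Type := ℤ × ℤ

/-- The four sides of a unit square. -/
inductive Dir : Type
  | up | right | down | left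

/-- The opposite side. -/
def Dir.opp : Dir → Dir
  | .up => .down
  | .right => .left
  | .down => .up
  | .left => .right

/-- The unit square on the other side of the side `d` of the square `p`. -/
def Cell.step (p : Cell) : Dir → Cell
  | .up => (p.1, p.2 + 1)
  | .right => (p.1 + 1, p.2)
  | .down => (p.1, p.2 - 1)
  | .left => (p.1 - 1, p.2)

/-- The graph on the unit squares in which two squares are adjacent if they share a side. -/
def cellGraph : SimpleGraph Cell :=
  SimpleGraph.fromRel fun p q => ∃ d : Dir, q = Cell.step p d

/-- A finite set of unit squares whose union has connected interior (the squares are connected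
through common sides; in particular there is at least one) and is simply connected. The union is
a bounded closed set, so it is simply connected if and only if its complement in the plane is
connected. As the complement is open, and contains the corner of a square only if it contains
the interiors of the four squares there, this means that the squares outside the set are
connected through common sides. -/
structure IsSimplyConnectedRegion (G : Finset Cell) : Prop where
  connected : (cellGraph.induce (G : Set Cell)).Connected
  compl_connected : (cellGraph.induce ((G : Set Cell)ᶜ)).Connected

/-- The simply connected regions. -/
abbrev Region : Type := {G : Finset Cell // IsSimplyConnectedRegion G}

/-! ### Wang tiles -/

/-- An (ordinary) Wang tile: a unit square with colored sides. -/
abbrev WangTile (C : Type) : Type := Dir → C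

/-- A simply connected region with a color from `B` on each unit edge of its boundary. A boundary
edge is named by the unique square `p` of the region that it belongs to and its side `d` of `p`;
`col p d` is `none` if this is not a boundary edge. -/
structure ColoredRegion {C : Type} (B : Finset C) : Type where
  cells : Finset Cell
  isSimplyConnected : IsSimplyConnectedRegion cells
  col : Cell → Dir → Option B
  isSome_col_iff : ∀ p d, (col p d).isSome ↔ p ∈ cells ∧ Cell.step p d ∉ cells

/-- A tiling of the colored region `G` by translates of Wang tiles from `W`: a tile on each
square, such that the two tiles at each interior edge agree in its color, and each
boundary edge has the same color in the tile and in the region. -/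
structure WangTiling {C : Type} {B : Finset C} (W : Finset (WangTile C))
    (G : ColoredRegion B) : Type where
  tile : G.cells → WangTile C
  tile_mem : ∀ p, tile p ∈ W
  interior : ∀ (p q : G.cells) (d : Dir), (q : Cell) = Cell.step p d →
    tile p d = tile q d.opp
  boundary : ∀ (p : G.cells) (d : Dir) (b : B), G.col p d = some b → tile p d = b

/-! ### Rectangular tiles -/

/-- A rectangular tile, up to translation. -/
structure RectTile : Type where
  height : ℕ+
  width : ℕ+

/-- The unit squares of the translate of `t` whose lower left square is `p`. -/
noncomputable def RectTile.cellsAt (t : RectTile) (p : Cell) : Finset Cell :=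
  Finset.Ico p.1 (p.1 + (t.width : ℤ)) ×ˢ Finset.Ico p.2 (p.2 + (t.height : ℤ))

/-- A tiling of `G` by translates of rectangles from `R`: a set of placed rectangles without
common squares (that is, with disjoint interiors) whose union is `G`. -/
structure RectTiling (R : Finset RectTile) (G : Finset Cell) : Type where
  tiles : Set (RectTile × Cell)
  tile_mem : ∀ t ∈ tiles, t.1 ∈ R
  disjoint : tiles.PairwiseDisjoint fun t => t.1.cellsAt t.2
  covers : ∀ p : Cell, p ∈ G ↔ ∃ t ∈ tiles, p ∈ t.1.cellsAt t.2

/-! ### Regions as input and output of an algorithm -/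

/-- The symbols with which regions are written, with extra labels from `L`. -/
inductive Sym (L : Type) : Type
  | bit (b : Bool)
  | minus
  | comma
  | label (a : L)

/-- An integer in binary: a minus sign if it is negative, then the binary digits of the absolute
value (least significant digit first, as in Mathlib's `encodeNat`), then a comma. -/
def encodeInt (L : Type) (z : ℤ) : List (Sym L) :=
  (if z < 0 then [Sym.minus] else []) ++
    (Computability.encodeNat z.natAbs).map Sym.bit ++ [Sym.comma]

/-- A square: its two coordinates. -/
def encodeCell (L : Type) (p : Cell) : List (Sym L) :=
  encodeInt L p.1 ++ encodeInt L p.2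

/-- A list of squares. -/
def encodeCells (l : List Cell) : List (Sym Empty) :=
  l.flatMap (encodeCell Empty)

/-- A colored region given as a list of its squares, in any order (and, as for any union,
possibly with repetitions), each square with the colors of those of its sides that lie on the
boundary of the region. -/
structure ColoredListing {C : Type} (B : Finset C) : Type where
  region : ColoredRegion B
  squares : List (Cell × (Dir → Option B))
  mem_squares_iff : ∀ s, s ∈ squares ↔ s.1 ∈ region.cells ∧ s.2 = region.col s.1

/-- A square with its boundary colors: the two coordinates, then one symbol for each side. -/
def encodeColoredSquare {C : Type} {B : Finset C} (s : Cell × (Dir → Option B)) :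
    List (Sym (Option B)) :=
  encodeCell (Option B) s.1 ++
    [Sym.label (s.2 .up), Sym.label (s.2 .right), Sym.label (s.2 .down), Sym.label (s.2 .left)]

/-- The written form of a listing of a colored region. -/
def ColoredListing.encode {C : Type} {B : Finset C} (l : ColoredListing B) :
    List (Sym (Option B)) :=
  l.squares.flatMap encodeColoredSquare

/-- `F` is computable in linear time: there is a Turing machine (Mathlib's machine with finitely
many stacks) that turns each listing of each colored region `G` into a listing of the squares of
`F G`, in a number of steps that is linear in the length of the input. -/
def IsLinearTime {C : Type} {B : Finset C} (F : ColoredRegion B → Region) : Prop :=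
  ∃ f : ColoredListing B → List Cell,
    (∀ (l : ColoredListing B) (p : Cell), p ∈ f l ↔ p ∈ (F l.region).1) ∧
    ∃ (M : Turing.TM2ComputableInTime ColoredListing.encode encodeCells f) (K : ℕ),
      ∀ n, M.time n ≤ K * (n + 1)

end WangRect

/-! The region `Γ'` is a square grid whose lines are slightly displaced, and the displacements carry
the information. Take a grid of mesh `S` and give each vertex an offset between `0` and `g`, with
`g` much smaller than `S`. Horizontal segments pass through the vertices with even coordinate sum
and vertical ones through the others, as in a pinwheel. This cuts the plane into bricks. One
diagonal of a brick determines its width, the other its height: each is `S` plus a difference of the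
offsets at two opposite corners.

A square of `Γ` becomes a box of four bricks. The center of the box shows its Wang tile, the
midpoints of its sides show their colors, and its corners show nothing. The offset of a vertex
encodes what it shows together with its coordinates modulo 4. Offsets are distinct powers of 4, so a
sum of up to three of them determines its terms (`four_pow_triple`), and the difference of two
different offsets determines both (`code_sub`). `R` consists of the bricks of all tiles in all 16
positions modulo 4, hence of at most `16 * k` rectangles.

From Wang tilings to rectangles: moving a vertex all of whose bricks lie in the region changes the
cutting but not the union (`brickRegion_congr`). Thus the outline of `Γ'` depends only on the
boundary colors, and every Wang tiling cuts the same region into members of `R`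
(`IsWangMap.rectTiling`).

From rectangles to Wang tilings: in a tiling of `Γ'`, read the tile of each box off the rectangle at
a fixed square of its lower left brick, and let these tiles define the offsets. Induction along the
diagonals of bricks shows that every brick is a rectangle of the tiling (`isFull_readTile`). The
geometric reason is that all sides are at least `S - g`. A gap narrower than this cannot be filled,
and two rectangles do not fit in the place of one. Grid vertices two steps apart have different
offsets, so the neighbors already placed form a step that no new rectangle can cross. This forces
the width of an even brick (`exists_tile_even`) and the upper side of an odd brick
(`exists_tile_odd`); the forced length then reveals what the vertices show. The delicate brick is
the upper right one of a box: its width gives the colors above and on the right, but its tile could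
still be wrong. A wrong tile displaces the bottom of the brick above, whose height would then be a
combination of codes that no rectangle has (`eq_of_height`). If there is no box above, the boundary
of the region fixes the height.

Linear time: the distance between neighboring boxes is a power of two, `2 ^ r`. The squares of a box
have coordinates `2 ^ r * z + t`, with finitely many `t` that depend only on the boundary colors of
the box and the parities of its coordinates. Such a number is written by copying the digits of `|z|`
or `|z| - 1` and appending `r` digits from finite memory. -/

namespace WangRect

/-! ### Pinwheel grids

A perturbed square grid of mesh `S`: the lattice vertex `(i, j)` carries an offset `v (i, j)`. If
`i + j` is even, a horizontal segment at height `S * j + v (i, j)` passes through the vertex; if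
`i + j` is odd, a vertical segment at abscissa `S * i + v (i, j)` passes through it. The segments
cut the plane into rectangles, one for each unit square of the lattice. -/

/-- The abscissa of the left side of the brick `(a, b)`. -/
def edgeX (S : ℤ) (v : Cell → ℤ) (a b : ℤ) : ℤ :=
  S * a + if (a + b) % 2 = 0 then v (a, b + 1) else v (a, b)

/-- The ordinate of the lower side of the brick `(a, b)`. -/
def edgeY (S : ℤ) (v : Cell → ℤ) (a b : ℤ) : ℤ :=
  S * b + if (a + b) % 2 = 0 then v (a, b) else v (a + 1, b)

/-- The unit squares in the brick `c`. -/
noncomputable def brick (S : ℤ) (v : Cell → ℤ) (c : Cell) : Finset Cell :=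
  Finset.Ico (edgeX S v c.1 c.2) (edgeX S v (c.1 + 1) c.2) ×ˢ
    Finset.Ico (edgeY S v c.1 c.2) (edgeY S v c.1 (c.2 + 1))

/-- The offsets are between `0` and `g`. -/
def OffsetsIn (g : ℤ) (v : Cell → ℤ) : Prop := ∀ u, 0 ≤ v u ∧ v u ≤ g

/-- The vertex `u` is a corner of the brick `c`. -/
def Incident (u c : Cell) : Prop :=
  (u.1 = c.1 ∨ u.1 = c.1 + 1) ∧ (u.2 = c.2 ∨ u.2 = c.2 + 1)

theorem mem_brick {S : ℤ} {v : Cell → ℤ} {c z : Cell} :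
    z ∈ brick S v c ↔ (edgeX S v c.1 c.2 ≤ z.1 ∧ z.1 < edgeX S v (c.1 + 1) c.2) ∧
      edgeY S v c.1 c.2 ≤ z.2 ∧ z.2 < edgeY S v c.1 (c.2 + 1) := by
  simp [brick]

section
variable {S g : ℤ} {v v' : Cell → ℤ}

theorem edgeX_bounds (hv : OffsetsIn g v) (a b : ℤ) :
    S * a ≤ edgeX S v a b ∧ edgeX S v a b ≤ S * a + g := by
  unfold edgeX
  have h1 := hv (a, b + 1)
  have h2 := hv (a, b)
  split_ifs <;> omega

theorem edgeY_bounds (hv : OffsetsIn g v) (a b : ℤ) :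
    S * b ≤ edgeY S v a b ∧ edgeY S v a b ≤ S * b + g := by
  unfold edgeY
  have h1 := hv (a + 1, b)
  have h2 := hv (a, b)
  split_ifs <;> omega

theorem edgeX_even (a b : ℤ) (h : (a + b) % 2 = 0) :
    edgeX S v a b = S * a + v (a, b + 1) := by simp [edgeX, h]

theorem edgeX_odd (a b : ℤ) (h : (a + b) % 2 = 1) : edgeX S v a b = S * a + v (a, b) := by
  simp [edgeX, h]

theorem edgeY_even (a b : ℤ) (h : (a + b) % 2 = 0) : edgeY S v a b = S * b + v (a, b) := by
  simp [edgeY, h]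

theorem edgeY_odd (a b : ℤ) (h : (a + b) % 2 = 1) :
    edgeY S v a b = S * b + v (a + 1, b) := by simp [edgeY, h]

/-- Vertical segments pass straight through odd vertices. -/
theorem edgeX_straight (a b : ℤ) (h : (a + b) % 2 = 0) :
    edgeX S v a (b + 1) = edgeX S v a b := by
  rw [edgeX_even a b h, edgeX_odd a (b + 1) (by omega)]

/-- Horizontal segments pass straight through even vertices. -/
theorem edgeY_straight (a b : ℤ) (h : (a + b) % 2 = 1) :
    edgeY S v (a + 1) b = edgeY S v a b := by
  rw [edgeY_odd a b h, edgeY_even (a + 1) b (by omega)]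

theorem floor_bounds (hS : 0 < S) (x : ℤ) : S * (x / S) ≤ x ∧ x < S * (x / S) + S :=
  ⟨Int.mul_ediv_self_le hS.ne', by
    have := Int.lt_mul_ediv_self_add (x := x) hS
    simpa using this⟩

/-- Every unit square lies in a brick. -/
theorem exists_brick (hS : g < S) (hg : 0 ≤ g) (hv : OffsetsIn g v) (z : Cell) :
    ∃ c, z ∈ brick S v c := by
  obtain ⟨X, Y⟩ := z
  have hS0 : 0 < S := by omega
  obtain ⟨hx1, hx2⟩ := floor_bounds hS0 X
  obtain ⟨hy1, hy2⟩ := floor_bounds hS0 Y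
  set a := X / S
  set b := Y / S
  have ea : S * (a + 1) = S * a + S := by ring
  have ea' : S * (a - 1) = S * a - S := by ring
  have eb : S * (b + 1) = S * b + S := by ring
  have eb' : S * (b - 1) = S * b - S := by ring
  have X00 := edgeX_bounds (S := S) hv a b
  have X10 := edgeX_bounds (S := S) hv (a + 1) b
  have X01 := edgeX_bounds (S := S) hv a (b - 1)
  have X11 := edgeX_bounds (S := S) hv (a + 1) (b - 1)
  have Xm0 := edgeX_bounds (S := S) hv (a - 1) b
  have Xm1 := edgeX_bounds (S := S) hv (a - 1) (b - 1)
  have Y00 := edgeY_bounds (S := S) hv a b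
  have Y10 := edgeY_bounds (S := S) hv (a - 1) b
  have Y01 := edgeY_bounds (S := S) hv a (b + 1)
  have Y11 := edgeY_bounds (S := S) hv (a - 1) (b + 1)
  have Ym0 := edgeY_bounds (S := S) hv a (b - 1)
  have Ym1 := edgeY_bounds (S := S) hv (a - 1) (b - 1)
  -- Offsets only move grid lines to the right and up, so the square lies in the brick `(a, b)` or
  -- in one of the three to its left and below. These four meet at the vertex `(a, b)`, where the
  -- segment that passes straight through decides between them.
  have key : (edgeX S v a b ≤ X ∧ edgeY S v a b ≤ Y) ∨
      (X < edgeX S v a b ∧ edgeY S v (a - 1) b ≤ Y) ∨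
      (edgeX S v a (b - 1) ≤ X ∧ Y < edgeY S v a b) ∨
      (X < edgeX S v a (b - 1) ∧ Y < edgeY S v (a - 1) b) := by
    rcases Int.emod_two_eq (a + b) with h | h
    · have := edgeY_straight (S := S) (v := v) (a - 1) b (by omega)
      simp only [sub_add_cancel] at this
      omega
    · have := edgeX_straight (S := S) (v := v) a (b - 1) (by omega)
      simp only [sub_add_cancel] at this
      omega
  rcases key with h | h | h | h
  · exact ⟨(a, b), by rw [mem_brick]; dsimp only; omega⟩
  · exact ⟨(a - 1, b), by rw [mem_brick]; dsimp only; rw [sub_add_cancel]; omega⟩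
  · exact ⟨(a, b - 1), by rw [mem_brick]; dsimp only; rw [sub_add_cancel]; omega⟩
  · exact ⟨(a - 1, b - 1), by rw [mem_brick]; dsimp only; rw [sub_add_cancel, sub_add_cancel]; omega⟩

theorem index_near (hS : g < S) (hg : 0 ≤ g) {a a' x : ℤ} (h1 : S * a ≤ x) (h2 : x < S * (a' + 1) + g) :
    a ≤ a' + 1 := by
  by_contra h
  have h3 : a' + 2 ≤ a := by omega
  have h4 := mul_le_mul_of_nonneg_left h3 (hg.trans hS.le)
  linarith [mul_add S a' 2, mul_add S a' 1]

/-- If a unit square belongs to different bricks for two families of offsets, then the offsets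
differ at a common corner of the two bricks. -/
theorem exists_ne_of_mem_bricks (hS : g < S) (hg : 0 ≤ g) (hv : OffsetsIn g v)
    (hv' : OffsetsIn g v') {z c c' : Cell} (hc : z ∈ brick S v c) (hc' : z ∈ brick S v' c')
    (hne : c ≠ c') : ∃ u, v u ≠ v' u ∧ Incident u c ∧ Incident u c' := by
  obtain ⟨X, Y⟩ := z
  obtain ⟨a, b⟩ := c
  obtain ⟨a', b'⟩ := c'
  rw [mem_brick] at hc hc'
  dsimp only at hc hc'
  obtain ⟨⟨h1, h2⟩, h3, h4⟩ := hc
  obtain ⟨⟨k1, k2⟩, k3, k4⟩ := hc'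
  have n1 : a ≤ a' + 1 := index_near hS hg ((edgeX_bounds hv a b).1.trans h1)
    (k2.trans_le (edgeX_bounds hv' (a' + 1) b').2)
  have n2 : a' ≤ a + 1 := index_near hS hg ((edgeX_bounds hv' a' b').1.trans k1)
    (h2.trans_le (edgeX_bounds hv (a + 1) b).2)
  have n3 : b ≤ b' + 1 := index_near hS hg ((edgeY_bounds hv a b).1.trans h3)
    (k4.trans_le (edgeY_bounds hv' a' (b' + 1)).2)
  have n4 : b' ≤ b + 1 := index_near hS hg ((edgeY_bounds hv' a' b').1.trans k3)
    (h4.trans_le (edgeY_bounds hv a (b + 1)).2)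
  -- The indices differ by at most one. In each remaining case one inequality for `c` and one for
  -- `c'` concern the same segment, which would separate the two bricks if the offsets at its vertex
  -- agreed.
  have ha : a' = a - 1 ∨ a' = a ∨ a' = a + 1 := by omega
  have hb : b' = b - 1 ∨ b' = b ∨ b' = b + 1 := by omega
  have found : ∀ i j : ℤ, (v (i, j) = v' (i, j) → False) → (i = a ∨ i = a + 1) →
      (j = b ∨ j = b + 1) → (i = a' ∨ i = a' + 1) → (j = b' ∨ j = b' + 1) →
      ∃ u, v u ≠ v' u ∧ Incident u (a, b) ∧ Incident u (a', b') :=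
    fun i j h p q r s => ⟨(i, j), h, ⟨p, q⟩, ⟨r, s⟩⟩
  rcases Int.emod_two_eq (a + b) with par | par
  · rcases ha with rfl | rfl | rfl
    · rcases hb with rfl | rfl | rfl
      · rw [edgeY_even _ _ par] at h3
        rw [edgeY_odd _ _ (by omega)] at k4
        simp only [sub_add_cancel] at k4
        exact found a b (by omega) (by omega) (by omega) (by omega) (by omega)
      · rw [edgeX_even _ _ par] at h1
        rw [edgeX_even _ _ (by omega)] at k2
        simp only [sub_add_cancel] at k2
        exact found a (b' + 1) (by omega) (by omega) (by omega) (by omega) (by omega)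
      · rw [edgeX_even _ _ par] at h1
        rw [edgeX_odd _ _ (by omega)] at k2
        simp only [sub_add_cancel] at k2
        exact found a (b + 1) (by omega) (by omega) (by omega) (by omega) (by omega)
    · rcases hb with rfl | rfl | rfl
      · rw [edgeY_even _ _ par] at h3
        rw [edgeY_even _ _ (by omega)] at k4
        simp only [sub_add_cancel] at k4
        exact found a' b (by omega) (by omega) (by omega) (by omega) (by omega)
      · exact absurd rfl hne
      · rw [edgeY_odd _ _ (by omega)] at h4 k3
        exact found (a' + 1) (b + 1) (by omega) (by omega) (by omega) (by omega) (by omega)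
    · rcases hb with rfl | rfl | rfl
      · rw [edgeX_odd _ _ (by omega)] at h2
        rw [edgeX_even _ _ (by omega)] at k1
        simp only [sub_add_cancel] at k1
        exact found (a + 1) b (by omega) (by omega) (by omega) (by omega) (by omega)
      · rw [edgeX_odd _ _ (by omega)] at h2 k1
        exact found (a + 1) b' (by omega) (by omega) (by omega) (by omega) (by omega)
      · rw [edgeY_odd _ _ (by omega)] at h4
        rw [edgeY_even _ _ (by omega)] at k3
        exact found (a + 1) (b + 1) (by omega) (by omega) (by omega) (by omega) (by omega)
  · rcases ha with rfl | rfl | rfl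
    · rcases hb with rfl | rfl | rfl
      · rw [edgeX_odd _ _ par] at h1
        rw [edgeX_even _ _ (by omega)] at k2
        simp only [sub_add_cancel] at k2
        exact found a b (by omega) (by omega) (by omega) (by omega) (by omega)
      · rw [edgeX_odd _ _ par] at h1
        rw [edgeX_odd _ _ (by omega)] at k2
        simp only [sub_add_cancel] at k2
        exact found a b' (by omega) (by omega) (by omega) (by omega) (by omega)
      · rw [edgeY_even _ _ (by omega)] at h4
        rw [edgeY_odd _ _ (by omega)] at k3
        simp only [sub_add_cancel] at k3
        exact found a (b + 1) (by omega) (by omega) (by omega) (by omega) (by omega)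
    · rcases hb with rfl | rfl | rfl
      · rw [edgeY_odd _ _ par] at h3
        rw [edgeY_odd _ _ (by omega)] at k4
        simp only [sub_add_cancel] at k4
        exact found (a' + 1) b (by omega) (by omega) (by omega) (by omega) (by omega)
      · exact absurd rfl hne
      · rw [edgeY_even _ _ (by omega)] at h4 k3
        exact found a' (b + 1) (by omega) (by omega) (by omega) (by omega) (by omega)
    · rcases hb with rfl | rfl | rfl
      · rw [edgeY_odd _ _ par] at h3
        rw [edgeY_even _ _ (by omega)] at k4
        simp only [sub_add_cancel] at k4
        exact found (a + 1) b (by omega) (by omega) (by omega) (by omega) (by omega)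
      · rw [edgeX_even _ _ (by omega)] at h2 k1
        exact found (a + 1) (b' + 1) (by omega) (by omega) (by omega) (by omega) (by omega)
      · rw [edgeX_even _ _ (by omega)] at h2
        rw [edgeX_odd _ _ (by omega)] at k1
        exact found (a + 1) (b + 1) (by omega) (by omega) (by omega) (by omega) (by omega)

/-- Different bricks are disjoint. -/
theorem brick_unique (hS : g < S) (hg : 0 ≤ g) (hv : OffsetsIn g v) {z c c' : Cell}
    (hc : z ∈ brick S v c) (hc' : z ∈ brick S v c') : c = c' := by
  by_contra hne
  obtain ⟨u, hu, -⟩ := exists_ne_of_mem_bricks hS hg hv hv hc hc' hne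
  exact hu rfl

/-- The unit squares covered by the bricks of a set do not depend on the offsets at the vertices
that are surrounded by bricks of this set. -/
theorem biUnion_brick_subset (hS : g < S) (hg : 0 ≤ g) (hv : OffsetsIn g v)
    (hv' : OffsetsIn g v') {A : Set Cell}
    (hA : ∀ u, v u ≠ v' u → ∀ c c', Incident u c → Incident u c' → c ∈ A → c' ∈ A)
    {z c : Cell} (hc : c ∈ A) (hz : z ∈ brick S v c) : ∃ c' ∈ A, z ∈ brick S v' c' := by
  obtain ⟨c', hc'⟩ := exists_brick hS hg hv' z
  refine ⟨c', ?_, hc'⟩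
  by_cases hne : c = c'
  · exact hne ▸ hc
  · obtain ⟨u, hu, h1, h2⟩ := exists_ne_of_mem_bricks hS hg hv hv' hz hc' hne
    exact hA u hu c c' h1 h2 hc

end

/-! ### Connectedness of preimages -/

theorem cellGraph_adj_step {p q : Cell} (h : cellGraph.Adj p q) :
    ∃ d, q = Cell.step p d ∨ p = Cell.step q d := by
  simp only [cellGraph, SimpleGraph.fromRel_adj] at h
  rcases h.2 with ⟨d, hd⟩ | ⟨d, hd⟩
  · exact ⟨d, Or.inl hd⟩
  · exact ⟨d, Or.inr hd⟩

theorem cellGraph_adj_right (x y : ℤ) : cellGraph.Adj (x, y) (x + 1, y) := by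
  simp only [cellGraph, SimpleGraph.fromRel_adj]
  exact ⟨by simp, Or.inl ⟨.right, rfl⟩⟩

theorem cellGraph_adj_up (x y : ℤ) : cellGraph.Adj (x, y) (x, y + 1) := by
  simp only [cellGraph, SimpleGraph.fromRel_adj]
  exact ⟨by simp, Or.inl ⟨.up, rfl⟩⟩

theorem cellGraph_adj_cases {p q : Cell} (h : cellGraph.Adj p q) :
    q = (p.1 + 1, p.2) ∨ q = (p.1, p.2 + 1) ∨ p = (q.1 + 1, q.2) ∨ p = (q.1, q.2 + 1) := by
  obtain ⟨px, py⟩ := p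
  obtain ⟨qx, qy⟩ := q
  obtain ⟨d, hd⟩ := cellGraph_adj_step h
  cases d <;> simp only [Cell.step, Prod.mk.injEq] at hd ⊢ <;> omega

theorem reachable_of_adj {s : Set Cell} {z w : Cell} (hz : z ∈ s) (hw : w ∈ s)
    (h : cellGraph.Adj z w) : (cellGraph.induce s).Reachable ⟨z, hz⟩ ⟨w, hw⟩ :=
  SimpleGraph.Adj.reachable (by simpa using h)

/-- In a rectangle of unit squares, every square is connected with the lower left one. -/
theorem reachable_corner {s : Set Cell} {l r b t : ℤ}
    (hs : ∀ x y, l ≤ x → x < r → b ≤ y → y < t → ((x, y) : Cell) ∈ s) :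
    ∀ (n : ℕ) (x y : ℤ) (h1 : l ≤ x) (h2 : x < r) (h3 : b ≤ y) (h4 : y < t),
      (x - l) + (y - b) = n →
      (cellGraph.induce s).Reachable ⟨(x, y), hs x y h1 h2 h3 h4⟩
        ⟨(l, b), hs l b le_rfl (by omega) le_rfl (by omega)⟩ := by
  intro n
  induction n with
  | zero =>
    intro x y h1 h2 h3 h4 h
    obtain rfl : x = l := by push_cast at h; omega
    obtain rfl : y = b := by push_cast at h; omega
    exact SimpleGraph.Reachable.refl _
  | succ n ih =>
    intro x y h1 h2 h3 h4 h
    push_cast at h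
    by_cases hx : l < x
    · refine SimpleGraph.Reachable.trans ?_
        (ih (x - 1) y (by omega) (by omega) h3 h4 (by omega))
      refine (reachable_of_adj (hs (x - 1) y (by omega) (by omega) h3 h4) _ ?_).symm
      simpa using cellGraph_adj_right (x - 1) y
    · refine SimpleGraph.Reachable.trans ?_
        (ih x (y - 1) h1 h2 (by omega) (by omega) (by omega))
      refine (reachable_of_adj (hs x (y - 1) h1 h2 (by omega) (by omega)) _ ?_).symm
      simpa using cellGraph_adj_up x (y - 1)

/-- If the fibers of a map between lattices of squares are rectangles, and the fibers of adjacent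
squares touch along an edge, then the preimages of connected sets are connected. -/
theorem connected_preimage {A s : Set Cell} (π : Cell → Cell) (l r b t : Cell → ℤ)
    (hfib : ∀ p x y, π (x, y) = p ↔ (l p ≤ x ∧ x < r p) ∧ b p ≤ y ∧ y < t p)
    (hlr : ∀ p, l p < r p) (hbt : ∀ p, b p < t p)
    (hright : ∀ x y, ∃ z w, π z = (x, y) ∧ π w = (x + 1, y) ∧ cellGraph.Adj z w)
    (hup : ∀ x y, ∃ z w, π z = (x, y) ∧ π w = (x, y + 1) ∧ cellGraph.Adj z w)
    (hs : ∀ z, z ∈ s ↔ π z ∈ A) (hA : (cellGraph.induce A).Connected) :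
    (cellGraph.induce s).Connected := by
  have hmem : ∀ p ∈ A, ∀ x y, l p ≤ x → x < r p → b p ≤ y → y < t p → ((x, y) : Cell) ∈ s := by
    intro p hp x y h1 h2 h3 h4
    rw [hs, (hfib p x y).2 ⟨⟨h1, h2⟩, h3, h4⟩]
    exact hp
  have hrep : ∀ p : A, ((l p, b p) : Cell) ∈ s := fun p =>
    hmem p p.2 _ _ le_rfl (hlr p) le_rfl (hbt p)
  have hfiber : ∀ (z : Cell) (hz : z ∈ s) (p : A), π z = p →
      (cellGraph.induce s).Reachable ⟨z, hz⟩ ⟨(l p, b p), hrep p⟩ := by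
    rintro ⟨x, y⟩ hz p hp
    obtain ⟨⟨h1, h2⟩, h3, h4⟩ := (hfib p x y).1 hp
    exact reachable_corner (hmem p p.2) ((x - l p) + (y - b p)).toNat x y h1 h2 h3 h4
      (by omega)
  have hstep : ∀ (p q : A), (∃ z w, π z = p ∧ π w = q ∧ cellGraph.Adj z w) →
      (cellGraph.induce s).Reachable ⟨(l p, b p), hrep p⟩ ⟨(l q, b q), hrep q⟩ := by
    rintro p q ⟨z, w, hz, hw, h⟩
    have hz' : z ∈ s := by rw [hs, hz]; exact p.2
    have hw' : w ∈ s := by rw [hs, hw]; exact q.2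
    exact ((hfiber z hz' p hz).symm.trans (reachable_of_adj hz' hw' h)).trans
      (hfiber w hw' q hw)
  have hadj : ∀ (p q : A), (cellGraph.induce A).Adj p q →
      (cellGraph.induce s).Reachable ⟨(l p, b p), hrep p⟩ ⟨(l q, b q), hrep q⟩ := by
    intro p q h
    have h' : cellGraph.Adj (p : Cell) q := by simpa using h
    rcases cellGraph_adj_cases h' with e | e | e | e
    · exact hstep p q (by rw [e]; exact hright _ _)
    · exact hstep p q (by rw [e]; exact hup _ _)
    · exact (hstep q p (by rw [e]; exact hright _ _)).symm
    · exact (hstep q p (by rw [e]; exact hup _ _)).symm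
  have hreach : ∀ p q : A,
      (cellGraph.induce s).Reachable ⟨(l p, b p), hrep p⟩ ⟨(l q, b q), hrep q⟩ := by
    intro p q
    obtain ⟨walk⟩ := hA.preconnected p q
    induction walk with
    | nil => exact SimpleGraph.Reachable.refl _
    | cons h _ ih => exact (hadj _ _ h).trans ih
  obtain ⟨p₀⟩ := hA.nonempty
  have : Nonempty s := ⟨⟨_, hrep p₀⟩⟩
  refine SimpleGraph.Connected.mk ?_
  rintro ⟨z, hz⟩ ⟨w, hw⟩
  have hz' := (hs z).1 hz
  have hw' := (hs w).1 hw
  exact ((hfiber z hz ⟨_, hz'⟩ rfl).trans (hreach ⟨_, hz'⟩ ⟨_, hw'⟩)).trans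
    (hfiber w hw ⟨_, hw'⟩ rfl).symm

/-! ### Boxes of four bricks -/

/-- The box to which a brick belongs: the box `p` consists of the four bricks around the vertex
`(2 * p.1, 2 * p.2)`. -/
def boxOf (c : Cell) : Cell := ((c.1 + 1) / 2, (c.2 + 1) / 2)

/-- The four bricks of the box `p`. -/
noncomputable def boxBricks (p : Cell) : Finset Cell :=
  Finset.Ico (2 * p.1 - 1) (2 * p.1 + 1) ×ˢ Finset.Ico (2 * p.2 - 1) (2 * p.2 + 1)

theorem boxOf_eq_iff {c p : Cell} : boxOf c = p ↔
    (2 * p.1 - 1 ≤ c.1 ∧ c.1 < 2 * p.1 + 1) ∧ 2 * p.2 - 1 ≤ c.2 ∧ c.2 < 2 * p.2 + 1 := by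
  obtain ⟨x, y⟩ := p
  simp only [boxOf, Prod.mk.injEq]
  omega

theorem mem_boxBricks {c p : Cell} : c ∈ boxBricks p ↔ boxOf c = p := by
  rw [boxOf_eq_iff]
  simp [boxBricks]

/-- The unit squares in the bricks of the boxes in `G`. -/
noncomputable def brickRegion (S : ℤ) (v : Cell → ℤ) (G : Finset Cell) : Finset Cell :=
  G.biUnion fun p => (boxBricks p).biUnion (brick S v)

theorem mem_brickRegion {S : ℤ} {v : Cell → ℤ} {G : Finset Cell} {z : Cell} :
    z ∈ brickRegion S v G ↔ ∃ c, boxOf c ∈ G ∧ z ∈ brick S v c := by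
  simp only [brickRegion, Finset.mem_biUnion, mem_boxBricks]
  constructor
  · rintro ⟨p, hp, c, rfl, h⟩
    exact ⟨c, hp, h⟩
  · rintro ⟨c, hp, h⟩
    exact ⟨_, hp, c, rfl, h⟩

section
variable {S g : ℤ} {v v' : Cell → ℤ}

theorem mem_brickRegion_iff_of_mem_brick (hS : g < S) (hg : 0 ≤ g) (hv : OffsetsIn g v)
    {G : Finset Cell} {z c : Cell} (hc : z ∈ brick S v c) :
    z ∈ brickRegion S v G ↔ boxOf c ∈ G := by
  rw [mem_brickRegion]
  constructor
  · rintro ⟨c', h1, h2⟩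
    rwa [brick_unique hS hg hv hc h2]
  · exact fun h => ⟨c, h, hc⟩

/-- The region covered by the boxes in `G` only depends on the offsets at the vertices that lie
on the boundary of `G`. -/
theorem brickRegion_congr (hS : g < S) (hg : 0 ≤ g) (hv : OffsetsIn g v)
    (hv' : OffsetsIn g v') {G : Finset Cell}
    (hG : ∀ u, v u ≠ v' u → ∀ c c', Incident u c → Incident u c' → boxOf c ∈ G → boxOf c' ∈ G) :
    brickRegion S v G = brickRegion S v' G := by
  ext z
  rw [mem_brickRegion, mem_brickRegion]
  constructor
  · rintro ⟨c, hc, hz⟩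
    exact biUnion_brick_subset (A := {c | boxOf c ∈ G}) hS hg hv hv' hG hc hz
  · rintro ⟨c, hc, hz⟩
    exact biUnion_brick_subset (A := {c | boxOf c ∈ G}) hS hg hv' hv
      (fun u hu => hG u hu.symm) hc hz

theorem mem_brick_of_bounds (hv : OffsetsIn g v) {x y a b : ℤ}
    (h1 : S * a + g ≤ x) (h2 : x < S * (a + 1)) (h3 : S * b + g ≤ y) (h4 : y < S * (b + 1)) :
    ((x, y) : Cell) ∈ brick S v (a, b) := by
  rw [mem_brick]
  have := edgeX_bounds (S := S) hv a b
  have := edgeX_bounds (S := S) hv (a + 1) b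
  have := edgeY_bounds (S := S) hv a b
  have := edgeY_bounds (S := S) hv a (b + 1)
  dsimp only
  omega

/-- The bricks are the fibers of the map from unit squares to brick indices, and adjacent bricks
share an edge, so connectedness passes from a set of indices to the union of its bricks. Stated for
arbitrary sets, it serves the region and its complement alike. -/
theorem brick_connected (hS : g < S) (hg : 0 ≤ g) (hv : OffsetsIn g v) {A s : Set Cell}
    (hs : ∀ z c, z ∈ brick S v c → (z ∈ s ↔ c ∈ A)) (hA : (cellGraph.induce A).Connected) :
    (cellGraph.induce s).Connected := by
  choose π hπ using fun z => exists_brick hS hg hv z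
  have hiff : ∀ z c, π z = c ↔ z ∈ brick S v c := fun z c =>
    ⟨fun h => h ▸ hπ z, fun h => brick_unique hS hg hv (hπ z) h⟩
  have e : ∀ a : ℤ, S * (a + 1) = S * a + S := fun a => by ring
  refine connected_preimage π (fun c => edgeX S v c.1 c.2) (fun c => edgeX S v (c.1 + 1) c.2)
    (fun c => edgeY S v c.1 c.2) (fun c => edgeY S v c.1 (c.2 + 1)) ?_ ?_ ?_ ?_ ?_ ?_ hA
  · intro p x y
    rw [hiff, mem_brick]
  · intro c
    have h1 := edgeX_bounds (S := S) hv c.1 c.2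
    have h2 := edgeX_bounds (S := S) hv (c.1 + 1) c.2
    have := e c.1
    omega
  · intro c
    have h1 := edgeY_bounds (S := S) hv c.1 c.2
    have h2 := edgeY_bounds (S := S) hv c.1 (c.2 + 1)
    have := e c.2
    omega
  · intro a b
    -- The level `S * b + g` is above the lower sides of both bricks whatever the offsets are; the
    -- witnesses are the two squares on either side of the common wall at this level.
    refine ⟨(edgeX S v (a + 1) b - 1, S * b + g), (edgeX S v (a + 1) b, S * b + g), ?_, ?_, ?_⟩
    · rw [hiff, mem_brick]
      have := edgeX_bounds (S := S) hv a b
      have := edgeX_bounds (S := S) hv (a + 1) b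
      have := edgeY_bounds (S := S) hv a b
      have := edgeY_bounds (S := S) hv a (b + 1)
      have := e a
      have := e b
      dsimp only
      omega
    · rw [hiff, mem_brick]
      have := edgeX_bounds (S := S) hv (a + 1) b
      have := edgeX_bounds (S := S) hv (a + 1 + 1) b
      have := edgeY_bounds (S := S) hv (a + 1) b
      have := edgeY_bounds (S := S) hv (a + 1) (b + 1)
      have := e (a + 1)
      have := e b
      dsimp only
      omega
    · simpa using cellGraph_adj_right (edgeX S v (a + 1) b - 1) (S * b + g)
  · intro a b
    refine ⟨(S * a + g, edgeY S v a (b + 1) - 1), (S * a + g, edgeY S v a (b + 1)), ?_, ?_, ?_⟩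
    · rw [hiff, mem_brick]
      have := edgeX_bounds (S := S) hv a b
      have := edgeX_bounds (S := S) hv (a + 1) b
      have := edgeY_bounds (S := S) hv a b
      have := edgeY_bounds (S := S) hv a (b + 1)
      have := e a
      have := e b
      dsimp only
      omega
    · rw [hiff, mem_brick]
      have := edgeX_bounds (S := S) hv a (b + 1)
      have := edgeX_bounds (S := S) hv (a + 1) (b + 1)
      have := edgeY_bounds (S := S) hv a (b + 1)
      have := edgeY_bounds (S := S) hv a (b + 1 + 1)
      have := e a
      have := e (b + 1)
      dsimp only
      omega
    · simpa using cellGraph_adj_up (S * a + g) (edgeY S v a (b + 1) - 1)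
  · exact fun z => hs z (π z) (hπ z)

theorem boxOf_connected {A : Set Cell} (hA : (cellGraph.induce A).Connected) :
    (cellGraph.induce {c | boxOf c ∈ A}).Connected := by
  refine connected_preimage boxOf (fun p => 2 * p.1 - 1) (fun p => 2 * p.1 + 1)
    (fun p => 2 * p.2 - 1) (fun p => 2 * p.2 + 1) (fun p x y => boxOf_eq_iff)
    (fun p => by omega) (fun p => by omega) ?_ ?_ (fun z => Iff.rfl) hA
  · intro x y
    refine ⟨(2 * x, 2 * y), (2 * x + 1, 2 * y), ?_, ?_, cellGraph_adj_right _ _⟩ <;>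
      rw [boxOf_eq_iff] <;> dsimp only <;> omega
  · intro x y
    refine ⟨(2 * x, 2 * y), (2 * x, 2 * y + 1), ?_, ?_, cellGraph_adj_up _ _⟩ <;>
      rw [boxOf_eq_iff] <;> dsimp only <;> omega

/-- Replacing the squares of a simply connected region by boxes gives a simply connected
region. -/
theorem isSimplyConnectedRegion_brickRegion (hS : g < S) (hg : 0 ≤ g) (hv : OffsetsIn g v)
    {G : Finset Cell} (hG : IsSimplyConnectedRegion G) :
    IsSimplyConnectedRegion (brickRegion S v G) where
  connected := brick_connected hS hg hv
    (fun _ _ hz => mem_brickRegion_iff_of_mem_brick hS hg hv hz) (boxOf_connected hG.connected)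
  compl_connected := brick_connected hS hg hv
    (fun _ _ hz => not_congr (mem_brickRegion_iff_of_mem_brick hS hg hv hz))
    (boxOf_connected hG.compl_connected)

end

/-! ### A set of integers without additive coincidences -/

/-- The last digit in base 4 counts the vanishing exponents on each side; if there are none, divide
by 4. -/
theorem four_pow_pair {a b d e : ℕ} (h : 4 ^ a + 4 ^ b = 4 ^ d + 4 ^ e) : a = d ∨ a = e := by
  induction a generalizing b d e with
  | zero =>
    rcases d with _ | d <;> rcases e with _ | e <;> rcases b with _ | b <;>
      simp only [pow_succ, pow_zero] at h <;> omega
  | succ a ih =>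
    have inj : ∀ n m : ℕ, 4 ^ n = 4 ^ m → n = m := fun n m h =>
      Nat.pow_right_injective (le_refl 2 |>.trans (by norm_num)) h
    rcases b with _ | b
    · rcases d with _ | d
      · have := inj (a + 1) e (by omega)
        omega
      · rcases e with _ | e
        · have := inj (a + 1) (d + 1) (by omega)
          omega
        · simp only [pow_succ, pow_zero] at h
          omega
    · rcases d with _ | d <;> rcases e with _ | e <;> simp only [pow_succ, pow_zero] at h
      · omega
      · omega
      · omega
      · have := @ih b d e (by omega)
        omega

/-- Three summands still produce no carry in base 4. Sums of three codes arise when a rectangle lies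
on top of one that might belong to a wrong tile. -/
theorem four_pow_triple {a b c d e f : ℕ}
    (h : 4 ^ a + 4 ^ b + 4 ^ c = 4 ^ d + 4 ^ e + 4 ^ f) : a = d ∨ a = e ∨ a = f := by
  induction a generalizing b c d e f with
  | zero =>
    rcases d with _ | d <;> rcases e with _ | e <;> rcases f with _ | f <;>
      rcases b with _ | b <;> rcases c with _ | c <;>
      simp only [pow_succ, pow_zero] at h <;> omega
  | succ a ih =>
    have key : b = 0 ∨ c = 0 ∨ (b ≠ 0 ∧ c ≠ 0) := by omega
    -- A summand `1` on the left needs a summand `1` on the right, by reduction modulo 4; cancelling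
    -- both leaves two powers on each side.
    have two : ∀ x, 1 + 4 ^ (a + 1) + 4 ^ x = 4 ^ d + 4 ^ e + 4 ^ f →
        a + 1 = d ∨ a + 1 = e ∨ a + 1 = f := by
      intro x hx
      rcases d with _ | d
      · have := @four_pow_pair (a + 1) x e f (by omega)
        omega
      · rcases e with _ | e
        · have := @four_pow_pair (a + 1) x (d + 1) f (by omega)
          omega
        · rcases f with _ | f
          · have := @four_pow_pair (a + 1) x (d + 1) (e + 1) (by omega)
            omega
          · rcases x with _ | x <;> simp only [pow_succ, pow_zero] at hx <;> omega
    rcases key with rfl | rfl | ⟨hb, hc⟩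
    · exact two c (by rw [pow_zero] at h; omega)
    · exact two b (by rw [pow_zero] at h; omega)
    · obtain ⟨b, rfl⟩ := Nat.exists_eq_succ_of_ne_zero hb
      obtain ⟨c, rfl⟩ := Nat.exists_eq_succ_of_ne_zero hc
      rcases d with _ | d <;> rcases e with _ | e <;> rcases f with _ | f <;>
        simp only [Nat.succ_eq_add_one, pow_succ, pow_zero] at h
      case succ.succ.succ =>
        have := @ih b c d e f (by omega)
        omega
      all_goals omega

/-! ### States of vertices -/

/-- The state of a vertex: its coordinates modulo `4`, and what it shows: the color of an edge,
a tile, or nothing. -/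
abbrev VState (κ ω : Type) : Type := (ZMod 4 × ZMod 4) × Option (κ ⊕ ω)

section
variable {κ ω : Type} [Fintype κ] [Fintype ω]

/-- The offset of a vertex in a given state. -/
noncomputable def code (s : VState κ ω) : ℤ := 4 ^ (Fintype.equivFin (VState κ ω) s : ℕ)

variable (κ ω) in
/-- An upper bound for the offsets. -/
noncomputable def maxCode : ℤ := 4 ^ Fintype.card (VState κ ω)

variable (κ ω) in
/-- The mesh of the grid. -/
noncomputable def mesh : ℤ := 16 * maxCode κ ω

variable (κ ω) in
theorem maxCode_pos : 0 < maxCode κ ω := by unfold maxCode; positivity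

variable (κ ω) in
theorem maxCode_lt_mesh : maxCode κ ω < mesh κ ω := by
  have := maxCode_pos κ ω
  unfold mesh
  omega

theorem code_bounds (s : VState κ ω) : 0 ≤ code s ∧ code s ≤ maxCode κ ω :=
  ⟨by unfold code; positivity, pow_le_pow_right₀ (by norm_num) (Fin.is_lt _).le⟩

theorem code_eq_cast (s : VState κ ω) :
    code s = ((4 ^ (Fintype.equivFin (VState κ ω) s : ℕ) : ℕ) : ℤ) := by simp [code]

theorem index_inj {s t : VState κ ω}
    (h : (Fintype.equivFin (VState κ ω) s : ℕ) = (Fintype.equivFin (VState κ ω) t : ℕ)) : s = t :=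
  (Fintype.equivFin (VState κ ω)).injective (Fin.ext h)

theorem code_injective {s t : VState κ ω} (h : code s = code t) : s = t := by
  rw [code_eq_cast, code_eq_cast] at h
  exact index_inj (Nat.pow_right_injective (le_refl 2 |>.trans (by norm_num)) (Int.ofNat.inj h))

theorem code_pair {a b d e : VState κ ω} (h : code a + code b = code d + code e) :
    a = d ∨ a = e := by
  simp only [code_eq_cast] at h
  exact (four_pow_pair (by exact_mod_cast h)).imp index_inj index_inj

theorem code_triple {a b c d e f : VState κ ω}
    (h : code a + code b + code c = code d + code e + code f) : a = d ∨ a = e ∨ a = f := by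
  simp only [code_eq_cast] at h
  exact (four_pow_triple (by exact_mod_cast h)).imp index_inj (Or.imp index_inj index_inj)

/-- A difference of two offsets determines the states. -/
theorem code_sub {a b d e : VState κ ω} (hab : a ≠ b) (h : code a - code b = code d - code e) :
    a = d ∧ b = e := by
  have h1 : a = d := (code_pair (a := a) (b := e) (d := d) (e := b) (by omega)).resolve_right hab
  subst h1
  exact ⟨rfl, code_injective (by omega)⟩

/-- The class of a vertex. -/
def vclass (u : Cell) : ZMod 4 × ZMod 4 := ((u.1 : ZMod 4), (u.2 : ZMod 4))

theorem intCast_eq_iff (i j : ℤ) : (i : ZMod 4) = (j : ZMod 4) ↔ i % 4 = j % 4 :=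
  ZMod.intCast_eq_intCast_iff' i j 4

theorem vclass_eq_iff {u w : Cell} : vclass u = vclass w ↔ u.1 % 4 = w.1 % 4 ∧ u.2 % 4 = w.2 % 4 := by
  simp [vclass, intCast_eq_iff]

/-! ### The rectangles of a Wang tile -/

/-- What a box with the tile `w` shows at the vertex with coordinates `d` relative to the center
of the box. -/
def tileContent (tc : ω → Dir → κ) (w : ω) (d : Cell) : Option (κ ⊕ ω) :=
  if d.1 = 0 then
    if d.2 = 0 then some (.inr w)
    else if d.2 = 1 then some (.inl (tc w .up)) else some (.inl (tc w .down))
  else if d.2 = 0 then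
    if d.1 = 1 then some (.inl (tc w .right)) else some (.inl (tc w .left))
  else none

/-- The offset at the vertex `u` of the box `p` with the tile `w`. -/
noncomputable def tileOffset (tc : ω → Dir → κ) (w : ω) (p u : Cell) : ℤ :=
  code (vclass u, tileContent tc w (u.1 - 2 * p.1, u.2 - 2 * p.2))

/-- The natural number with a given positive value. -/
def toPos (z : ℤ) : ℕ+ := z.toNat.toPNat'

theorem coe_toPos {z : ℤ} (hz : 0 < z) : ((toPos z : ℕ+) : ℤ) = z := by
  unfold toPos
  have : 0 < z.toNat := by omega
  rw [Nat.toPNat'_coe, if_pos this]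
  omega

/-- The rectangle in the place of the brick `c` in a box with the tile `w`. -/
noncomputable def rectOf (tc : ω → Dir → κ) (w : ω) (c : Cell) : RectTile where
  height := toPos (edgeY (mesh κ ω) (tileOffset tc w (boxOf c)) c.1 (c.2 + 1) -
    edgeY (mesh κ ω) (tileOffset tc w (boxOf c)) c.1 c.2)
  width := toPos (edgeX (mesh κ ω) (tileOffset tc w (boxOf c)) (c.1 + 1) c.2 -
    edgeX (mesh κ ω) (tileOffset tc w (boxOf c)) c.1 c.2)

open scoped Classical in
/-- The set of all rectangles. -/
noncomputable def rects (tc : ω → Dir → κ) : Finset RectTile :=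
  (Finset.univ : Finset (ω × Fin 4 × Fin 4)).image fun x =>
    rectOf tc x.1 ((x.2.1 : ℕ), (x.2.2 : ℕ))

theorem card_rects_le (tc : ω → Dir → κ) : (rects tc).card ≤ 16 * Fintype.card ω := by
  classical
  refine Finset.card_image_le.trans ?_
  simp [Fintype.card_prod]
  omega

theorem offsetsIn_tileOffset (tc : ω → Dir → κ) (w : ω) (p : Cell) :
    OffsetsIn (maxCode κ ω) (tileOffset tc w p) := fun _ => code_bounds _

theorem width_rectOf (tc : ω → Dir → κ) (w : ω) (c : Cell) :
    ((rectOf tc w c).width : ℤ) = edgeX (mesh κ ω) (tileOffset tc w (boxOf c)) (c.1 + 1) c.2 -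
      edgeX (mesh κ ω) (tileOffset tc w (boxOf c)) c.1 c.2 := by
  have h1 := edgeX_bounds (S := mesh κ ω) (offsetsIn_tileOffset tc w (boxOf c)) c.1 c.2
  have h2 := edgeX_bounds (S := mesh κ ω) (offsetsIn_tileOffset tc w (boxOf c)) (c.1 + 1) c.2
  have := maxCode_lt_mesh κ ω
  rw [mul_add, mul_one] at h2
  exact coe_toPos (by omega)

theorem height_rectOf (tc : ω → Dir → κ) (w : ω) (c : Cell) :
    ((rectOf tc w c).height : ℤ) = edgeY (mesh κ ω) (tileOffset tc w (boxOf c)) c.1 (c.2 + 1) -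
      edgeY (mesh κ ω) (tileOffset tc w (boxOf c)) c.1 c.2 := by
  have h1 := edgeY_bounds (S := mesh κ ω) (offsetsIn_tileOffset tc w (boxOf c)) c.1 c.2
  have h2 := edgeY_bounds (S := mesh κ ω) (offsetsIn_tileOffset tc w (boxOf c)) c.1 (c.2 + 1)
  have := maxCode_lt_mesh κ ω
  rw [mul_add, mul_one] at h2
  exact coe_toPos (by omega)

theorem tileOffset_add (tc : ω → Dir → κ) (w : ω) (x y k l i j : ℤ) :
    tileOffset tc w (x + 2 * k, y + 2 * l) (i + 4 * k, j + 4 * l) =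
      tileOffset tc w (x, y) (i, j) := by
  unfold tileOffset
  congr 2
  · rw [vclass_eq_iff]
    dsimp only
    omega
  · congr 2 <;> ring

theorem boxOf_add (a b k l : ℤ) :
    boxOf (a + 4 * k, b + 4 * l) = ((boxOf (a, b)).1 + 2 * k, (boxOf (a, b)).2 + 2 * l) := by
  simp only [boxOf, Prod.mk.injEq]
  omega

theorem edgeX_add {S : ℤ} {v v' : Cell → ℤ} (a b k l : ℤ)
    (h : ∀ i j, v' (i + 4 * k, j + 4 * l) = v (i, j)) :
    edgeX S v' (a + 4 * k) (b + 4 * l) = edgeX S v a b + S * (4 * k) := by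
  unfold edgeX
  have e : (a + 4 * k + (b + 4 * l)) % 2 = (a + b) % 2 := by omega
  rw [e, ← h a b, ← h a (b + 1), show b + 1 + 4 * l = b + 4 * l + 1 by ring]
  ring

theorem edgeY_add {S : ℤ} {v v' : Cell → ℤ} (a b k l : ℤ)
    (h : ∀ i j, v' (i + 4 * k, j + 4 * l) = v (i, j)) :
    edgeY S v' (a + 4 * k) (b + 4 * l) = edgeY S v a b + S * (4 * l) := by
  unfold edgeY
  have e : (a + 4 * k + (b + 4 * l)) % 2 = (a + b) % 2 := by omega
  rw [e, ← h a b, ← h (a + 1) b, show a + 1 + 4 * k = a + 4 * k + 1 by ring]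
  ring

/-- Four vertices are two boxes: such a shift preserves both the classes of vertices and their
positions relative to the center. Hence sixteen positions for each tile give all rectangles. -/
theorem rectOf_add (tc : ω → Dir → κ) (w : ω) (a b k l : ℤ) :
    rectOf tc w (a + 4 * k, b + 4 * l) = rectOf tc w (a, b) := by
  have h : ∀ i j, tileOffset tc w (boxOf (a + 4 * k, b + 4 * l)) (i + 4 * k, j + 4 * l) =
      tileOffset tc w (boxOf (a, b)) (i, j) := by
    intro i j
    rw [boxOf_add]
    exact tileOffset_add tc w _ _ _ _ _ _
  unfold rectOf
  dsimp only
  rw [edgeX_add a b k l h, edgeY_add a b k l h,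
    show a + 4 * k + 1 = a + 1 + 4 * k by ring, show b + 4 * l + 1 = b + 1 + 4 * l by ring,
    edgeX_add (a + 1) b k l h, edgeY_add a (b + 1) k l h, add_sub_add_right_eq_sub,
    add_sub_add_right_eq_sub]

theorem mem_rects {tc : ω → Dir → κ} {t : RectTile} :
    t ∈ rects tc ↔ ∃ w c, t = rectOf tc w c := by
  classical
  simp only [rects, Finset.mem_image, Finset.mem_univ, true_and]
  constructor
  · rintro ⟨x, rfl⟩
    exact ⟨_, _, rfl⟩
  · rintro ⟨w, ⟨a, b⟩, rfl⟩
    refine ⟨(w, ⟨(a % 4).toNat, by omega⟩, ⟨(b % 4).toNat, by omega⟩), ?_⟩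
    have h := rectOf_add tc w (a % 4) (b % 4) (a / 4) (b / 4)
    rw [Int.emod_add_mul_ediv, Int.emod_add_mul_ediv] at h
    rw [h]
    congr 2 <;> dsimp only <;> omega

end

/-! ### The region of boxes for a colored region -/

/-- A coloring of the boundary edges of `G`. -/
structure EdgeColoring (κ : Type) (G : Finset Cell) : Type where
  col : Cell → Dir → Option κ
  isSome_iff : ∀ p d, (col p d).isSome ↔ p ∈ G ∧ Cell.step p d ∉ G

section
variable {κ ω : Type} {G : Finset Cell}

theorem EdgeColoring.eq_none (E : EdgeColoring κ G) {p : Cell} {d : Dir}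
    (h : p ∈ G → Cell.step p d ∈ G) : E.col p d = none := by
  by_contra h'
  have := (E.isSome_iff p d).1 (Option.isSome_iff_ne_none.2 h')
  exact this.2 (h this.1)

theorem EdgeColoring.exists_eq_some (E : EdgeColoring κ G) {p : Cell} {d : Dir}
    (h : p ∈ G) (h' : Cell.step p d ∉ G) : ∃ b, E.col p d = some b :=
  Option.isSome_iff_exists.1 ((E.isSome_iff p d).2 ⟨h, h'⟩)

/-- The color shown on the left side of the square `p`: the color of the region if this is a
boundary edge, otherwise the color of the tile on the left. -/
def edgeL (E : EdgeColoring κ G) (tc : ω → Dir → κ) (θ : Cell → Option ω) (p : Cell) : Option κ :=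
  ((E.col p .left).or (E.col (p.1 - 1, p.2) .right)).or ((θ (p.1 - 1, p.2)).map (tc · .right))

/-- The color shown on the lower side of the square `p`. -/
def edgeB (E : EdgeColoring κ G) (tc : ω → Dir → κ) (θ : Cell → Option ω) (p : Cell) : Option κ :=
  ((E.col p .down).or (E.col (p.1, p.2 - 1) .up)).or ((θ (p.1, p.2 - 1)).map (tc · .up))

/-- What the vertex `u` shows. -/
def vertexContent (E : EdgeColoring κ G) (tc : ω → Dir → κ) (θ : Cell → Option ω) (u : Cell) :
    Option (κ ⊕ ω) :=
  if u.1 % 2 = 0 then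
    if u.2 % 2 = 0 then (θ (u.1 / 2, u.2 / 2)).map .inr
    else (edgeB E tc θ (u.1 / 2, (u.2 + 1) / 2)).map .inl
  else if u.2 % 2 = 0 then (edgeL E tc θ ((u.1 + 1) / 2, u.2 / 2)).map .inl
  else none

variable (E : EdgeColoring κ G) (tc : ω → Dir → κ) (θ : Cell → Option ω)

theorem vertexContent_center (x y : ℤ) :
    vertexContent E tc θ (2 * x, 2 * y) = (θ (x, y)).map .inr := by
  have h : ∀ z : ℤ, 2 * z % 2 = 0 := fun z => by omega
  have h' : ∀ z : ℤ, 2 * z / 2 = z := fun z => by omega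
  simp [vertexContent, h, h']

theorem vertexContent_left (x y : ℤ) :
    vertexContent E tc θ (2 * x - 1, 2 * y) = (edgeL E tc θ (x, y)).map .inl := by
  have h1 : (2 * x - 1) % 2 ≠ 0 := by omega
  have h2 : (2 * y) % 2 = 0 := by omega
  have h3 : (2 * x - 1 + 1) / 2 = x := by omega
  have h4 : 2 * y / 2 = y := by omega
  simp only [vertexContent, h1, h2, h3, h4, if_true, if_false]

theorem vertexContent_bot (x y : ℤ) :
    vertexContent E tc θ (2 * x, 2 * y - 1) = (edgeB E tc θ (x, y)).map .inl := by
  have h1 : (2 * y - 1) % 2 ≠ 0 := by omega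
  have h2 : (2 * x) % 2 = 0 := by omega
  have h3 : (2 * y - 1 + 1) / 2 = y := by omega
  have h4 : 2 * x / 2 = x := by omega
  simp only [vertexContent, h1, h2, h3, h4, if_true, if_false]

theorem vertexContent_corner {u : Cell} (h1 : u.1 % 2 = 1) (h2 : u.2 % 2 = 1) :
    vertexContent E tc θ u = none := by
  simp [vertexContent, h1, h2]

variable {E tc θ}

theorem edgeL_of_notMem {x y : ℤ} (hp : (x, y) ∈ G) (hl : (x - 1, y) ∉ G) :
    edgeL E tc θ (x, y) = E.col (x, y) .left := by
  obtain ⟨b, hb⟩ := E.exists_eq_some (d := .left) hp hl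
  simp [edgeL, hb]

theorem edgeL_of_mem {x y : ℤ} (hp : (x, y) ∈ G) (hl : (x - 1, y) ∈ G) :
    edgeL E tc θ (x, y) = (θ (x - 1, y)).map (tc · .right) := by
  have h1 : E.col (x, y) .left = none := E.eq_none fun _ => hl
  have h2 : E.col (x - 1, y) .right = none := E.eq_none fun _ => by simpa [Cell.step] using hp
  simp [edgeL, h1, h2]

theorem edgeL_of_right_notMem {x y : ℤ} (hp : (x, y) ∈ G) (hr : (x + 1, y) ∉ G) :
    edgeL E tc θ (x + 1, y) = E.col (x, y) .right := by
  obtain ⟨b, hb⟩ := E.exists_eq_some (d := .right) hp hr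
  have h1 : E.col (x + 1, y) .left = none := E.eq_none fun h => absurd h hr
  simp [edgeL, hb, h1]

theorem edgeB_of_notMem {x y : ℤ} (hp : (x, y) ∈ G) (hl : (x, y - 1) ∉ G) :
    edgeB E tc θ (x, y) = E.col (x, y) .down := by
  obtain ⟨b, hb⟩ := E.exists_eq_some (d := .down) hp hl
  simp [edgeB, hb]

theorem edgeB_of_mem {x y : ℤ} (hp : (x, y) ∈ G) (hl : (x, y - 1) ∈ G) :
    edgeB E tc θ (x, y) = (θ (x, y - 1)).map (tc · .up) := by
  have h1 : E.col (x, y) .down = none := E.eq_none fun _ => hl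
  have h2 : E.col (x, y - 1) .up = none := E.eq_none fun _ => by simpa [Cell.step] using hp
  simp [edgeB, h1, h2]

theorem edgeB_of_up_notMem {x y : ℤ} (hp : (x, y) ∈ G) (hr : (x, y + 1) ∉ G) :
    edgeB E tc θ (x, y + 1) = E.col (x, y) .up := by
  obtain ⟨b, hb⟩ := E.exists_eq_some (d := .up) hp hr
  have h1 : E.col (x, y + 1) .down = none := E.eq_none fun h => absurd h hr
  simp [edgeB, hb, h1]

/-- A Wang tiling of `G`, as a partial function on the whole lattice. -/
structure IsWangMap (E : EdgeColoring κ G) (tc : ω → Dir → κ) (θ : Cell → Option ω) : Prop where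
  isSome_iff : ∀ p, (θ p).isSome ↔ p ∈ G
  right : ∀ x y w w', θ (x, y) = some w → θ (x + 1, y) = some w' → tc w .right = tc w' .left
  up : ∀ x y w w', θ (x, y) = some w → θ (x, y + 1) = some w' → tc w .up = tc w' .down
  boundary : ∀ p w d b, θ p = some w → E.col p d = some b → tc w d = b

theorem IsWangMap.mem (h : IsWangMap E tc θ) {p : Cell} {w : ω} (hw : θ p = some w) : p ∈ G :=
  (h.isSome_iff p).1 (by simp [hw])

/-- A vertical side inside the region shows the color of the tile on its left, so the matching
condition is what makes this also the color of the tile on its right. On the boundary the condition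
on prescribed colors takes its place. -/
theorem IsWangMap.edge_left (h : IsWangMap E tc θ) {x y : ℤ} {w : ω} (hw : θ (x, y) = some w) :
    edgeL E tc θ (x, y) = some (tc w .left) := by
  by_cases hl : (x - 1, y) ∈ G
  · rw [edgeL_of_mem (h.mem hw) hl]
    obtain ⟨w', hw'⟩ := Option.isSome_iff_exists.1 ((h.isSome_iff _).2 hl)
    simp [hw', h.right (x - 1) y w' w hw' (by simpa using hw)]
  · rw [edgeL_of_notMem (h.mem hw) hl]
    obtain ⟨b, hb⟩ := E.exists_eq_some (d := .left) (h.mem hw) hl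
    rw [hb, h.boundary _ _ _ _ hw hb]

theorem IsWangMap.edge_right (h : IsWangMap E tc θ) {x y : ℤ} {w : ω} (hw : θ (x, y) = some w) :
    edgeL E tc θ (x + 1, y) = some (tc w .right) := by
  by_cases hl : (x + 1, y) ∈ G
  · rw [edgeL_of_mem hl (by simpa using h.mem hw)]
    simp [hw]
  · rw [edgeL_of_right_notMem (h.mem hw) hl]
    obtain ⟨b, hb⟩ := E.exists_eq_some (d := .right) (h.mem hw) hl
    rw [hb, h.boundary _ _ _ _ hw hb]

theorem IsWangMap.edge_down (h : IsWangMap E tc θ) {x y : ℤ} {w : ω} (hw : θ (x, y) = some w) :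
    edgeB E tc θ (x, y) = some (tc w .down) := by
  by_cases hl : (x, y - 1) ∈ G
  · rw [edgeB_of_mem (h.mem hw) hl]
    obtain ⟨w', hw'⟩ := Option.isSome_iff_exists.1 ((h.isSome_iff _).2 hl)
    simp [hw', h.up x (y - 1) w' w hw' (by simpa using hw)]
  · rw [edgeB_of_notMem (h.mem hw) hl]
    obtain ⟨b, hb⟩ := E.exists_eq_some (d := .down) (h.mem hw) hl
    rw [hb, h.boundary _ _ _ _ hw hb]

theorem IsWangMap.edge_up (h : IsWangMap E tc θ) {x y : ℤ} {w : ω} (hw : θ (x, y) = some w) :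
    edgeB E tc θ (x, y + 1) = some (tc w .up) := by
  by_cases hl : (x, y + 1) ∈ G
  · rw [edgeB_of_mem hl (by simpa using h.mem hw)]
    simp [hw]
  · rw [edgeB_of_up_notMem (h.mem hw) hl]
    obtain ⟨b, hb⟩ := E.exists_eq_some (d := .up) (h.mem hw) hl
    rw [hb, h.boundary _ _ _ _ hw hb]

/-- The values shown at the vertices of a box with center `(2 * x, 2 * y)` are those of the
tile `w`. -/
theorem vertexContent_eq_tileContent {x y i j : ℤ} {w : ω}
    (hi : 2 * x - 1 ≤ i ∧ i ≤ 2 * x + 1) (hj : 2 * y - 1 ≤ j ∧ j ≤ 2 * y + 1)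
    (hθ : i = 2 * x → j = 2 * y → θ (x, y) = some w)
    (hl : i = 2 * x - 1 → j = 2 * y → edgeL E tc θ (x, y) = some (tc w .left))
    (hr : i = 2 * x + 1 → j = 2 * y → edgeL E tc θ (x + 1, y) = some (tc w .right))
    (hd : i = 2 * x → j = 2 * y - 1 → edgeB E tc θ (x, y) = some (tc w .down))
    (hu : i = 2 * x → j = 2 * y + 1 → edgeB E tc θ (x, y + 1) = some (tc w .up)) :
    vertexContent E tc θ (i, j) = tileContent tc w (i - 2 * x, j - 2 * y) := by
  have hi' : i = 2 * x - 1 ∨ i = 2 * x ∨ i = 2 * x + 1 := by omega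
  have hj' : j = 2 * y - 1 ∨ j = 2 * y ∨ j = 2 * y + 1 := by omega
  have er := vertexContent_left E tc θ (x + 1) y
  have eu := vertexContent_bot E tc θ x (y + 1)
  rw [show 2 * (x + 1) - 1 = 2 * x + 1 by ring] at er
  rw [show 2 * (y + 1) - 1 = 2 * y + 1 by ring] at eu
  rcases hi' with rfl | rfl | rfl
  · rcases hj' with rfl | rfl | rfl
    · rw [vertexContent_corner] <;> simp [tileContent]
    · rw [vertexContent_left, hl rfl rfl]
      simp [tileContent]
    · rw [vertexContent_corner] <;> simp [tileContent]
  · rcases hj' with rfl | rfl | rfl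
    · rw [vertexContent_bot, hd rfl rfl]
      simp [tileContent]
    · rw [vertexContent_center, hθ rfl rfl]
      simp [tileContent]
    · rw [eu, hu rfl rfl]
      simp [tileContent]
  · rcases hj' with rfl | rfl | rfl
    · rw [vertexContent_corner] <;> simp [tileContent]
    · rw [er, hr rfl rfl]
      simp [tileContent]
    · rw [vertexContent_corner] <;> simp [tileContent]

theorem incident_bounds {u c : Cell} (h : Incident u c) :
    (2 * (boxOf c).1 - 1 ≤ u.1 ∧ u.1 ≤ 2 * (boxOf c).1 + 1) ∧
      2 * (boxOf c).2 - 1 ≤ u.2 ∧ u.2 ≤ 2 * (boxOf c).2 + 1 := by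
  have := boxOf_eq_iff.1 (rfl : boxOf c = boxOf c)
  unfold Incident at h
  omega

theorem IsWangMap.vertexContent_eq (h : IsWangMap E tc θ) {u c : Cell} {w : ω}
    (hw : θ (boxOf c) = some w) (hu : Incident u c) :
    vertexContent E tc θ u =
      tileContent tc w (u.1 - 2 * (boxOf c).1, u.2 - 2 * (boxOf c).2) := by
  have hb := incident_bounds hu
  exact vertexContent_eq_tileContent hb.1 hb.2 (fun _ _ => hw) (fun _ _ => h.edge_left hw)
    (fun _ _ => h.edge_right hw) (fun _ _ => h.edge_down hw) (fun _ _ => h.edge_up hw)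

/-! ### The region of boxes and the rectangles of a Wang tiling -/

variable [Fintype κ] [Fintype ω]

variable (E tc θ) in
/-- The offsets of the vertices. -/
noncomputable def vertexOffset (u : Cell) : ℤ := code (vclass u, vertexContent E tc θ u)

variable (E tc θ) in
theorem offsetsIn_vertexOffset : OffsetsIn (maxCode κ ω) (vertexOffset E tc θ) :=
  fun _ => code_bounds _

variable (E tc) in
/-- The region of boxes for a colored region. -/
noncomputable def boxRegion : Finset Cell :=
  brickRegion (mesh κ ω) (vertexOffset E tc fun _ => none) G

/-- The region of boxes does not depend on the tiles inside. -/
theorem brickRegion_eq_boxRegion (hθ : ∀ p, p ∉ G → θ p = none) :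
    brickRegion (mesh κ ω) (vertexOffset E tc θ) G = boxRegion E tc := by
  refine brickRegion_congr (maxCode_lt_mesh κ ω) (maxCode_pos κ ω).le
    (offsetsIn_vertexOffset E tc θ) (offsetsIn_vertexOffset E tc _) ?_
  rintro ⟨i, j⟩ hu c c' hc hc' hG
  have hne : vertexContent E tc θ (i, j) ≠ vertexContent E tc (fun _ => none) (i, j) := by
    intro h
    exact hu (by simp only [vertexOffset, h])
  have b1 := incident_bounds hc
  have b2 := incident_bounds hc'
  dsimp only at b1 b2
  generalize boxOf c = p at *
  generalize boxOf c' = q at *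
  obtain ⟨x, y⟩ := p
  obtain ⟨x', y'⟩ := q
  dsimp only at b1 b2
  -- Tiles affect only centers and midpoints of sides. A center belongs to a single box. A midpoint
  -- whose content changes has boxes of `G` on both sides, because a side on the boundary shows its
  -- prescribed color in any case.
  rcases Int.emod_two_eq i with hi | hi <;> rcases Int.emod_two_eq j with hj | hj
  · obtain rfl : x' = x := by omega
    obtain rfl : y' = y := by omega
    exact hG
  · obtain rfl : x' = x := by omega
    obtain ⟨l, rfl⟩ : ∃ l, j = 2 * l - 1 := ⟨(j + 1) / 2, by omega⟩
    obtain rfl : i = 2 * x' := by omega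
    rw [vertexContent_bot, vertexContent_bot] at hne
    have key : (x', l - 1) ∈ G ∧ (x', l) ∈ G := by
      by_contra hk
      apply hne
      unfold edgeB
      dsimp only
      by_cases h1 : (x', l - 1) ∈ G
      · have h2 : (x', l) ∉ G := fun h => hk ⟨h1, h⟩
        obtain ⟨b, hb⟩ := E.exists_eq_some (d := .up) h1 (by simpa [Cell.step] using h2)
        simp [hb]
      · rw [hθ _ h1]
    have h3 : y' = l ∨ y' = l - 1 := by omega
    rcases h3 with rfl | rfl
    exacts [key.2, key.1]
  · obtain rfl : y' = y := by omega
    obtain ⟨l, rfl⟩ : ∃ l, i = 2 * l - 1 := ⟨(i + 1) / 2, by omega⟩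
    obtain rfl : j = 2 * y' := by omega
    rw [vertexContent_left, vertexContent_left] at hne
    have key : (l - 1, y') ∈ G ∧ (l, y') ∈ G := by
      by_contra hk
      apply hne
      unfold edgeL
      dsimp only
      by_cases h1 : (l - 1, y') ∈ G
      · have h2 : (l, y') ∉ G := fun h => hk ⟨h1, h⟩
        obtain ⟨b, hb⟩ := E.exists_eq_some (d := .right) h1 (by simpa [Cell.step] using h2)
        simp [hb]
      · rw [hθ _ h1]
    have h3 : x' = l ∨ x' = l - 1 := by omega
    rcases h3 with rfl | rfl
    exacts [key.2, key.1]
  · exact absurd ((vertexContent_corner E tc θ hi hj).trans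
      (vertexContent_corner E tc _ hi hj).symm) hne

/-- The brick `c` is the rectangle of the tile `w` if its vertices show the values of `w`. -/
theorem edges_eq {c : Cell} {w : ω} (h : ∀ u, Incident u c → vertexContent E tc θ u =
      tileContent tc w (u.1 - 2 * (boxOf c).1, u.2 - 2 * (boxOf c).2)) :
    edgeX (mesh κ ω) (vertexOffset E tc θ) (c.1 + 1) c.2 -
        edgeX (mesh κ ω) (vertexOffset E tc θ) c.1 c.2 = (rectOf tc w c).width ∧
    edgeY (mesh κ ω) (vertexOffset E tc θ) c.1 (c.2 + 1) -
        edgeY (mesh κ ω) (vertexOffset E tc θ) c.1 c.2 = (rectOf tc w c).height := by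
  have e : ∀ i j : ℤ, (i = c.1 ∨ i = c.1 + 1) → (j = c.2 ∨ j = c.2 + 1) →
      vertexOffset E tc θ (i, j) = tileOffset tc w (boxOf c) (i, j) := by
    intro i j h1 h2
    have := h (i, j) ⟨h1, h2⟩
    simp only [vertexOffset, tileOffset, this]
  rw [width_rectOf, height_rectOf]
  rcases Int.emod_two_eq (c.1 + c.2) with par | par
  · rw [edgeX_even _ _ par, edgeX_even _ _ par, edgeX_odd _ _ (by omega), edgeX_odd _ _ (by omega),
      edgeY_even _ _ par, edgeY_even _ _ par, edgeY_odd _ _ (by omega), edgeY_odd _ _ (by omega)]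
    simp only [e _ _ (Or.inl rfl) (Or.inl rfl), e _ _ (Or.inl rfl) (Or.inr rfl),
      e _ _ (Or.inr rfl) (Or.inl rfl), e _ _ (Or.inr rfl) (Or.inr rfl), and_self]
  · rw [edgeX_odd _ _ par, edgeX_odd _ _ par, edgeX_even _ _ (by omega), edgeX_even _ _ (by omega),
      edgeY_odd _ _ par, edgeY_odd _ _ par, edgeY_even _ _ (by omega), edgeY_even _ _ (by omega)]
    simp only [e _ _ (Or.inl rfl) (Or.inl rfl), e _ _ (Or.inl rfl) (Or.inr rfl),
      e _ _ (Or.inr rfl) (Or.inl rfl), e _ _ (Or.inr rfl) (Or.inr rfl), and_self]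

variable (E tc θ) in
/-- The lower left square of the brick `c`. -/
noncomputable def brickCorner (c : Cell) : Cell :=
  (edgeX (mesh κ ω) (vertexOffset E tc θ) c.1 c.2, edgeY (mesh κ ω) (vertexOffset E tc θ) c.1 c.2)

theorem cellsAt_rectOf {c : Cell} {w : ω} (h : ∀ u, Incident u c → vertexContent E tc θ u =
      tileContent tc w (u.1 - 2 * (boxOf c).1, u.2 - 2 * (boxOf c).2)) :
    (rectOf tc w c).cellsAt (brickCorner E tc θ c) =
      brick (mesh κ ω) (vertexOffset E tc θ) c := by
  obtain ⟨h1, h2⟩ := edges_eq h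
  unfold RectTile.cellsAt brick brickCorner
  dsimp only
  rw [← h1, ← h2]
  congr 2 <;> ring

/-- The tiling of the region of boxes given by a Wang tiling. -/
noncomputable def IsWangMap.rectTiling (h : IsWangMap E tc θ) :
    RectTiling (rects tc) (boxRegion E tc) where
  tiles := {t | ∃ c w, θ (boxOf c) = some w ∧ t = (rectOf tc w c, brickCorner E tc θ c)}
  tile_mem := by
    rintro t ⟨c, w, -, rfl⟩
    exact mem_rects.2 ⟨w, c, rfl⟩
  disjoint := by
    rintro t ⟨c, w, hw, rfl⟩ t' ⟨c', w', hw', rfl⟩ hne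
    simp only [Function.onFun]
    rw [cellsAt_rectOf fun u => h.vertexContent_eq hw, cellsAt_rectOf fun u => h.vertexContent_eq hw',
      Finset.disjoint_left]
    intro z hz hz'
    obtain rfl := brick_unique (maxCode_lt_mesh κ ω) (maxCode_pos κ ω).le
      (offsetsIn_vertexOffset E tc θ) hz hz'
    rw [hw] at hw'
    exact hne (by rw [Option.some.inj hw'])
  covers := by
    intro z
    -- The region is defined by the offsets without tiles; the offsets with tiles cover the same
    -- squares, and for these the bricks are the rectangles.
    rw [← brickRegion_eq_boxRegion (θ := θ), mem_brickRegion]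
    · constructor
      · rintro ⟨c, hc, hz⟩
        obtain ⟨w, hw⟩ := Option.isSome_iff_exists.1 ((h.isSome_iff _).2 hc)
        exact ⟨_, ⟨c, w, hw, rfl⟩, by rwa [cellsAt_rectOf fun u => h.vertexContent_eq hw]⟩
      · rintro ⟨t, ⟨c, w, hw, rfl⟩, hz⟩
        rw [cellsAt_rectOf fun u => h.vertexContent_eq hw] at hz
        exact ⟨c, h.mem hw, hz⟩
    · intro p hp
      have := mt (h.isSome_iff p).1 hp
      simpa using this

end

/-! ### Tilings by rectangles whose sides are not too short -/

/-- `P x₀ x₁ y₀ y₁` says that `[x₀, x₁) × [y₀, y₁)` is one of a family of disjoint rectangles with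
sides at least `m` and union `F`. -/
structure IsBoxTiling (m : ℤ) (F : ℤ → ℤ → Prop) (P : ℤ → ℤ → ℤ → ℤ → Prop) : Prop where
  pos : 0 < m
  dims : ∀ {x₀ x₁ y₀ y₁}, P x₀ x₁ y₀ y₁ → x₀ + m ≤ x₁ ∧ y₀ + m ≤ y₁
  eq : ∀ {x₀ x₁ y₀ y₁ x₀' x₁' y₀' y₁' x y}, P x₀ x₁ y₀ y₁ → P x₀' x₁' y₀' y₁' →
    x₀ ≤ x → x < x₁ → y₀ ≤ y → y < y₁ → x₀' ≤ x → x < x₁' → y₀' ≤ y → y < y₁' →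
    x₀ = x₀' ∧ x₁ = x₁' ∧ y₀ = y₀' ∧ y₁ = y₁'
  covers : ∀ x y, F x y ↔ ∃ x₀ x₁ y₀ y₁, P x₀ x₁ y₀ y₁ ∧ x₀ ≤ x ∧ x < x₁ ∧ y₀ ≤ y ∧ y < y₁

/-- No rectangle contains both `(x, y)` and `(x', y')`. -/
def Separated (P : ℤ → ℤ → ℤ → ℤ → Prop) (x y x' y' : ℤ) : Prop :=
  ∀ x₀ x₁ y₀ y₁, P x₀ x₁ y₀ y₁ → x₀ ≤ x → x < x₁ → y₀ ≤ y → y < y₁ →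
    ¬(x₀ ≤ x' ∧ x' < x₁ ∧ y₀ ≤ y' ∧ y' < y₁)

section
variable {m : ℤ} {F : ℤ → ℤ → Prop} {P : ℤ → ℤ → ℤ → ℤ → Prop}

/-- Reflection in the diagonal exchanges widths and heights, so a forcing argument for one direction
also gives the other. -/
theorem IsBoxTiling.transpose (h : IsBoxTiling m F P) :
    IsBoxTiling m (fun x y => F y x) (fun x₀ x₁ y₀ y₁ => P y₀ y₁ x₀ x₁) where
  pos := h.pos
  dims ht := (h.dims ht).symm
  eq ht ht' h1 h2 h3 h4 h5 h6 h7 h8 := by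
    have := h.eq ht ht' h3 h4 h1 h2 h7 h8 h5 h6
    omega
  covers x y := by
    rw [h.covers]
    constructor
    · rintro ⟨y₀, y₁, x₀, x₁, ht, h1, h2, h3, h4⟩
      exact ⟨x₀, x₁, y₀, y₁, ht, h3, h4, h1, h2⟩
    · rintro ⟨x₀, x₁, y₀, y₁, ht, h1, h2, h3, h4⟩
      exact ⟨y₀, y₁, x₀, x₁, ht, h3, h4, h1, h2⟩

theorem Separated.transpose {x y x' y' : ℤ} (h : Separated P x y x' y') :
    Separated (fun x₀ x₁ y₀ y₁ => P y₀ y₁ x₀ x₁) y x y' x' :=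
  fun x₀ x₁ y₀ y₁ ht h1 h2 h3 h4 h5 => h y₀ y₁ x₀ x₁ ht h3 h4 h1 h2 (by omega)

theorem IsBoxTiling.separated_of_not (h : IsBoxTiling m F P) {x y x' y' : ℤ} (hF : ¬F x y) :
    Separated P x y x' y' := fun x₀ x₁ y₀ y₁ ht h1 h2 h3 h4 =>
  absurd ((h.covers x y).2 ⟨x₀, x₁, y₀, y₁, ht, h1, h2, h3, h4⟩) hF

theorem IsBoxTiling.separated_of_tile (h : IsBoxTiling m F P) {x y x' y' x₀ x₁ y₀ y₁ : ℤ}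
    (ht : P x₀ x₁ y₀ y₁) (hx : x₀ ≤ x ∧ x < x₁) (hy : y₀ ≤ y ∧ y < y₁)
    (h' : ¬(x₀ ≤ x' ∧ x' < x₁ ∧ y₀ ≤ y' ∧ y' < y₁)) : Separated P x y x' y' := by
  intro a₀ a₁ b₀ b₁ hs h1 h2 h3 h4 h5
  have := h.eq ht hs hx.1 hx.2 hy.1 hy.2 h1 h2 h3 h4
  omega

/-- The width of a rectangle with a known lower left corner, if a rectangle beginning at the
same level cannot cross the abscissa `X`, and there is no room for two rectangles. -/
theorem IsBoxTiling.width_forced (h : IsBoxTiling m F P) {x y X : ℤ} (hF : F x y)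
    (hl : Separated P (x - 1) y x y) (hd : Separated P x (y - 1) x y) (hx : x < X)
    (hX : X - x < 2 * m) (hF' : F (X - 1) y) (hd' : Separated P (X - 1) (y - 1) (X - 1) y)
    (lock : ∀ x₀ x₁ y₁, P x₀ x₁ y y₁ → x₀ ≤ X → x₁ ≤ X) : ∃ y₁, P x X y y₁ := by
  obtain ⟨x₀, x₁, y₀, y₁, ht, h1, h2, h3, h4⟩ := (h.covers x y).1 hF
  have e1 : x₀ = x := by
    by_contra hne
    exact hl _ _ _ _ ht (by omega) (by omega) h3 h4 ⟨h1, h2, h3, h4⟩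
  have e2 : y₀ = y := by
    by_contra hne
    exact hd _ _ _ _ ht h1 h2 (by omega) (by omega) ⟨h1, h2, h3, h4⟩
  subst e1 e2
  have hle := lock _ _ _ ht hx.le
  obtain ⟨x₂, x₃, y₂, y₃, hs, h5, h6, h7, h8⟩ := (h.covers _ _).1 hF'
  have e3 : y₂ = y₀ := by
    by_contra hne
    exact hd' _ _ _ _ hs h5 h6 (by omega) (by omega) ⟨h5, h6, h7, h8⟩
  subst e3
  have hle' := lock _ _ _ hs (by omega)
  have d1 := h.dims ht
  have d2 := h.dims hs
  by_cases hlt : x₁ = X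
  · exact ⟨y₁, hlt ▸ ht⟩
  -- If the first rectangle ended before `X`, the one that covers `(X - 1, y)` would have to fit
  -- beside it, but together they are at least `2 * m` wide.
  · exfalso
    by_cases hx2 : x₂ < x₁
    · rcases le_total x₀ x₂ with hh | hh
      · have := h.eq (x := x₂) (y := y₂) ht hs (by omega) (by omega) (by omega) (by omega)
          (by omega) (by omega) (by omega) (by omega)
        omega
      · have := h.eq (x := x₀) (y := y₂) ht hs (by omega) (by omega) (by omega) (by omega)
          (by omega) (by omega) (by omega) (by omega)
        omega
    · omega

/-- The height of a rectangle with a known lower left corner. -/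
theorem IsBoxTiling.height_forced (h : IsBoxTiling m F P) {x y Y : ℤ} (hF : F x y)
    (hl : Separated P (x - 1) y x y) (hd : Separated P x (y - 1) x y) (hy : y < Y)
    (hY : Y - y < 2 * m) (hF' : F x (Y - 1)) (hl' : Separated P (x - 1) (Y - 1) x (Y - 1))
    (lock : ∀ x₁ y₀ y₁, P x x₁ y₀ y₁ → y₀ ≤ Y → y₁ ≤ Y) : ∃ x₁, P x x₁ y Y :=
  h.transpose.width_forced (x := y) (y := x) (X := Y) hF hd.transpose hl.transpose hy hY hF'
    hl'.transpose fun x₀ x₁ y₁ => lock y₁ x₀ x₁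

/-- A step of the level below the next rectangle keeps rectangles from crossing. -/
theorem IsBoxTiling.lock_of_step (h : IsBoxTiling m F P) {X y y' : ℤ} (hy : y' < y)
    (hy' : y < y' + m) (hF : F X y → F X (y - 1)) (hs : Separated P X (y' - 1) X (y - 1))
    {x₀ x₁ y₁ : ℤ} (ht : P x₀ x₁ y y₁) (hx : x₀ ≤ X) : x₁ ≤ X := by
  by_contra hlt
  have d1 := h.dims ht
  have pos := h.pos
  -- The square just below the crossing rectangle at abscissa `X` is covered by a rectangle trapped
  -- between the levels `y'` and `y`, which are less than `m` apart.
  obtain ⟨a₀, a₁, b₀, b₁, hs', h5, h6, h7, h8⟩ := (h.covers _ _).1 <|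
    hF ((h.covers _ _).2 ⟨x₀, x₁, y, y₁, ht, hx, by omega, le_rfl, by omega⟩)
  have d2 := h.dims hs'
  have h9 : b₁ ≤ y := by
    by_contra hb
    have := h.eq (x := X) (y := y) ht hs' (by omega) (by omega) (by omega) (by omega)
          (by omega) (by omega) (by omega) (by omega)
    omega
  have h10 : y' ≤ b₀ := by
    by_contra hb
    exact hs _ _ _ _ hs' h5 h6 (by omega) (by omega) ⟨h5, h6, h7, h8⟩
  omega

/-- A rectangle that begins lower keeps rectangles from crossing. -/
theorem IsBoxTiling.lock_of_tile (h : IsBoxTiling m F P) {X y a₀ a₁ b₀ b₁ : ℤ}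
    (hk : P a₀ a₁ b₀ b₁) (ha : a₀ ≤ X ∧ X < a₁) (hb : b₀ < y ∧ y < b₁)
    {x₀ x₁ y₁ : ℤ} (ht : P x₀ x₁ y y₁) (hx : x₀ ≤ X) : x₁ ≤ X := by
  by_contra hlt
  have d1 := h.dims ht
  have pos := h.pos
  have := h.eq (x := X) (y := y) ht hk (by omega) (by omega) (by omega) (by omega)
    (by omega) (by omega) (by omega) (by omega)
  omega

theorem IsBoxTiling.lock_of_not (h : IsBoxTiling m F P) {X y : ℤ} (hF : ¬F X y)
    {x₀ x₁ y₁ : ℤ} (ht : P x₀ x₁ y y₁) (hx : x₀ ≤ X) : x₁ ≤ X := by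
  by_contra hlt
  have d1 := h.dims ht
  have pos := h.pos
  exact hF ((h.covers _ _).2 ⟨x₀, x₁, y, y₁, ht, hx, by omega, le_rfl, by omega⟩)

/-- A rectangle at the upper boundary of `F` ends there. -/
theorem IsBoxTiling.top_forced (h : IsBoxTiling m F P) {x₀ x₁ y₀ y₁ Y : ℤ} (ht : P x₀ x₁ y₀ y₁)
    (hY : y₀ < Y) (hlt : Y < y₁ + m) (hF : ¬F x₀ Y) (hF' : ∀ y, y₀ ≤ y → y < Y → F x₀ y) :
    y₁ = Y := by
  have d1 := h.dims ht
  have pos := h.pos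
  rcases lt_trichotomy y₁ Y with hl | hl | hl
  -- A rectangle in the gap between `y₁` and `Y` has height at least `m`, so it would extend beyond
  -- `Y`.
  · exfalso
    obtain ⟨a₀, a₁, b₀, b₁, hs', h5, h6, h7, h8⟩ :=
      (h.covers _ _).1 (hF' y₁ (by omega) hl)
    have d2 := h.dims hs'
    have h9 : y₁ ≤ b₀ := by
      by_contra hb
      have := h.eq (x := x₀) (y := y₁ - 1) ht hs' (by omega) (by omega) (by omega) (by omega)
        (by omega) (by omega) (by omega) (by omega)
      omega
    exact hF ((h.covers _ _).2 ⟨a₀, a₁, b₀, b₁, hs', h5, h6, by omega, by omega⟩)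
  · exact hl
  · exact absurd ((h.covers _ _).2 ⟨x₀, x₁, y₀, y₁, ht, le_rfl, by omega, by omega, by omega⟩) hF

/-- A rectangle at the right boundary of `F` ends there. -/
theorem IsBoxTiling.right_forced (h : IsBoxTiling m F P) {x₀ x₁ y₀ y₁ X : ℤ} (ht : P x₀ x₁ y₀ y₁)
    (hX : x₀ < X) (hlt : X < x₁ + m) (hF : ¬F X y₀) (hF' : ∀ x, x₀ ≤ x → x < X → F x y₀) :
    x₁ = X :=
  h.transpose.top_forced (x₀ := y₀) (x₁ := y₁) (y₀ := x₀) (y₁ := x₁) ht hX hlt hF hF'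

/-- A rectangle along the upper boundary of `F` ends where the boundary has a step. -/
theorem IsBoxTiling.right_forced_of_step (h : IsBoxTiling m F P) {x₀ x₁ y₀ y₁ X Y : ℤ}
    (ht : P x₀ x₁ y₀ y₁) (hX : x₀ < X) (h1 : X < x₁ + m) (hne : y₁ ≠ Y)
    (h4 : Y < y₁ + m)
    (hl : ∀ x, x₀ ≤ x → x < X → F x (y₁ - 1)) (hl' : ¬F (X - 1) y₁)
    (hr : y₁ < Y → F X y₁ ∧ ¬F X Y) (hr' : Y < y₁ → ¬F X (y₁ - 1)) : x₁ = X := by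
  have d1 := h.dims ht
  have pos := h.pos
  rcases lt_or_gt_of_ne hne with hlt | hlt
  · obtain ⟨hF1, hF2⟩ := hr hlt
    obtain ⟨a₀, a₁, b₀, b₁, hs, h5, h6, h7, h8⟩ := (h.covers _ _).1 hF1
    have d2 := h.dims hs
    have h9 : b₁ ≤ Y := by
      by_contra hb
      exact hF2 ((h.covers _ _).2 ⟨a₀, a₁, b₀, b₁, hs, h5, h6, by omega, by omega⟩)
    have h10 : a₀ = X := by
      by_contra hb
      exact hl' ((h.covers _ _).2 ⟨a₀, a₁, b₀, b₁, hs, by omega, by omega, h7, h8⟩)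
    by_contra hx
    by_cases hx1 : X < x₁
    · have := h.eq (x := X) (y := y₁ - 1) ht hs (by omega) (by omega) (by omega) (by omega)
        (by omega) (by omega) (by omega) (by omega)
      omega
    · obtain ⟨c₀, c₁, e₀, e₁, hu, g5, g6, g7, g8⟩ := (h.covers _ _).1 (hl x₁ (by omega) (by omega))
      have d3 := h.dims hu
      have g9 : x₁ ≤ c₀ := by
        by_contra hb
        have := h.eq (x := x₁ - 1) (y := y₁ - 1) ht hu (by omega) (by omega) (by omega) (by omega)
          (by omega) (by omega) (by omega) (by omega)
        omega
      have := h.eq (x := X) (y := y₁ - 1) hu hs (by omega) (by omega) (by omega) (by omega)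
        (by omega) (by omega) (by omega) (by omega)
      omega
  -- Step down: here the exterior of `F` is the wall at `X`.
  · have hF := hr' hlt
    by_contra hx
    by_cases hx1 : X < x₁
    · exact hF ((h.covers _ _).2 ⟨x₀, x₁, y₀, y₁, ht, by omega, by omega, by omega, by omega⟩)
    · obtain ⟨c₀, c₁, e₀, e₁, hu, g5, g6, g7, g8⟩ := (h.covers _ _).1 (hl x₁ (by omega) (by omega))
      have d3 := h.dims hu
      have g9 : x₁ ≤ c₀ := by
        by_contra hb
        have := h.eq (x := x₁ - 1) (y := y₁ - 1) ht hu (by omega) (by omega) (by omega) (by omega)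
          (by omega) (by omega) (by omega) (by omega)
        omega
      exact hF ((h.covers _ _).2 ⟨c₀, c₁, e₀, e₁, hu, by omega, by omega, by omega, by omega⟩)

end

/-! ### Rectangles in the place of bricks -/

section
variable {S g : ℤ} {v : Cell → ℤ} {G : Finset Cell} {P : ℤ → ℤ → ℤ → ℤ → Prop}

theorem mem_brick_even {a b a' b' x y : ℤ} (par : (a + b) % 2 = 0) (ha : a' = a + 1)
    (hb : b' = b + 1) : ((x, y) : Cell) ∈ brick S v (a, b) ↔
      (S * a + v (a, b') ≤ x ∧ x < S * a + S + v (a', b)) ∧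
        S * b + v (a, b) ≤ y ∧ y < S * b + S + v (a', b') := by
  subst ha hb
  rw [mem_brick]
  dsimp only
  rw [edgeX_even _ _ par, edgeX_odd _ _ (by omega), edgeY_even _ _ par, edgeY_odd _ _ (by omega),
    mul_add, mul_add, mul_one]

theorem mem_brick_odd {a b a' b' x y : ℤ} (par : (a + b) % 2 = 1) (ha : a' = a + 1)
    (hb : b' = b + 1) : ((x, y) : Cell) ∈ brick S v (a, b) ↔
      (S * a + v (a, b) ≤ x ∧ x < S * a + S + v (a', b')) ∧
        S * b + v (a', b) ≤ y ∧ y < S * b + S + v (a, b') := by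
  subst ha hb
  rw [mem_brick]
  dsimp only
  rw [edgeX_odd _ _ par, edgeX_even _ _ (by omega), edgeY_odd _ _ par, edgeY_even _ _ (by omega),
    mul_add, mul_add, mul_one]

/-- The brick `c` is one of the rectangles, if it belongs to the region. -/
def Placed (S : ℤ) (v : Cell → ℤ) (G : Finset Cell) (P : ℤ → ℤ → ℤ → ℤ → Prop) (c : Cell) : Prop :=
  boxOf c ∈ G → P (edgeX S v c.1 c.2) (edgeX S v (c.1 + 1) c.2) (edgeY S v c.1 c.2)
    (edgeY S v c.1 (c.2 + 1))

/-- A brick is a wall for other rectangles both when it is itself a rectangle of the tiling and when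
it lies outside the region. This lets the boundary be treated like a neighbor that is already
placed. -/
theorem Placed.separated (hS : g < S) (hg : 0 ≤ g) (hv : OffsetsIn g v)
    (hT : IsBoxTiling (S - g) (fun x y => (x, y) ∈ brickRegion S v G) P) {c : Cell}
    (hc : Placed S v G P c) {x y x' y' : ℤ} (h : (x, y) ∈ brick S v c)
    (h' : (x', y') ∉ brick S v c) : Separated P x y x' y' := by
  by_cases hG : boxOf c ∈ G
  · rw [mem_brick] at h h'
    exact hT.separated_of_tile (hc hG) h.1 h.2 (by dsimp only at h'; omega)
  · exact hT.separated_of_not (mt (mem_brickRegion_iff_of_mem_brick hS hg hv h).1 hG)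

/-- In the place of an even brick there is a rectangle of the right width. -/
theorem exists_tile_even (hS : 8 * g < S) (hg : 0 ≤ g) (hv : OffsetsIn g v)
    (hT : IsBoxTiling (S - g) (fun x y => (x, y) ∈ brickRegion S v G) P) {a b : ℤ}
    (par : (a + b) % 2 = 0) (hc : boxOf (a, b) ∈ G)
    (k1 : Placed S v G P (a - 1, b)) (k2 : Placed S v G P (a, b - 1))
    (k3 : Placed S v G P (a - 1, b - 1)) (hne : v (a, b) ≠ v (a + 2, b))
    (k4 : boxOf (a + 1, b - 1) ∈ G → ∃ y', y' ≠ S * b + v (a, b) ∧ S * b - 2 * g ≤ y' ∧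
      y' ≤ S * b + 2 * g ∧ P (edgeX S v (a + 1) (b - 1)) (edgeX S v (a + 2) (b - 1))
        (edgeY S v (a + 1) (b - 1)) y') :
    ∃ y₁, P (edgeX S v a b) (edgeX S v (a + 1) b) (edgeY S v a b) y₁ := by
  have hS' : g < S := by omega
  have s1 : S * (a - 1) = S * a - S := by ring
  have s2 : S * (b - 1) = S * b - S := by ring
  have s3 : S * (a + 1) = S * a + S := by ring
  have s4 : S * (a + 2) = S * a + S + S := by ring
  have m0 := fun x y => mem_brick_even (S := S) (v := v) (x := x) (y := y) par (rfl : a + 1 = _)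
    (rfl : b + 1 = _)
  have m1 := fun x y => mem_brick_odd (S := S) (v := v) (x := x) (y := y) (a := a - 1) (a' := a)
    (b := b) (b' := b + 1) (by omega) (by omega) (by omega)
  have m2 := fun x y => mem_brick_odd (S := S) (v := v) (x := x) (y := y) (a := a) (a' := a + 1)
    (b := b - 1) (b' := b) (by omega) (by omega) (by omega)
  have m3 := fun x y => mem_brick_even (S := S) (v := v) (x := x) (y := y) (a := a - 1) (a' := a)
    (b := b - 1) (b' := b) (by omega) (by omega) (by omega)
  have m4 := fun x y => mem_brick_even (S := S) (v := v) (x := x) (y := y) (a := a + 1)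
    (a' := a + 2) (b := b - 1) (b' := b) (by omega) (by omega) (by omega)
  have m5 := fun x y => mem_brick_odd (S := S) (v := v) (x := x) (y := y) (a := a + 1)
    (a' := a + 2) (b := b) (b' := b + 1) (by omega) (by omega) (by omega)
  have b1 := hv (a, b)
  have b2 := hv (a, b + 1)
  have b3 := hv (a + 1, b)
  have b4 := hv (a + 1, b + 1)
  have b5 := hv (a + 2, b)
  have b6 := hv (a, b - 1)
  have b7 := hv (a - 1, b)
  have b8 := hv (a + 2, b - 1)
  have b9 := hv (a + 1, b - 1)
  have b10 := hv (a - 1, b + 1)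
  have b11 := hv (a - 1, b - 1)
  have b12 := hv (a + 2, b + 1)
  have hF : ∀ {x y : ℤ} {c : Cell}, (x, y) ∈ brick S v c →
      ((x, y) ∈ brickRegion S v G ↔ boxOf c ∈ G) := fun h =>
    mem_brickRegion_iff_of_mem_brick hS' hg hv h
  have e1 := edgeX_even (S := S) (v := v) a b par
  have e2 := edgeX_odd (S := S) (v := v) (a + 1) b (by omega)
  have e3 := edgeY_even (S := S) (v := v) a b par
  have e4 := edgeX_even (S := S) (v := v) (a + 1) (b - 1) (by omega)
  have e5 := edgeX_odd (S := S) (v := v) (a + 2) (b - 1) (by omega)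
  have e6 := edgeY_even (S := S) (v := v) (a + 1) (b - 1) (by omega)
  rw [show b - 1 + 1 = b by ring] at e4
  rw [e4, e5, e6] at k4
  rw [e1, e2, e3]
  set x := S * a + v (a, b + 1)
  set y := S * b + v (a, b)
  set X := S * (a + 1) + v (a + 1, b)
  refine hT.width_forced (hF (c := (a, b)) ((m0 _ _).2 ?_) |>.2 hc) ?_ ?_ ?_ ?_
    (hF (c := (a, b)) ((m0 _ _).2 ?_) |>.2 hc) ?_ ?_
  · omega
  · exact k1.separated hS' hg hv hT ((m1 _ _).2 (by omega)) (mt (m1 _ _).1 (by omega))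
  · by_cases hx : S * a + v (a, b - 1) ≤ x
    · exact k2.separated hS' hg hv hT ((m2 _ _).2 (by omega)) (mt (m2 _ _).1 (by omega))
    · exact k3.separated hS' hg hv hT ((m3 _ _).2 (by omega)) (mt (m3 _ _).1 (by omega))
  · omega
  · omega
  · omega
  · exact k2.separated hS' hg hv hT ((m2 _ _).2 (by omega)) (mt (m2 _ _).1 (by omega))
  -- The lock at `X`: the top of the lower right neighbor is at a level different from `y`. If it is
  -- higher, the neighbor itself blocks the way; if it is lower, a crossing rectangle would leave a
  -- gap that is too low. If the neighbor is outside the region, the segment through the vertex `(a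
  -- + 2, b)` takes the place of its top, and `hne` makes the levels differ.
  · intro x₀ x₁ y₁
    by_cases hG : boxOf (a + 1, b - 1) ∈ G
    · obtain ⟨y', h1, h2, h3, h4⟩ := k4 hG
      by_cases hy : y < y'
      · exact hT.lock_of_tile h4 (by omega) (by omega)
      · refine hT.lock_of_step (y' := y') (by omega) (by omega) ?_
          (hT.separated_of_tile h4 (by omega) (by omega) (by omega))
        by_cases hy' : S * b + v (a + 2, b) ≤ y - 1
        · rw [hF (c := (a + 1, b)) ((m5 _ _).2 (by omega)),
            hF (c := (a + 1, b)) ((m5 _ _).2 (by omega))]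
          exact id
        · exact fun _ => (hF (c := (a + 1, b - 1)) ((m4 _ _).2 (by omega))).2 hG
    · by_cases hy : y < S * b + v (a + 2, b)
      · exact hT.lock_of_not (by rwa [hF (c := (a + 1, b - 1)) ((m4 _ _).2 (by omega))])
      · refine hT.lock_of_step (y' := S * b + v (a + 2, b)) (by omega) (by omega) ?_
          (hT.separated_of_not (by rwa [hF (c := (a + 1, b - 1)) ((m4 _ _).2 (by omega))]))
        rw [hF (c := (a + 1, b)) ((m5 _ _).2 (by omega)),
          hF (c := (a + 1, b)) ((m5 _ _).2 (by omega))]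
        exact id

/-- In the place of an odd brick there is a rectangle with the right upper side, if the level
`y` of its lower side is known. -/
theorem exists_tile_odd (hS : 8 * g < S) (hg : 0 ≤ g) (hv : OffsetsIn g v)
    (hT : IsBoxTiling (S - g) (fun x y => (x, y) ∈ brickRegion S v G) P) {a b y : ℤ}
    (par : (a + b) % 2 = 1) (hc : boxOf (a, b) ∈ G)
    (k1 : Placed S v G P (a - 1, b)) (k2 : Placed S v G P (a - 1, b + 1))
    (k3 : Placed S v G P (a - 1, b - 1)) (hne : v (a, b) ≠ v (a, b + 2))
    (hy : S * b - 2 * g ≤ y ∧ y ≤ S * b + 2 * g)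
    (hF : (edgeX S v a b, y) ∈ brickRegion S v G)
    (k4 : Separated P (edgeX S v a b) (y - 1) (edgeX S v a b) y) :
    ∃ x₁, P (edgeX S v a b) x₁ y (edgeY S v a (b + 1)) := by
  have hS' : g < S := by omega
  have s1 : S * (a - 1) = S * a - S := by ring
  have s2 : S * (b - 1) = S * b - S := by ring
  have s3 : S * (b + 1) = S * b + S := by ring
  have m0 := fun x y => mem_brick_odd (S := S) (v := v) (x := x) (y := y) par (rfl : a + 1 = _)
    (rfl : b + 1 = _)
  have m1 := fun x y => mem_brick_even (S := S) (v := v) (x := x) (y := y) (a := a - 1) (a' := a)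
    (b := b) (b' := b + 1) (by omega) (by omega) (by omega)
  have m2 := fun x y => mem_brick_odd (S := S) (v := v) (x := x) (y := y) (a := a - 1) (a' := a)
    (b := b + 1) (b' := b + 2) (by omega) (by omega) (by omega)
  have m3 := fun x y => mem_brick_odd (S := S) (v := v) (x := x) (y := y) (a := a - 1) (a' := a)
    (b := b - 1) (b' := b) (by omega) (by omega) (by omega)
  have m5 := fun x y => mem_brick_even (S := S) (v := v) (x := x) (y := y) (a := a)
    (a' := a + 1) (b := b + 1) (b' := b + 2) (by omega) (by omega) (by omega)
  have b1 := hv (a, b)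
  have b2 := hv (a, b + 1)
  have b3 := hv (a + 1, b)
  have b4 := hv (a + 1, b + 1)
  have b5 := hv (a, b + 2)
  have b6 := hv (a, b - 1)
  have b7 := hv (a - 1, b)
  have b8 := hv (a - 1, b + 2)
  have b9 := hv (a + 1, b + 2)
  have b10 := hv (a - 1, b + 1)
  have b11 := hv (a - 1, b - 1)
  have hF' : ∀ {x y : ℤ} {c : Cell}, (x, y) ∈ brick S v c →
      ((x, y) ∈ brickRegion S v G ↔ boxOf c ∈ G) := fun h =>
    mem_brickRegion_iff_of_mem_brick hS' hg hv h
  have e1 := edgeX_odd (S := S) (v := v) a b par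
  have e2 := edgeY_even (S := S) (v := v) a (b + 1) (by omega)
  rw [e1] at hF k4 ⊢
  rw [e2]
  set x := S * a + v (a, b)
  set Y := S * (b + 1) + v (a, b + 1)
  refine hT.height_forced hF ?_ k4 ?_ ?_ (hF' (c := (a, b)) ((m0 _ _).2 ?_) |>.2 hc) ?_ ?_
  · by_cases hy : S * b + v (a - 1, b) ≤ y
    · exact k1.separated hS' hg hv hT ((m1 _ _).2 (by omega)) (mt (m1 _ _).1 (by omega))
    · exact k3.separated hS' hg hv hT ((m3 _ _).2 (by omega)) (mt (m3 _ _).1 (by omega))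
  · omega
  · omega
  · omega
  · exact k1.separated hS' hg hv hT ((m1 _ _).2 (by omega)) (mt (m1 _ _).1 (by omega))
  -- The same lock, transposed: the right side of the upper left neighbor is at `S * a + v (a, b +
  -- 2)`, which differs from `x` by `hne`.
  · intro x₁ y₀ y₁
    by_cases hx : x < S * a + v (a, b + 2)
    · by_cases hG : boxOf (a - 1, b + 1) ∈ G
      · have hk := k2 hG
        have q1 := edgeX_odd (S := S) (v := v) (a - 1) (b + 1) (by omega)
        have q2 := edgeX_even (S := S) (v := v) (a - 1 + 1) (b + 1) (by omega)
        have q3 := edgeY_odd (S := S) (v := v) (a - 1) (b + 1) (by omega)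
        have q4 := edgeY_even (S := S) (v := v) (a - 1) (b + 1 + 1) (by omega)
        rw [show a - 1 + 1 = a by ring, show b + 1 + 1 = b + 2 by ring] at q2
        rw [show a - 1 + 1 = a by ring] at q3
        rw [show b + 1 + 1 = b + 2 by ring] at q4
        have s4 : S * (b + 2) = S * b + S + S := by ring
        dsimp only at hk
        rw [show a - 1 + 1 = a by ring, show b + 1 + 1 = b + 2 by ring, q1, q2, q3, q4] at hk
        exact hT.transpose.lock_of_tile (X := Y) (y := x) hk (by omega) (by omega)
      · exact hT.transpose.lock_of_not (X := Y) (y := x)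
          (by rwa [hF' (c := (a - 1, b + 1)) ((m2 _ _).2 (by omega))])
    · refine hT.transpose.lock_of_step (X := Y) (y := x) (y' := S * a + v (a, b + 2))
        (by omega) (by omega) ?_
        (k2.separated hS' hg hv hT ((m2 _ _).2 (by omega)) (mt (m2 _ _).1 (by omega))).transpose
      rw [hF' (c := (a, b + 1)) ((m5 _ _).2 (by omega)),
        hF' (c := (a, b + 1)) ((m5 _ _).2 (by omega))]
      exact id

end

/-! ### Every tiling of the region of boxes comes from a Wang tiling -/

section
variable {κ ω : Type}

/-- Vertices of different classes have different offsets whatever they show. Coordinates are taken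
modulo 4 and not modulo 2 in order that this applies to vertices two steps apart, where the locks
need a step. -/
theorem state_ne {u u' : Cell} {q q' : Option (κ ⊕ ω)}
    (h : u.1 % 4 ≠ u'.1 % 4 ∨ u.2 % 4 ≠ u'.2 % 4) : ((vclass u, q) : VState κ ω) ≠ (vclass u', q') := by
  intro e
  have := vclass_eq_iff.1 (Prod.ext_iff.1 e).1
  omega

theorem state_eq {u u' : Cell} {q q' : Option (κ ⊕ ω)}
    (e : ((vclass u, q) : VState κ ω) = (vclass u', q')) :
    u.1 % 4 = u'.1 % 4 ∧ u.2 % 4 = u'.2 % 4 ∧ q = q' := by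
  have := vclass_eq_iff.1 (Prod.ext_iff.1 e).1
  exact ⟨this.1, this.2, (Prod.ext_iff.1 e).2⟩

variable {G : Finset Cell} {E : EdgeColoring κ G} {tc : ω → Dir → κ}
  {θ : Cell → Option ω} [Fintype κ] [Fintype ω]

/-- `[x₀, x₁) × [y₀, y₁)` is one of the rectangles of the tiling. -/
def IsTile {R : Finset RectTile} {H : Finset Cell} (T : RectTiling R H) (x₀ x₁ y₀ y₁ : ℤ) : Prop :=
  ∃ t : RectTile, (t, (x₀, y₀)) ∈ T.tiles ∧ x₁ = x₀ + t.width ∧ y₁ = y₀ + t.height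

theorem mem_cellsAt {t : RectTile} {p : Cell} {x y : ℤ} : (x, y) ∈ t.cellsAt p ↔
    (p.1 ≤ x ∧ x < p.1 + t.width) ∧ p.2 ≤ y ∧ y < p.2 + t.height := by
  simp [RectTile.cellsAt]

theorem RectTiling.eq_of_mem {R : Finset RectTile} {H : Finset Cell} (T : RectTiling R H)
    {t t' : RectTile × Cell} (ht : t ∈ T.tiles) (ht' : t' ∈ T.tiles) {z : Cell}
    (hz : z ∈ t.1.cellsAt t.2) (hz' : z ∈ t'.1.cellsAt t'.2) : t = t' := by
  by_contra hne
  exact Finset.disjoint_left.1 (T.disjoint ht ht' hne) hz hz'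

theorem rectOf_dims (tc : ω → Dir → κ) (w : ω) (c : Cell) :
    mesh κ ω - maxCode κ ω ≤ (rectOf tc w c).width ∧
      mesh κ ω - maxCode κ ω ≤ (rectOf tc w c).height := by
  rw [width_rectOf, height_rectOf]
  have hv := offsetsIn_tileOffset tc w (boxOf c)
  have h1 := edgeX_bounds (S := mesh κ ω) hv c.1 c.2
  have h2 := edgeX_bounds (S := mesh κ ω) hv (c.1 + 1) c.2
  have h3 := edgeY_bounds (S := mesh κ ω) hv c.1 c.2
  have h4 := edgeY_bounds (S := mesh κ ω) hv c.1 (c.2 + 1)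
  rw [mul_add, mul_one] at h2 h4
  omega

theorem isBoxTiling (T : RectTiling (rects tc) (boxRegion E tc)) (hθ : ∀ p, p ∉ G → θ p = none) :
    IsBoxTiling (mesh κ ω - maxCode κ ω)
      (fun x y => (x, y) ∈ brickRegion (mesh κ ω) (vertexOffset E tc θ) G) (IsTile T) where
  pos := by
    have := maxCode_lt_mesh κ ω
    omega
  dims := by
    rintro x₀ x₁ y₀ y₁ ⟨t, ht, rfl, rfl⟩
    obtain ⟨w, c, rfl⟩ := mem_rects.1 (T.tile_mem _ ht)
    have := rectOf_dims tc w c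
    omega
  eq := by
    rintro x₀ x₁ y₀ y₁ x₀' x₁' y₀' y₁' x y ⟨t, ht, rfl, rfl⟩ ⟨t', ht', rfl, rfl⟩
    intro h1 h2 h3 h4 h5 h6 h7 h8
    have := T.eq_of_mem ht ht' (z := (x, y)) (mem_cellsAt.2 (by dsimp only; omega))
      (mem_cellsAt.2 (by dsimp only; omega))
    simp only [Prod.mk.injEq] at this
    obtain ⟨rfl, rfl, rfl⟩ := this
    simp
  covers := by
    intro x y
    rw [brickRegion_eq_boxRegion hθ, T.covers]
    constructor
    · rintro ⟨⟨t, x₀, y₀⟩, ht, h⟩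
      rw [mem_cellsAt] at h
      exact ⟨_, _, _, _, ⟨t, ht, rfl, rfl⟩, h.1.1, h.1.2, h.2.1, h.2.2⟩
    · rintro ⟨x₀, x₁, y₀, y₁, ⟨t, ht, rfl, rfl⟩, h1, h2, h3, h4⟩
      exact ⟨_, ht, mem_cellsAt.2 ⟨⟨h1, h2⟩, h3, h4⟩⟩

theorem rectOf_congr (tc : ω → Dir → κ) (w : ω) {a b a' b' : ℤ} (ha : a % 4 = a' % 4)
    (hb : b % 4 = b' % 4) : rectOf tc w (a, b) = rectOf tc w (a', b') := by
  have := rectOf_add tc w a' b' ((a - a') / 4) ((b - b') / 4)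
  rwa [show a' + 4 * ((a - a') / 4) = a by omega, show b' + 4 * ((b - b') / 4) = b by omega] at this

/-- The sides of the rectangles in terms of codes. -/
theorem width_rectOf_even (tc : ω → Dir → κ) (w : ω) {a b : ℤ} (par : (a + b) % 2 = 0) :
    ((rectOf tc w (a, b)).width : ℤ) = mesh κ ω + tileOffset tc w (boxOf (a, b)) (a + 1, b) -
      tileOffset tc w (boxOf (a, b)) (a, b + 1) := by
  rw [width_rectOf, edgeX_odd _ _ (by dsimp only; omega), edgeX_even _ _ par]
  ring

theorem width_rectOf_odd (tc : ω → Dir → κ) (w : ω) {a b : ℤ} (par : (a + b) % 2 = 1) :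
    ((rectOf tc w (a, b)).width : ℤ) = mesh κ ω + tileOffset tc w (boxOf (a, b)) (a + 1, b + 1) -
      tileOffset tc w (boxOf (a, b)) (a, b) := by
  rw [width_rectOf, edgeX_even _ _ (by dsimp only; omega), edgeX_odd _ _ par]
  ring

theorem height_rectOf_even (tc : ω → Dir → κ) (w : ω) {a b : ℤ} (par : (a + b) % 2 = 0) :
    ((rectOf tc w (a, b)).height : ℤ) = mesh κ ω + tileOffset tc w (boxOf (a, b)) (a + 1, b + 1) -
      tileOffset tc w (boxOf (a, b)) (a, b) := by
  rw [height_rectOf, edgeY_odd _ _ (by dsimp only; omega), edgeY_even _ _ par]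
  ring

theorem height_rectOf_odd (tc : ω → Dir → κ) (w : ω) {a b : ℤ} (par : (a + b) % 2 = 1) :
    ((rectOf tc w (a, b)).height : ℤ) = mesh κ ω + tileOffset tc w (boxOf (a, b)) (a, b + 1) -
      tileOffset tc w (boxOf (a, b)) (a + 1, b) := by
  rw [height_rectOf, edgeY_even _ _ (by dsimp only; omega), edgeY_odd _ _ par]
  ring

theorem code_sub_of_add {M : ℤ} {a b d e : VState κ ω} (hab : a ≠ b)
    (h : M + code d - code e = M + code a - code b) : a = d ∧ b = e :=
  code_sub hab (by linarith)

/-- A rectangle with the width of an even brick is one for this brick. -/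
theorem rectOf_of_width {a b : ℤ} (par : (a + b) % 2 = 0) {q r : Option (κ ⊕ ω)} {w : ω} {c : Cell}
    (h : ((rectOf tc w c).width : ℤ) =
      mesh κ ω + code (vclass (a + 1, b), q) - code (vclass (a, b + 1), r)) :
    rectOf tc w c = rectOf tc w (a, b) ∧
      q = tileContent tc w (a + 1 - 2 * (boxOf (a, b)).1, b - 2 * (boxOf (a, b)).2) ∧
      r = tileContent tc w (a - 2 * (boxOf (a, b)).1, b + 1 - 2 * (boxOf (a, b)).2) := by
  obtain ⟨a', b'⟩ := c
  have hne : ((vclass (a + 1, b), q) : VState κ ω) ≠ (vclass (a, b + 1), r) :=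
    state_ne (by dsimp only; omega)
  have e : rectOf tc w (a', b') = rectOf tc w (a, b) := by
    rcases Int.emod_two_eq (a' + b') with par' | par'
    · rw [width_rectOf_even tc w par'] at h
      simp only [tileOffset] at h
      have := code_sub_of_add hne h
      have h1 := state_eq this.1
      have h2 := state_eq this.2
      dsimp only at h1 h2
      exact rectOf_congr tc w (by omega) (by omega)
    -- The width of an odd brick comes from its other diagonal; comparing the classes of its ends
    -- with those of an even brick would give `2 ≡ 0` modulo 4.
    · rw [width_rectOf_odd tc w par'] at h
      simp only [tileOffset] at h
      have := code_sub_of_add hne h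
      have h1 := state_eq this.1
      have h2 := state_eq this.2
      dsimp only at h1 h2
      omega
  refine ⟨e, ?_⟩
  rw [e, width_rectOf_even tc w par] at h
  simp only [tileOffset] at h
  have := code_sub_of_add hne h
  exact ⟨(state_eq this.1).2.2, (state_eq this.2).2.2⟩

/-- A rectangle with the height of an odd brick is one for this brick. -/
theorem rectOf_of_height {a b : ℤ} (par : (a + b) % 2 = 1) {q r : Option (κ ⊕ ω)} {w : ω} {c : Cell}
    (h : ((rectOf tc w c).height : ℤ) =
      mesh κ ω + code (vclass (a, b + 1), q) - code (vclass (a + 1, b), r)) :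
    rectOf tc w c = rectOf tc w (a, b) ∧
      q = tileContent tc w (a - 2 * (boxOf (a, b)).1, b + 1 - 2 * (boxOf (a, b)).2) ∧
      r = tileContent tc w (a + 1 - 2 * (boxOf (a, b)).1, b - 2 * (boxOf (a, b)).2) := by
  obtain ⟨a', b'⟩ := c
  have hne : ((vclass (a, b + 1), q) : VState κ ω) ≠ (vclass (a + 1, b), r) :=
    state_ne (by dsimp only; omega)
  have e : rectOf tc w (a', b') = rectOf tc w (a, b) := by
    rcases Int.emod_two_eq (a' + b') with par' | par'
    · rw [height_rectOf_even tc w par'] at h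
      simp only [tileOffset] at h
      have := code_sub_of_add hne h
      have h1 := state_eq this.1
      have h2 := state_eq this.2
      dsimp only at h1 h2
      omega
    · rw [height_rectOf_odd tc w par'] at h
      simp only [tileOffset] at h
      have := code_sub_of_add hne h
      have h1 := state_eq this.1
      have h2 := state_eq this.2
      dsimp only at h1 h2
      exact rectOf_congr tc w (by omega) (by omega)
  refine ⟨e, ?_⟩
  rw [e, height_rectOf_odd tc w par] at h
  simp only [tileOffset] at h
  have := code_sub_of_add hne h
  exact ⟨(state_eq this.1).2.2, (state_eq this.2).2.2⟩

/-- If the lower neighbor of an odd brick is as high as it would be with another tile, then the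
height of a rectangle on top of it shows that this tile is the same. -/
theorem eq_of_height {x y : ℤ} {q : Option (κ ⊕ ω)} {w w₁ w₂ : ω} {c : Cell}
    (h : ((rectOf tc w c).height : ℤ) =
      mesh κ ω + code (vclass (2 * x, 2 * y), q) - (code (vclass (2 * x + 1, 2 * y - 1), (none : Option (κ ⊕ ω))) +
        code (vclass (2 * x, 2 * y - 2), (some (.inr w₁) : Option (κ ⊕ ω))) -
          code (vclass (2 * x, 2 * y - 2), (some (.inr w₂) : Option (κ ⊕ ω))))) : w₁ = w₂ := by
  obtain ⟨a', b'⟩ := c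
  have key : ∀ u u' : Cell, ∀ z z' : Option (κ ⊕ ω), ((rectOf tc w (a', b')).height : ℤ) =
      mesh κ ω + code (vclass u, z) - code (vclass u', z') →
      (u = (a', b' + 1) ∧ u' = (a' + 1, b') ∨ u = (a' + 1, b' + 1) ∧ u' = (a', b')) → w₁ = w₂ := by
    rintro ⟨u1, u2⟩ ⟨u1', u2'⟩ z z' hh hu
    simp only [Prod.mk.injEq] at hu
    -- Moving all negative terms across gives an equation between sums of three codes. The corner
    -- can only be the state at `u'`, since the two other terms on the right belong to centers.
    -- After cancelling it, `w₁` must be matched with `w₂`, because the centers at `2 * y - 2` and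
    -- `2 * y` have different classes.
    have e1 := code_triple (a := (vclass (2 * x + 1, 2 * y - 1), none))
      (b := (vclass (2 * x, 2 * y - 2), some (.inr w₁))) (c := (vclass (u1, u2), z))
      (d := (vclass (u1', u2'), z'))
      (e := (vclass (2 * x, 2 * y - 2), some (.inr w₂))) (f := (vclass (2 * x, 2 * y), q))
      (by linarith)
    rcases e1 with e1 | e1 | e1
    · have e2 := code_pair (a := (vclass (2 * x, 2 * y - 2), some (.inr w₁)))
        (b := (vclass (u1, u2), z)) (d := (vclass (2 * x, 2 * y - 2), some (.inr w₂)))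
        (e := (vclass (2 * x, 2 * y), q)) (by rw [← e1] at hh; linarith)
      rcases e2 with e2 | e2
      · simpa using (state_eq e2).2.2
      · exact absurd e2 (state_ne (by dsimp only; omega))
    · exact absurd e1 (state_ne (by dsimp only; omega))
    · exact absurd e1 (state_ne (by dsimp only; omega))
  rcases Int.emod_two_eq (a' + b') with par' | par'
  · exact key (a' + 1, b' + 1) (a', b') _ _ (height_rectOf_even tc w par') (Or.inr ⟨rfl, rfl⟩)
  · exact key (a', b' + 1) (a' + 1, b') _ _ (height_rectOf_odd tc w par') (Or.inl ⟨rfl, rfl⟩)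

end

/-! ### Identifying the rectangles in the four bricks of a box -/

section
variable {κ ω : Type} {G : Finset Cell} {E : EdgeColoring κ G} {tc : ω → Dir → κ}
  {θ : Cell → Option ω}

theorem tileContent_center {w : ω} {d e : ℤ} (hd : d = 0) (he : e = 0) :
    tileContent tc w (d, e) = some (.inr w) := by simp [tileContent, hd, he]

theorem tileContent_left {w : ω} {d e : ℤ} (hd : d = -1) (he : e = 0) :
    tileContent tc w (d, e) = some (.inl (tc w .left)) := by simp [tileContent, hd, he]

theorem tileContent_right {w : ω} {d e : ℤ} (hd : d = 1) (he : e = 0) :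
    tileContent tc w (d, e) = some (.inl (tc w .right)) := by simp [tileContent, hd, he]

theorem tileContent_down {w : ω} {d e : ℤ} (hd : d = 0) (he : e = -1) :
    tileContent tc w (d, e) = some (.inl (tc w .down)) := by simp [tileContent, hd, he]

theorem tileContent_up {w : ω} {d e : ℤ} (hd : d = 0) (he : e = 1) :
    tileContent tc w (d, e) = some (.inl (tc w .up)) := by simp [tileContent, hd, he]

theorem tileContent_corner {w : ω} {d e : ℤ} (hd : d ≠ 0) (he : e ≠ 0) :
    tileContent tc w (d, e) = none := by simp [tileContent, hd, he]

theorem map_inl_eq {o : Option κ} {k : κ} (h : o.map (Sum.inl : κ → κ ⊕ ω) = some (.inl k)) :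
    o = some k := by simpa using h

theorem map_inr_eq {o : Option ω} {w : ω} (h : o.map (Sum.inr : ω → κ ⊕ ω) = some (.inr w)) :
    o = some w := by simpa using h

variable [Fintype κ] [Fintype ω] {T : RectTiling (rects tc) (boxRegion E tc)}

variable (θ T) in
/-- The brick `c` is covered by a rectangle for the tile of its box, and shows the right values. -/
def IsFull (c : Cell) : Prop :=
  boxOf c ∈ G → ∃ w, θ (boxOf c) = some w ∧
    (∀ u, Incident u c → vertexContent E tc θ u =
      tileContent tc w (u.1 - 2 * (boxOf c).1, u.2 - 2 * (boxOf c).2)) ∧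
    (rectOf tc w c, brickCorner E tc θ c) ∈ T.tiles

variable (θ T) in
/-- The upper right brick of a box is covered by a rectangle for some tile with the right colors
above and on the right. -/
def IsWeak (p : Cell) : Prop :=
  p ∈ G → ∃ w, (rectOf tc w (2 * p.1, 2 * p.2), brickCorner E tc θ (2 * p.1, 2 * p.2)) ∈ T.tiles ∧
    edgeL E tc θ (p.1 + 1, p.2) = some (tc w .right) ∧
    edgeB E tc θ (p.1, p.2 + 1) = some (tc w .up)

theorem IsFull.placed {c : Cell} (h : IsFull θ T c) :
    Placed (mesh κ ω) (vertexOffset E tc θ) G (IsTile T) c := by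
  intro hG
  obtain ⟨w, -, hw, ht⟩ := h hG
  have := edges_eq hw
  exact ⟨_, ht, by linarith, by linarith⟩

theorem IsFull.placed' {c : Cell} (h : IsFull θ T c) {a b : ℤ} (h1 : a = c.1) (h2 : b = c.2) :
    Placed (mesh κ ω) (vertexOffset E tc θ) G (IsTile T) (a, b) := by
  subst h1 h2
  exact h.placed

/-- The margin for all forcing arguments: the levels that occur deviate from the grid lines by small
multiples of `g`, much less than the shortest possible side `S - g`. The factor 16 in the mesh also
keeps it a power of two. -/
theorem eight_mul_maxCode_lt (κ ω : Type) [Fintype κ] [Fintype ω] :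
    8 * maxCode κ ω < mesh κ ω := by
  have := maxCode_pos κ ω
  unfold mesh
  omega

theorem boxOf_lowerLeft (x y : ℤ) : boxOf (2 * x - 1, 2 * y - 1) = (x, y) :=
  boxOf_eq_iff.2 (by dsimp only; omega)

theorem boxOf_lowerRight (x y : ℤ) : boxOf (2 * x, 2 * y - 1) = (x, y) :=
  boxOf_eq_iff.2 (by dsimp only; omega)

theorem boxOf_upperLeft (x y : ℤ) : boxOf (2 * x - 1, 2 * y) = (x, y) :=
  boxOf_eq_iff.2 (by dsimp only; omega)

theorem boxOf_upperRight (x y : ℤ) : boxOf (2 * x, 2 * y) = (x, y) :=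
  boxOf_eq_iff.2 (by dsimp only; omega)

theorem vertexOffset_corner {i j : ℤ} (h1 : i % 2 = 1) (h2 : j % 2 = 1) :
    vertexOffset E tc θ (i, j) = code (κ := κ) (ω := ω) (vclass (i, j), none) := by
  rw [vertexOffset, vertexContent_corner E tc θ h1 h2]

theorem vertexOffset_ne {u u' : Cell} (h : u.1 % 4 ≠ u'.1 % 4 ∨ u.2 % 4 ≠ u'.2 % 4) :
    vertexOffset E tc θ u ≠ vertexOffset E tc θ u' := fun e =>
  state_ne h (code_injective e)

theorem vertexOffset_center (x y : ℤ) : vertexOffset E tc θ (2 * x, 2 * y) =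
    code (κ := κ) (ω := ω) (vclass (2 * x, 2 * y), (θ (x, y)).map .inr) := by
  rw [vertexOffset, vertexContent_center]

theorem vertexOffset_left (x y : ℤ) : vertexOffset E tc θ (2 * x - 1, 2 * y) =
    code (κ := κ) (ω := ω) (vclass (2 * x - 1, 2 * y), (edgeL E tc θ (x, y)).map .inl) := by
  rw [vertexOffset, vertexContent_left]

theorem vertexOffset_bot (x y : ℤ) : vertexOffset E tc θ (2 * x, 2 * y - 1) =
    code (κ := κ) (ω := ω) (vclass (2 * x, 2 * y - 1), (edgeB E tc θ (x, y)).map .inl) := by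
  rw [vertexOffset, vertexContent_bot]

theorem vertexOffset_right (x y : ℤ) : vertexOffset E tc θ (2 * x + 1, 2 * y) =
    code (κ := κ) (ω := ω) (vclass (2 * x + 1, 2 * y), (edgeL E tc θ (x + 1, y)).map .inl) := by
  have := vertexOffset_left (E := E) (tc := tc) (θ := θ) (x + 1) y
  rwa [show 2 * (x + 1) - 1 = 2 * x + 1 by ring] at this

theorem vertexOffset_top (x y : ℤ) : vertexOffset E tc θ (2 * x, 2 * y + 1) =
    code (κ := κ) (ω := ω) (vclass (2 * x, 2 * y + 1), (edgeB E tc θ (x, y + 1)).map .inl) := by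
  have := vertexOffset_bot (E := E) (tc := tc) (θ := θ) x (y + 1)
  rwa [show 2 * (y + 1) - 1 = 2 * y + 1 by ring] at this

theorem tileOffset_center (w : ω) (x y : ℤ) : tileOffset tc w (x, y) (2 * x, 2 * y) =
    code (κ := κ) (ω := ω) (vclass (2 * x, 2 * y), some (.inr w)) := by
  rw [tileOffset, tileContent_center (by dsimp only; omega) (by dsimp only; omega)]

theorem tileOffset_left (w : ω) (x y : ℤ) : tileOffset tc w (x, y) (2 * x - 1, 2 * y) =
    code (κ := κ) (ω := ω) (vclass (2 * x - 1, 2 * y), some (.inl (tc w .left))) := by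
  rw [tileOffset, tileContent_left (by dsimp only; omega) (by dsimp only; omega)]

theorem tileOffset_right (w : ω) (x y : ℤ) : tileOffset tc w (x, y) (2 * x + 1, 2 * y) =
    code (κ := κ) (ω := ω) (vclass (2 * x + 1, 2 * y), some (.inl (tc w .right))) := by
  rw [tileOffset, tileContent_right (by dsimp only; omega) (by dsimp only; omega)]

theorem tileOffset_bot (w : ω) (x y : ℤ) : tileOffset tc w (x, y) (2 * x, 2 * y - 1) =
    code (κ := κ) (ω := ω) (vclass (2 * x, 2 * y - 1), some (.inl (tc w .down))) := by
  rw [tileOffset, tileContent_down (by dsimp only; omega) (by dsimp only; omega)]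

theorem tileOffset_top (w : ω) (x y : ℤ) : tileOffset tc w (x, y) (2 * x, 2 * y + 1) =
    code (κ := κ) (ω := ω) (vclass (2 * x, 2 * y + 1), some (.inl (tc w .up))) := by
  rw [tileOffset, tileContent_up (by dsimp only; omega) (by dsimp only; omega)]

theorem tileOffset_corner (w : ω) {x y i j : ℤ} (hi : i ≠ 2 * x) (hj : j ≠ 2 * y) :
    tileOffset tc w (x, y) (i, j) = code (κ := κ) (ω := ω) (vclass (i, j), none) := by
  rw [tileOffset, tileContent_corner (by dsimp only; omega) (by dsimp only; omega)]

/-- The rectangle in the place of the upper right brick of a box. -/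
theorem IsWeak.isTile {x y : ℤ} (h : IsWeak θ T (x, y)) (hG : (x, y) ∈ G) :
    ∃ w, (rectOf tc w (2 * x, 2 * y), brickCorner E tc θ (2 * x, 2 * y)) ∈ T.tiles ∧
      edgeL E tc θ (x + 1, y) = some (tc w .right) ∧
      edgeB E tc θ (x, y + 1) = some (tc w .up) ∧
      IsTile T (edgeX (mesh κ ω) (vertexOffset E tc θ) (2 * x) (2 * y))
        (edgeX (mesh κ ω) (vertexOffset E tc θ) (2 * x + 1) (2 * y))
        (edgeY (mesh κ ω) (vertexOffset E tc θ) (2 * x) (2 * y))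
        (mesh κ ω * (2 * y + 1) + (code (κ := κ) (ω := ω) (vclass (2 * x + 1, 2 * y + 1), none) +
          code (κ := κ) (ω := ω) (vclass (2 * x, 2 * y), (θ (x, y)).map .inr) -
          code (κ := κ) (ω := ω) (vclass (2 * x, 2 * y), some (.inr w)))) := by
  obtain ⟨w, h1, h2, h3⟩ := h hG
  dsimp only at h1 h2 h3
  refine ⟨w, h1, h2, h3, _, h1, ?_, ?_⟩
  · rw [width_rectOf_even tc w (by omega), boxOf_upperRight, tileOffset_right, tileOffset_top,
      edgeX_even (2 * x) (2 * y) (by omega), edgeX_odd (2 * x + 1) (2 * y) (by omega),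
      vertexOffset_right, vertexOffset_top, h2, h3]
    simp only [Option.map_some]
    ring
  · rw [height_rectOf_even tc w (by omega), boxOf_upperRight, tileOffset_center,
      tileOffset_corner w (by omega) (by omega), edgeY_even (2 * x) (2 * y) (by omega),
      vertexOffset_center]
    ring

/-- The lower left brick of a box. -/
theorem isFull_lowerLeft (hθ : ∀ p, p ∉ G → θ p = none)
    (hread : ∀ x y w pos, (x, y) ∈ G → (rectOf tc w (2 * x - 1, 2 * y - 1), pos) ∈ T.tiles →
      (mesh κ ω * (2 * x - 1) + maxCode κ ω, mesh κ ω * (2 * y - 1) + maxCode κ ω) ∈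
        (rectOf tc w (2 * x - 1, 2 * y - 1)).cellsAt pos →
      ∃ w', θ (x, y) = some w' ∧
        rectOf tc w' (2 * x - 1, 2 * y - 1) = rectOf tc w (2 * x - 1, 2 * y - 1))
    {x y : ℤ} (k1 : IsFull θ T (2 * (x - 1), 2 * y - 1)) (k2 : IsFull θ T (2 * x - 1, 2 * (y - 1)))
    (k3 : IsFull θ T (2 * (x - 1), 2 * (y - 1))) (k4 : IsWeak θ T (x, y - 1)) :
    IsFull θ T (2 * x - 1, 2 * y - 1) := by
  intro hG
  have gS := eight_mul_maxCode_lt κ ω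
  have g0 := maxCode_pos κ ω
  have hv := offsetsIn_vertexOffset E tc θ
  obtain ⟨y₁, t, ht, hx1, hy1⟩ := exists_tile_even gS g0.le hv (isBoxTiling T hθ) (by omega) hG
    (k1.placed' (by ring) (by ring)) (k2.placed' (by ring) (by ring))
    (k3.placed' (by ring) (by ring)) (vertexOffset_ne (by dsimp only; omega)) (by
      intro hG'
      rw [show 2 * x - 1 + 1 = 2 * x by ring, show 2 * y - 1 - 1 = 2 * (y - 1) by ring] at hG' ⊢
      rw [boxOf_upperRight] at hG'
      obtain ⟨w, -, -, -, hw⟩ := k4.isTile hG'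
      rw [← show 2 * x - 1 + 2 = 2 * x + 1 by ring] at hw
      refine ⟨_, ?_, ?_, ?_, hw⟩
      · rw [show 2 * x - 1 + 2 = 2 * x + 1 by ring, show 2 * (y - 1) + 1 = 2 * y - 1 by ring,
          vertexOffset_corner (by omega) (by omega)]
        -- The neighbor may still carry a wrong tile `w`, which displaces its top by a difference of
        -- codes. Even so its top misses the level of the corner `(2 * x - 1, 2 * y - 1)`: equality
        -- would match this corner with another corner or with a center.
        intro e
        have := code_pair (a := (vclass (2 * x - 1, 2 * y - 1), none))
          (b := (vclass (2 * x, 2 * (y - 1)), some (.inr w)))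
          (d := (vclass (2 * x + 1, 2 * y - 1), none))
          (e := (vclass (2 * x, 2 * (y - 1)), (θ (x, y - 1)).map .inr)) (by linarith)
        rcases this with h | h <;> exact absurd h (state_ne (by dsimp only; omega))
      all_goals
        rw [show 2 * x - 1 + 2 = 2 * x + 1 by ring, show 2 * (y - 1) + 1 = 2 * y - 1 by ring]
        have := code_bounds (κ := κ) (ω := ω) (vclass (2 * x + 1, 2 * y - 1), none)
        have := code_bounds (κ := κ) (ω := ω)
          (vclass (2 * x, 2 * (y - 1)), (θ (x, y - 1)).map .inr)
        have := code_bounds (κ := κ) (ω := ω) (vclass (2 * x, 2 * (y - 1)), some (.inr w))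
        omega)
  rw [boxOf_lowerLeft] at hG ⊢
  obtain ⟨w₀, c₀, rfl⟩ := mem_rects.1 (T.tile_mem _ ht)
  rw [edgeX_odd (2 * x - 1 + 1) (2 * y - 1) (by omega),
    edgeX_even (2 * x - 1) (2 * y - 1) (by omega), mul_add, mul_one, vertexOffset,
    vertexOffset] at hx1
  obtain ⟨e, -⟩ := rectOf_of_width (c := c₀) (w := w₀) (a := 2 * x - 1) (b := 2 * y - 1) (by omega)
    (q := vertexContent E tc θ (2 * x - 1 + 1, 2 * y - 1))
    (r := vertexContent E tc θ (2 * x - 1, 2 * y - 1 + 1)) (by linarith)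
  rw [e] at ht hx1
  -- The square at distance `maxCode` from the grid point in both directions lies in the brick for
  -- every choice of offsets. Reading a tile there does not presuppose `θ`, so there is no
  -- circularity.
  obtain ⟨w, hw, e'⟩ := hread x y w₀ _ hG ht (by
    rw [mem_cellsAt]
    have h1 := edgeX_bounds (S := mesh κ ω) hv (2 * x - 1) (2 * y - 1)
    have h2 := edgeY_bounds (S := mesh κ ω) hv (2 * x - 1) (2 * y - 1)
    have h3 := rectOf_dims tc w₀ (2 * x - 1, 2 * y - 1)
    dsimp only
    omega)
  rw [← e'] at ht hx1
  obtain ⟨-, e1, e2⟩ := rectOf_of_width (c := (2 * x - 1, 2 * y - 1)) (w := w) (a := 2 * x - 1)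
    (b := 2 * y - 1) (by omega)
    (q := vertexContent E tc θ (2 * x - 1 + 1, 2 * y - 1))
    (r := vertexContent E tc θ (2 * x - 1, 2 * y - 1 + 1)) (by linarith)
  rw [boxOf_lowerLeft] at e1 e2
  rw [show 2 * x - 1 + 1 = 2 * x by ring, vertexContent_bot,
    tileContent_down (by omega) (by omega)] at e1
  rw [show 2 * y - 1 + 1 = 2 * y by ring, vertexContent_left,
    tileContent_left (by omega) (by omega)] at e2
  refine ⟨w, hw, ?_, ht⟩
  rintro ⟨i, j⟩ ⟨hi, hj⟩
  dsimp only at hi hj ⊢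
  exact vertexContent_eq_tileContent (by omega) (by omega) (fun _ _ => hw)
    (fun _ _ => map_inl_eq e2) (by omega) (fun _ _ => map_inl_eq e1) (by omega)

/-- The upper right brick of a box. -/
theorem isWeak_upperRight (hθ : ∀ p, p ∉ G → θ p = none) {x y : ℤ}
    (k1 : IsFull θ T (2 * x - 1, 2 * y)) (k2 : IsFull θ T (2 * x, 2 * y - 1))
    (k3 : IsFull θ T (2 * x - 1, 2 * y - 1)) (k4 : IsFull θ T (2 * (x + 1) - 1, 2 * y - 1)) :
    IsWeak θ T (x, y) ∧ ((x, y + 1) ∉ G → IsFull θ T (2 * x, 2 * y)) := by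
  by_cases hG : (x, y) ∈ G
  swap
  · exact ⟨fun h => absurd h hG, fun _ h => absurd (by rwa [boxOf_upperRight] at h) hG⟩
  have gS := eight_mul_maxCode_lt κ ω
  have g0 := maxCode_pos κ ω
  have hS' := maxCode_lt_mesh κ ω
  have hv := offsetsIn_vertexOffset E tc θ
  have hT := isBoxTiling T hθ
  have hb : boxOf (2 * x, 2 * y) ∈ G := by rwa [boxOf_upperRight]
  obtain ⟨y₁, t, ht, hx1, hy1⟩ := exists_tile_even gS g0.le hv hT (by omega) hb
    (k1.placed' (by ring) (by ring)) (k2.placed' (by ring) (by ring))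
    (k3.placed' (by ring) (by ring)) (vertexOffset_ne (by dsimp only; omega)) (by
      intro hG'
      refine ⟨edgeY (mesh κ ω) (vertexOffset E tc θ) (2 * x + 1) (2 * y - 1 + 1), ?_, ?_, ?_, ?_⟩
      rotate_left 3
      · have := k4.placed' (a := 2 * x + 1) (b := 2 * y - 1) (by ring) (by ring) hG'
        dsimp only at this
        rwa [show 2 * x + 1 + 1 = 2 * x + 2 by ring] at this
      · rw [edgeY_odd _ _ (by omega), show 2 * x + 1 + 1 = 2 * x + 2 by ring,
          show 2 * y - 1 + 1 = 2 * y by ring]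
        intro e
        exact vertexOffset_ne (E := E) (tc := tc) (θ := θ) (u := (2 * x + 2, 2 * y))
          (u' := (2 * x, 2 * y)) (by dsimp only; omega) (by linarith)
      all_goals
        rw [show 2 * y - 1 + 1 = 2 * y by ring]
        have := edgeY_bounds (S := mesh κ ω) hv (2 * x + 1) (2 * y)
        omega)
  obtain ⟨w, c₀, rfl⟩ := mem_rects.1 (T.tile_mem _ ht)
  have hx2 := hx1
  rw [edgeX_odd (2 * x + 1) (2 * y) (by omega),
    edgeX_even (2 * x) (2 * y) (by omega), mul_add, mul_one, vertexOffset,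
    vertexOffset] at hx2
  obtain ⟨e, e1, e2⟩ := rectOf_of_width (c := c₀) (w := w) (a := 2 * x) (b := 2 * y) (by omega)
    (q := vertexContent E tc θ (2 * x + 1, 2 * y))
    (r := vertexContent E tc θ (2 * x, 2 * y + 1)) (by linarith)
  rw [e] at ht hx1 hy1
  rw [boxOf_upperRight] at e1 e2
  rw [show 2 * x + 1 = 2 * (x + 1) - 1 by ring, vertexContent_left,
    tileContent_right (by dsimp only; omega) (by dsimp only; omega)] at e1
  rw [show 2 * y + 1 = 2 * (y + 1) - 1 by ring, vertexContent_bot,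
    tileContent_up (by dsimp only; omega) (by dsimp only; omega)] at e2
  -- The width has revealed the two colors. The tile is encoded in the height, which is known here
  -- only if the region ends above the box.
  refine ⟨fun _ => ⟨w, ht, map_inl_eq e1, map_inl_eq e2⟩, fun hup _ => ?_⟩
  have b1 := hv (2 * x, 2 * y)
  have b2 := hv (2 * x, 2 * y + 1)
  have b3 := hv (2 * x + 1, 2 * y)
  have b4 := hv (2 * x + 1, 2 * y + 1)
  have b5 := hv (2 * x + 1, 2 * y + 2)
  have b6 := hv (2 * x, 2 * y + 2)
  have s1 : mesh κ ω * (2 * y + 1) = mesh κ ω * (2 * y) + mesh κ ω := by ring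
  have m0 := fun X Y => mem_brick_even (S := mesh κ ω) (v := vertexOffset E tc θ) (x := X) (y := Y)
    (a := 2 * x) (b := 2 * y) (by omega) rfl rfl
  have m1 := fun X Y => mem_brick_odd (S := mesh κ ω) (v := vertexOffset E tc θ) (x := X) (y := Y)
    (a := 2 * x) (b := 2 * y + 1) (a' := 2 * x + 1) (b' := 2 * y + 2) (by omega) (by omega)
    (by omega)
  have hF : ∀ {X Y : ℤ} {c : Cell}, (X, Y) ∈ brick (mesh κ ω) (vertexOffset E tc θ) c →
      ((X, Y) ∈ brickRegion (mesh κ ω) (vertexOffset E tc θ) G ↔ boxOf c ∈ G) := fun h =>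
    mem_brickRegion_iff_of_mem_brick hS' g0.le hv h
  have q1 := edgeX_even (S := mesh κ ω) (v := vertexOffset E tc θ) (2 * x) (2 * y) (by omega)
  have q2 := edgeY_even (S := mesh κ ω) (v := vertexOffset E tc θ) (2 * x) (2 * y) (by omega)
  have q3 := edgeY_odd (S := mesh κ ω) (v := vertexOffset E tc θ) (2 * x) (2 * y + 1) (by omega)
  have dd := rectOf_dims tc w (2 * x, 2 * y)
  have top := hT.top_forced (Y := edgeY (mesh κ ω) (vertexOffset E tc θ) (2 * x) (2 * y + 1))
    ⟨_, ht, hx1, hy1⟩ (by omega) (by omega)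
    (by
      rw [hF (c := (2 * x, 2 * y + 1)) ((m1 _ _).2 (by omega)),
        show 2 * y + 1 = 2 * (y + 1) - 1 by ring, boxOf_lowerRight]
      exact hup)
    (by
      intro Y h1 h2
      exact (hF (c := (2 * x, 2 * y)) ((m0 _ _).2 (by omega))).2 hb)
  rw [hy1, height_rectOf_even tc w (by omega), boxOf_upperRight, tileOffset_center,
    tileOffset_corner w (by omega) (by omega), q2, q3, vertexOffset_center,
    vertexOffset_corner (by omega) (by omega)] at top
  have hw : θ (x, y) = some w := map_inr_eq (state_eq (code_injective (κ := κ) (ω := ω)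
    (s := (vclass (2 * x, 2 * y), (θ (x, y)).map .inr)) (by linarith))).2.2
  rw [boxOf_upperRight]
  refine ⟨w, hw, ?_, ht⟩
  rintro ⟨i, j⟩ ⟨hi, hj⟩
  dsimp only at hi hj ⊢
  exact vertexContent_eq_tileContent (by omega) (by omega) (fun _ _ => hw) (by omega)
    (fun _ _ => map_inl_eq e1) (by omega) (fun _ _ => map_inl_eq e2)

end

section
variable {κ ω : Type} {G : Finset Cell} {E : EdgeColoring κ G} {tc : ω → Dir → κ}
  {θ : Cell → Option ω} [Fintype κ] [Fintype ω] {T : RectTiling (rects tc) (boxRegion E tc)}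

/-- The lower right brick of a box, and the brick below. -/
theorem exists_tile_lowerRight (hθ : ∀ p, p ∉ G → θ p = none) {x y : ℤ} (hG : (x, y) ∈ G)
    (k1 : IsFull θ T (2 * x - 1, 2 * y - 1)) (k2 : IsFull θ T (2 * x - 1, 2 * y))
    (k3 : IsFull θ T (2 * x - 1, 2 * (y - 1))) (k4 : IsWeak θ T (x, y - 1)) :
    IsFull θ T (2 * x, 2 * (y - 1)) ∧
      ∃ x₁, IsTile T (edgeX (mesh κ ω) (vertexOffset E tc θ) (2 * x) (2 * y - 1)) x₁
        (edgeY (mesh κ ω) (vertexOffset E tc θ) (2 * x) (2 * y - 1))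
        (edgeY (mesh κ ω) (vertexOffset E tc θ) (2 * x) (2 * y)) := by
  have gS := eight_mul_maxCode_lt κ ω
  have g0 := maxCode_pos κ ω
  have hS' := maxCode_lt_mesh κ ω
  have hv := offsetsIn_vertexOffset E tc θ
  have hT := isBoxTiling T hθ
  have hb : boxOf (2 * x, 2 * y - 1) ∈ G := by rwa [boxOf_lowerRight]
  have b1 := hv (2 * x, 2 * y - 1)
  have b2 := hv (2 * x + 1, 2 * y - 1)
  have b3 := hv (2 * x, 2 * y)
  have b4 := hv (2 * x + 1, 2 * y)
  have b5 := hv (2 * x, 2 * y - 2)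
  have b6 := hv (2 * x + 1, 2 * y - 2)
  have s1 : mesh κ ω * (2 * y - 1) = mesh κ ω * (2 * y) - mesh κ ω := by ring
  have s2 : mesh κ ω * (2 * y - 2) = mesh κ ω * (2 * y) - mesh κ ω - mesh κ ω := by ring
  have m0 := fun X Y => mem_brick_odd (S := mesh κ ω) (v := vertexOffset E tc θ) (x := X) (y := Y)
    (a := 2 * x) (b := 2 * y - 1) (a' := 2 * x + 1) (b' := 2 * y) (by omega) (by omega) (by omega)
  have m1 := fun X Y => mem_brick_even (S := mesh κ ω) (v := vertexOffset E tc θ) (x := X) (y := Y)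
    (a := 2 * x) (b := 2 * y - 2) (a' := 2 * x + 1) (b' := 2 * y - 1) (by omega) (by omega)
    (by omega)
  have hF : ∀ {X Y : ℤ} {c : Cell}, (X, Y) ∈ brick (mesh κ ω) (vertexOffset E tc θ) c →
      ((X, Y) ∈ brickRegion (mesh κ ω) (vertexOffset E tc θ) G ↔ boxOf c ∈ G) := fun h =>
    mem_brickRegion_iff_of_mem_brick hS' g0.le hv h
  have q1 := edgeX_odd (S := mesh κ ω) (v := vertexOffset E tc θ) (2 * x) (2 * y - 1) (by omega)
  have q2 := edgeY_odd (S := mesh κ ω) (v := vertexOffset E tc θ) (2 * x) (2 * y - 1) (by omega)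
  have q3 := edgeX_even (S := mesh κ ω) (v := vertexOffset E tc θ) (2 * x) (2 * y - 2) (by omega)
  have q4 := edgeY_even (S := mesh κ ω) (v := vertexOffset E tc θ) (2 * x) (2 * y - 2) (by omega)
  have q5 := edgeX_odd (S := mesh κ ω) (v := vertexOffset E tc θ) (2 * x + 1) (2 * y - 2)
    (by omega)
  have q6 := edgeY_even (S := mesh κ ω) (v := vertexOffset E tc θ) (2 * x) (2 * y) (by omega)
  have s3 : mesh κ ω * (2 * x + 1) = mesh κ ω * (2 * x) + mesh κ ω := by ring
  rw [show 2 * y - 2 + 1 = 2 * y - 1 by ring] at q3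
  have forced := fun Y hy hF' k => exists_tile_odd (y := Y) gS g0.le hv hT (a := 2 * x)
    (b := 2 * y - 1) (by omega) hb (k1.placed' (by ring) (by ring)) (k2.placed' (by ring) (by ring))
    (k3.placed' (by ring) (by ring)) (vertexOffset_ne (by dsimp only; omega)) hy hF' k
  rw [show 2 * y - 1 + 1 = 2 * y by ring] at forced
  by_cases hG' : (x, y - 1) ∈ G
  · have hb' : boxOf (2 * x, 2 * y - 2) ∈ G := by
      rwa [show 2 * y - 2 = 2 * (y - 1) by ring, boxOf_upperRight]
    obtain ⟨w, h1, h2, h3, h5⟩ := k4.isTile hG'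
    obtain ⟨w', hw', -⟩ := k3 (by rwa [boxOf_upperLeft])
    rw [boxOf_upperLeft] at hw'
    have c1 := code_bounds (κ := κ) (ω := ω) (vclass (2 * x + 1, 2 * y - 1), none)
    have c2 := code_bounds (κ := κ) (ω := ω) (vclass (2 * x, 2 * (y - 1)), some (.inr w))
    have c3 := code_bounds (κ := κ) (ω := ω) (vclass (2 * x, 2 * (y - 1)), some (.inr w'))
    rw [hw', Option.map_some, show 2 * (y - 1) + 1 = 2 * y - 1 by ring,
      show 2 * (y - 1) = 2 * y - 2 by ring, q3, q4, q5] at h5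
    rw [show 2 * (y - 1) = 2 * y - 2 by ring] at c2 c3
    -- The actual top of the rectangle below. It differs from the expected one by the codes of `w'`,
    -- the tile read in that box, and `w`, the tile to which this rectangle belongs.
    obtain ⟨Y, hY⟩ : ∃ Y, Y = mesh κ ω * (2 * y - 1) + (code (κ := κ) (ω := ω) (vclass (2 * x + 1, 2 * y - 1), none) +
          code (κ := κ) (ω := ω) (vclass (2 * x, 2 * y - 2), some (.inr w')) -
          code (κ := κ) (ω := ω) (vclass (2 * x, 2 * y - 2), some (.inr w))) := ⟨_, rfl⟩
    rw [← hY] at h5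
    obtain ⟨x₁, t, ht, hx1, hy1⟩ := forced Y (by omega)
      (by
        rw [q1]
        by_cases hy : mesh κ ω * (2 * y - 1) + vertexOffset E tc θ (2 * x + 1, 2 * y - 1) ≤ Y
        · exact (hF (c := (2 * x, 2 * y - 1)) ((m0 _ _).2 (by omega))).2 hb
        · exact (hF (c := (2 * x, 2 * y - 2)) ((m1 _ _).2 (by omega))).2 hb')
      (by
        rw [q1]
        exact hT.separated_of_tile h5 (by omega) (by omega) (by omega))
    obtain ⟨w₀, c₀, rfl⟩ := mem_rects.1 (T.tile_mem _ ht)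
    -- The upper side of the new rectangle is where it should be, so its height shows the
    -- discrepancy between `w'` and `w`, and no rectangle of the set has such a height unless they
    -- agree.
    obtain rfl : w' = w := eq_of_height (x := x) (y := y) (q := (θ (x, y)).map .inr) (w := w₀)
      (c := c₀) (tc := tc) (by
        rw [q6, vertexOffset_center] at hy1
        linarith)
    refine ⟨fun _ => ⟨w', ?_, ?_, h1⟩, x₁, ?_⟩
    · rwa [boxOf_upperRight]
    · rw [boxOf_upperRight]
      rintro ⟨i, j⟩ ⟨hi, hj⟩
      dsimp only at hi hj ⊢
      exact vertexContent_eq_tileContent (by omega) (by omega) (fun _ _ => hw') (by omega)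
        (fun _ _ => h2) (by omega) (fun _ _ => h3)
    · refine ⟨_, ?_, hx1, ?_⟩
      · convert ht using 3
        rw [q2, vertexOffset_corner (by omega) (by omega), hY]
        ring
      · rw [hy1, q2, vertexOffset_corner (by omega) (by omega), hY]
        ring
  · have hb' : boxOf (2 * x, 2 * y - 2) ∉ G := by
      rwa [show 2 * y - 2 = 2 * (y - 1) by ring, boxOf_upperRight]
    refine ⟨fun h => absurd (by rwa [boxOf_upperRight] at h) hG', ?_⟩
    refine forced _ (by omega) ?_ ?_
    · exact (hF (c := (2 * x, 2 * y - 1)) ((m0 _ _).2 (by omega))).2 hb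
    · refine hT.separated_of_not ?_
      rwa [hF (c := (2 * x, 2 * y - 2)) ((m1 _ _).2 (by omega))]

/-- The height identifies the tile. If there is a box on the right, the common side shows the color
of the tile on its left by definition, and the agreement is tested when the right box is placed.
Otherwise the region ends there and forces the width, which shows that the prescribed color is that
of the tile. -/
theorem isFull_lowerRight (hθ : ∀ p, p ∉ G → θ p = none) {x y : ℤ} (hG : (x, y) ∈ G)
    (k1 : IsFull θ T (2 * x - 1, 2 * y - 1)) (k2 : IsFull θ T (2 * x - 1, 2 * y))
    (k3 : IsFull θ T (2 * x - 1, 2 * (y - 1))) (k4 : IsWeak θ T (x, y - 1)) :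
    IsFull θ T (2 * x, 2 * y - 1) ∧ IsFull θ T (2 * x, 2 * (y - 1)) := by
  obtain ⟨hd, x₁, t, ht, hx1, hy1⟩ := exists_tile_lowerRight hθ hG k1 k2 k3 k4
  refine ⟨fun _ => ?_, hd⟩
  have gS := eight_mul_maxCode_lt κ ω
  have g0 := maxCode_pos κ ω
  have hS' := maxCode_lt_mesh κ ω
  have hv := offsetsIn_vertexOffset E tc θ
  have hT := isBoxTiling T hθ
  have hb : boxOf (2 * x, 2 * y - 1) ∈ G := by rwa [boxOf_lowerRight]
  obtain ⟨w, hw, hcon, -⟩ := k1 (by rwa [boxOf_lowerLeft])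
  rw [boxOf_lowerLeft] at hw hcon
  have hdown := hcon (2 * x, 2 * y - 1) ⟨Or.inr (by dsimp only; ring), Or.inl rfl⟩
  rw [vertexContent_bot, tileContent_down (by dsimp only; omega) (by dsimp only; omega)] at hdown
  obtain ⟨w₀, c₀, rfl⟩ := mem_rects.1 (T.tile_mem _ ht)
  have q1 := edgeX_odd (S := mesh κ ω) (v := vertexOffset E tc θ) (2 * x) (2 * y - 1) (by omega)
  have q2 := edgeY_odd (S := mesh κ ω) (v := vertexOffset E tc θ) (2 * x) (2 * y - 1) (by omega)
  have q3 := edgeY_even (S := mesh κ ω) (v := vertexOffset E tc θ) (2 * x) (2 * y) (by omega)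
  have q4 := edgeX_even (S := mesh κ ω) (v := vertexOffset E tc θ) (2 * x + 1) (2 * y - 1)
    (by omega)
  rw [show 2 * y - 1 + 1 = 2 * y by ring] at q4
  have s1 : mesh κ ω * (2 * y - 1) = mesh κ ω * (2 * y) - mesh κ ω := by ring
  have s3 : mesh κ ω * (2 * x + 1) = mesh κ ω * (2 * x) + mesh κ ω := by ring
  have hy2 := hy1
  rw [q2, q3, vertexOffset, vertexOffset] at hy2
  obtain ⟨e, e1, -⟩ := rectOf_of_height (c := c₀) (w := w₀) (a := 2 * x) (b := 2 * y - 1)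
    (by omega) (q := vertexContent E tc θ (2 * x, 2 * y - 1 + 1))
    (r := vertexContent E tc θ (2 * x + 1, 2 * y - 1)) (by
      rw [show 2 * y - 1 + 1 = 2 * y by ring]
      linarith)
  rw [boxOf_lowerRight] at e1
  rw [show 2 * y - 1 + 1 = 2 * y by ring, vertexContent_center,
    tileContent_center (by dsimp only; omega) (by dsimp only; omega)] at e1
  have e2 := map_inr_eq e1
  obtain rfl : w = w₀ := Option.some.inj (hw.symm.trans e2)
  rw [e] at ht hx1 hy1
  have hright : edgeL E tc θ (x + 1, y) = some (tc w .right) := by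
    by_cases hr : (x + 1, y) ∈ G
    · rw [edgeL_of_mem hr (by simpa using hG)]
      simp [hw]
    · have b1 := hv (2 * x, 2 * y - 1)
      have b2 := hv (2 * x + 1, 2 * y - 1)
      have b3 := hv (2 * x, 2 * y)
      have b4 := hv (2 * x + 1, 2 * y)
      have b5 := hv (2 * x + 2, 2 * y - 1)
      have b6 := hv (2 * x + 2, 2 * y)
      have m0 := fun X Y => mem_brick_odd (S := mesh κ ω) (v := vertexOffset E tc θ) (x := X)
        (y := Y) (a := 2 * x) (b := 2 * y - 1) (a' := 2 * x + 1) (b' := 2 * y) (by omega) (by omega)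
        (by omega)
      have m1 := fun X Y => mem_brick_even (S := mesh κ ω) (v := vertexOffset E tc θ) (x := X)
        (y := Y) (a := 2 * x + 1) (b := 2 * y - 1) (a' := 2 * x + 2) (b' := 2 * y) (by omega)
        (by omega) (by omega)
      have hF : ∀ {X Y : ℤ} {c : Cell}, (X, Y) ∈ brick (mesh κ ω) (vertexOffset E tc θ) c →
          ((X, Y) ∈ brickRegion (mesh κ ω) (vertexOffset E tc θ) G ↔ boxOf c ∈ G) := fun h =>
        mem_brickRegion_iff_of_mem_brick hS' g0.le hv h
      have dd := rectOf_dims tc w (2 * x, 2 * y - 1)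
      have right := hT.right_forced
        (X := edgeX (mesh κ ω) (vertexOffset E tc θ) (2 * x + 1) (2 * y - 1))
        ⟨_, ht, hx1, hy1⟩ (by omega) (by omega)
        (by
          rw [hF (c := (2 * x + 1, 2 * y - 1)) ((m1 _ _).2 (by omega)),
            show 2 * x + 1 = 2 * (x + 1) - 1 by ring, boxOf_lowerLeft]
          exact hr)
        (by
          intro X h1 h2
          exact (hF (c := (2 * x, 2 * y - 1)) ((m0 _ _).2 (by omega))).2 hb)
      rw [hx1, width_rectOf_odd tc w (by omega), boxOf_lowerRight,
        show 2 * y - 1 + 1 = 2 * y by ring, tileOffset_right, tileOffset_bot, q1, q4,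
        vertexOffset_right, vertexOffset_bot, hdown] at right
      exact map_inl_eq (state_eq (code_injective (κ := κ) (ω := ω)
        (s := (vclass (2 * x + 1, 2 * y), (edgeL E tc θ (x + 1, y)).map .inl)) (by linarith))).2.2
  rw [boxOf_lowerRight]
  refine ⟨w, hw, ?_, ht⟩
  rintro ⟨i, j⟩ ⟨hi, hj⟩
  dsimp only at hi hj ⊢
  exact vertexContent_eq_tileContent (by omega) (by omega) (fun _ _ => hw) (by omega)
    (fun _ _ => hright) (fun _ _ => map_inl_eq hdown) (by omega)

/-- The upper left brick of a box. -/
theorem isFull_upperLeft (hθ : ∀ p, p ∉ G → θ p = none) {x y : ℤ}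
    (k1 : IsFull θ T (2 * (x - 1), 2 * y)) (k2 : IsFull θ T (2 * (x - 1), 2 * (y + 1) - 1))
    (k3 : IsFull θ T (2 * (x - 1), 2 * y - 1)) (k4 : IsFull θ T (2 * x - 1, 2 * y - 1)) :
    IsFull θ T (2 * x - 1, 2 * y) := by
  intro hb
  have hG : (x, y) ∈ G := by rwa [boxOf_upperLeft] at hb
  have gS := eight_mul_maxCode_lt κ ω
  have g0 := maxCode_pos κ ω
  have hS' := maxCode_lt_mesh κ ω
  have hv := offsetsIn_vertexOffset E tc θ
  have hT := isBoxTiling T hθ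
  obtain ⟨w, hw, hcon, -⟩ := k4 (by rwa [boxOf_lowerLeft])
  rw [boxOf_lowerLeft] at hw hcon
  have hleft := hcon (2 * x - 1, 2 * y) ⟨Or.inl rfl, Or.inr (by dsimp only; ring)⟩
  rw [vertexContent_left, tileContent_left (by dsimp only; omega) (by dsimp only; omega)] at hleft
  have b1 := hv (2 * x - 1, 2 * y)
  have b2 := hv (2 * x, 2 * y)
  have b3 := hv (2 * x - 1, 2 * y + 1)
  have b4 := hv (2 * x, 2 * y + 1)
  have b5 := hv (2 * x - 1, 2 * y - 1)
  have b6 := hv (2 * x, 2 * y - 1)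
  have m0 := fun X Y => mem_brick_odd (S := mesh κ ω) (v := vertexOffset E tc θ) (x := X) (y := Y)
    (a := 2 * x - 1) (b := 2 * y) (a' := 2 * x) (b' := 2 * y + 1) (by omega) (by omega) (by omega)
  have m1 := fun X Y => mem_brick_even (S := mesh κ ω) (v := vertexOffset E tc θ) (x := X) (y := Y)
    (a := 2 * x - 1) (b := 2 * y - 1) (a' := 2 * x) (b' := 2 * y) (by omega) (by omega) (by omega)
  have hF : ∀ {X Y : ℤ} {c : Cell}, (X, Y) ∈ brick (mesh κ ω) (vertexOffset E tc θ) c →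
      ((X, Y) ∈ brickRegion (mesh κ ω) (vertexOffset E tc θ) G ↔ boxOf c ∈ G) := fun h =>
    mem_brickRegion_iff_of_mem_brick hS' g0.le hv h
  have q1 := edgeX_odd (S := mesh κ ω) (v := vertexOffset E tc θ) (2 * x - 1) (2 * y) (by omega)
  have q2 := edgeY_odd (S := mesh κ ω) (v := vertexOffset E tc θ) (2 * x - 1) (2 * y) (by omega)
  rw [show 2 * x - 1 + 1 = 2 * x by ring] at q2
  have q3 := edgeY_even (S := mesh κ ω) (v := vertexOffset E tc θ) (2 * x - 1) (2 * y + 1)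
    (by omega)
  have s1 : mesh κ ω * (2 * x - 1) = mesh κ ω * (2 * x) - mesh κ ω := by ring
  have s2 : mesh κ ω * (2 * y - 1) = mesh κ ω * (2 * y) - mesh κ ω := by ring
  have s3 : mesh κ ω * (2 * y + 1) = mesh κ ω * (2 * y) + mesh κ ω := by ring
  obtain ⟨x₁, t, ht, hx1, hy1⟩ := exists_tile_odd gS g0.le hv hT (by omega) hb
    (y := edgeY (mesh κ ω) (vertexOffset E tc θ) (2 * x - 1) (2 * y))
    (k1.placed' (by ring) (by ring)) (k2.placed' (by ring) (by ring))
    (k3.placed' (by ring) (by ring)) (vertexOffset_ne (by dsimp only; omega)) (by omega)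
    ((hF (c := (2 * x - 1, 2 * y)) ((m0 _ _).2 (by omega))).2 hb)
    (k4.placed.separated hS' g0.le hv hT ((m1 _ _).2 (by omega)) (mt (m1 _ _).1 (by omega)))
  obtain ⟨w₀, c₀, rfl⟩ := mem_rects.1 (T.tile_mem _ ht)
  have hy2 := hy1
  rw [q2, q3, vertexOffset, vertexOffset] at hy2
  obtain ⟨e, -, e1⟩ := rectOf_of_height (c := c₀) (w := w₀) (a := 2 * x - 1) (b := 2 * y)
    (by omega) (q := vertexContent E tc θ (2 * x - 1, 2 * y + 1))
    (r := vertexContent E tc θ (2 * x - 1 + 1, 2 * y)) (by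
      rw [show 2 * x - 1 + 1 = 2 * x by ring]
      linarith)
  rw [boxOf_upperLeft] at e1
  rw [show 2 * x - 1 + 1 = 2 * x by ring, vertexContent_center,
    tileContent_center (by dsimp only; omega) (by dsimp only; omega)] at e1
  obtain rfl : w = w₀ := Option.some.inj (hw.symm.trans (map_inr_eq e1))
  rw [e] at ht hx1 hy1
  -- With a box above, this holds by the definition of the shown color. Otherwise the corners `(2 *
  -- x - 1, 2 * y + 1)` and `(2 * x + 1, 2 * y + 1)` have different offsets, so the upper boundary
  -- has a step at the midpoint of the side, and the rectangle must end at this step.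
  have hup : edgeB E tc θ (x, y + 1) = some (tc w .up) := by
    by_cases hr : (x, y + 1) ∈ G
    · rw [edgeB_of_mem hr (by simpa using hG)]
      simp [hw]
    · have b7 := hv (2 * x + 1, 2 * y)
      have b8 := hv (2 * x + 1, 2 * y + 1)
      have b9 := hv (2 * x + 1, 2 * y + 2)
      have b10 := hv (2 * x, 2 * y + 2)
      have b11 := hv (2 * x - 1, 2 * y + 2)
      have m2 := fun X Y => mem_brick_even (S := mesh κ ω) (v := vertexOffset E tc θ) (x := X)
        (y := Y) (a := 2 * x) (b := 2 * y) (a' := 2 * x + 1) (b' := 2 * y + 1) (by omega)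
        (by omega) (by omega)
      have m3 := fun X Y => mem_brick_even (S := mesh κ ω) (v := vertexOffset E tc θ) (x := X)
        (y := Y) (a := 2 * x - 1) (b := 2 * y + 1) (a' := 2 * x) (b' := 2 * y + 2) (by omega)
        (by omega) (by omega)
      have m4 := fun X Y => mem_brick_odd (S := mesh κ ω) (v := vertexOffset E tc θ) (x := X)
        (y := Y) (a := 2 * x) (b := 2 * y + 1) (a' := 2 * x + 1) (b' := 2 * y + 2) (by omega)
        (by omega) (by omega)
      have dd := rectOf_dims tc w (2 * x - 1, 2 * y)
      have hne := vertexOffset_ne (E := E) (tc := tc) (θ := θ) (u := (2 * x - 1, 2 * y + 1))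
        (u' := (2 * x + 1, 2 * y + 1)) (by dsimp only; omega)
      have n3 : boxOf (2 * x - 1, 2 * y + 1) ∉ G := by
        rwa [show 2 * y + 1 = 2 * (y + 1) - 1 by ring, boxOf_lowerLeft]
      have n4 : boxOf (2 * x, 2 * y + 1) ∉ G := by
        rwa [show 2 * y + 1 = 2 * (y + 1) - 1 by ring, boxOf_lowerRight]
      have right := hT.right_forced_of_step
        (X := mesh κ ω * (2 * x) + vertexOffset E tc θ (2 * x, 2 * y + 1))
        (Y := mesh κ ω * (2 * y + 1) + vertexOffset E tc θ (2 * x + 1, 2 * y + 1))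
        ⟨_, ht, hx1, hy1⟩ (by omega) (by omega) (by omega) (by omega)
        (by
          intro X h1 h2
          exact (hF (c := (2 * x - 1, 2 * y)) ((m0 _ _).2 (by omega))).2 hb)
        (by rwa [hF (c := (2 * x - 1, 2 * y + 1)) ((m3 _ _).2 (by omega))])
        (by
          intro h1
          refine ⟨(hF (c := (2 * x, 2 * y)) ((m2 _ _).2 (by omega))).2 ?_, ?_⟩
          · rwa [boxOf_upperRight]
          · rwa [hF (c := (2 * x, 2 * y + 1)) ((m4 _ _).2 (by omega))])
        (by
          intro h1
          rwa [hF (c := (2 * x, 2 * y + 1)) ((m4 _ _).2 (by omega))])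
      rw [hx1, width_rectOf_odd tc w (by omega), boxOf_upperLeft,
        show 2 * x - 1 + 1 = 2 * x by ring, tileOffset_top, tileOffset_left, q1,
        vertexOffset_top, vertexOffset_left, hleft] at right
      exact map_inl_eq (state_eq (code_injective (κ := κ) (ω := ω)
        (s := (vclass (2 * x, 2 * y + 1), (edgeB E tc θ (x, y + 1)).map .inl)) (by linarith))).2.2
  rw [boxOf_upperLeft]
  refine ⟨w, hw, ?_, ht⟩
  rintro ⟨i, j⟩ ⟨hi, hj⟩
  dsimp only at hi hj ⊢
  exact vertexContent_eq_tileContent (by omega) (by omega) (fun _ _ => hw)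
    (fun _ _ => map_inl_eq hleft) (by omega) (by omega) (fun _ _ => hup)

end

/-! ### Induction along the diagonals of bricks -/

theorem int_induction {p : ℤ → Prop} (N : ℤ) (h0 : ∀ n ≤ N, p n) (hs : ∀ n, p (n - 1) → p n)
    (n : ℤ) : p n := by
  rcases le_total n N with h | h
  · exact h0 n h
  · induction n, h using Int.leInduction with
    | base => exact h0 N le_rfl
    | succ n _ ih => exact hs (n + 1) (by simpa using ih)

theorem exists_lower_bound (G : Finset Cell) : ∃ N : ℤ, ∀ x y, (x, y) ∈ G → N < x ∧ N < y := by
  obtain ⟨N₁, h₁⟩ := (G.image Prod.fst).bddBelow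
  obtain ⟨N₂, h₂⟩ := (G.image Prod.snd).bddBelow
  refine ⟨min N₁ N₂ - 1, fun x y h => ?_⟩
  have e₁ : N₁ ≤ x := h₁ (by simpa using ⟨y, h⟩)
  have e₂ : N₂ ≤ y := h₂ (by simpa using ⟨x, h⟩)
  omega

section
variable {κ ω : Type} {G : Finset Cell} {E : EdgeColoring κ G} {tc : ω → Dir → κ}
  {θ : Cell → Option ω} [Fintype κ] [Fintype ω] {T : RectTiling (rects tc) (boxRegion E tc)}

open scoped Classical in
variable (T) in
/-- The tile of the square `p` that is encoded in a tiling. -/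
noncomputable def readTile (p : Cell) : Option ω :=
  if h : p ∈ G ∧ ∃ w pos, (rectOf tc w (2 * p.1 - 1, 2 * p.2 - 1), pos) ∈ T.tiles ∧
      (mesh κ ω * (2 * p.1 - 1) + maxCode κ ω, mesh κ ω * (2 * p.2 - 1) + maxCode κ ω) ∈
        (rectOf tc w (2 * p.1 - 1, 2 * p.2 - 1)).cellsAt pos
    then some h.2.choose else none

theorem readTile_of_notMem (p : Cell) (h : p ∉ G) : readTile T p = none :=
  dif_neg fun h' => h h'.1

theorem readTile_of_mem (x y : ℤ) (w : ω) (pos : Cell) (hG : (x, y) ∈ G)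
    (ht : (rectOf tc w (2 * x - 1, 2 * y - 1), pos) ∈ T.tiles)
    (hm : (mesh κ ω * (2 * x - 1) + maxCode κ ω, mesh κ ω * (2 * y - 1) + maxCode κ ω) ∈
        (rectOf tc w (2 * x - 1, 2 * y - 1)).cellsAt pos) :
    ∃ w', readTile T (x, y) = some w' ∧
      rectOf tc w' (2 * x - 1, 2 * y - 1) = rectOf tc w (2 * x - 1, 2 * y - 1) := by
  have h : (x, y) ∈ G ∧ ∃ w pos, (rectOf tc w (2 * x - 1, 2 * y - 1), pos) ∈ T.tiles ∧
      (mesh κ ω * (2 * x - 1) + maxCode κ ω, mesh κ ω * (2 * y - 1) + maxCode κ ω) ∈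
        (rectOf tc w (2 * x - 1, 2 * y - 1)).cellsAt pos := ⟨hG, w, pos, ht, hm⟩
  refine ⟨h.2.choose, dif_pos h, ?_⟩
  obtain ⟨pos', ht', hm'⟩ := h.2.choose_spec
  exact congrArg Prod.fst (T.eq_of_mem ht' ht hm' hm)

theorem IsFull.of_notMem {c : Cell} (h : boxOf c ∉ G) : IsFull θ T c := fun h' => absurd h' h

variable (T) in
/-- All bricks are covered by the right rectangles. -/
theorem isFull_readTile (c : Cell) : IsFull (readTile T) T c := by
  obtain ⟨N, hN⟩ := exists_lower_bound G
  have hθ : ∀ p, p ∉ G → readTile T p = none := readTile_of_notMem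
  -- These are the bricks `(a, b)` with `a + b = 2 * d`. An even brick needs its lower right
  -- neighbor on the same diagonal, so the inner induction, with variable `n`, goes by increasing
  -- `y`.
  let even := fun d : ℤ => ∀ n x y : ℤ, y = n → x + y = d → IsWeak (readTile T) T (x, y) ∧
    ((x, y + 1) ∉ G → IsFull (readTile T) T (2 * x, 2 * y)) ∧
    IsFull (readTile T) T (2 * (x + 1) - 1, 2 * y - 1)
  -- These are the bricks with `a + b = 2 * d - 1`. An odd brick needs its upper left neighbor, so
  -- the inner induction goes by increasing `x`. The middle clause completes the upper right brick
  -- of the box below, which was known only weakly before.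
  let odd := fun d : ℤ => ∀ n x y : ℤ, x = n → x + y = d →
    IsFull (readTile T) T (2 * x - 1, 2 * y) ∧
    (∀ y', (x, y) ∈ G → y' = y - 1 → IsFull (readTile T) T (2 * x, 2 * y')) ∧
    IsFull (readTile T) T (2 * x, 2 * y - 1)
  have all : ∀ d, even d ∧ odd d := by
    -- Squares of `G` have both coordinates above `N`, so the boxes met for `d ≤ 2 * N` are all
    -- outside `G`.
    refine int_induction (2 * N) (fun d hd => ⟨?_, ?_⟩) ?_
    · intro n x y _ hxy
      have h1 : (x, y) ∉ G := fun h => by have := hN _ _ h; omega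
      have h2 : (x + 1, y) ∉ G := fun h => by have := hN _ _ h; omega
      exact ⟨fun h => absurd h h1, fun _ => .of_notMem (by rwa [boxOf_upperRight]),
        .of_notMem (by rwa [boxOf_lowerLeft])⟩
    · intro n x y _ hxy
      have h1 : (x, y) ∉ G := fun h => by have := hN _ _ h; omega
      exact ⟨.of_notMem (by rwa [boxOf_upperLeft]), fun _ h => absurd h h1,
        .of_notMem (by rwa [boxOf_lowerRight])⟩
    · rintro d ⟨he, ho⟩
      have ho' : odd d := by
        refine int_induction N ?_ ?_
        · intro n hn x y hx hxy
          have h1 : (x, y) ∉ G := fun h => by have := hN _ _ h; omega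
          exact ⟨.of_notMem (by rwa [boxOf_upperLeft]), fun _ h => absurd h h1,
            .of_notMem (by rwa [boxOf_lowerRight])⟩
        · intro n ih x y hx hxy
          have k00 : IsFull (readTile T) T (2 * x - 1, 2 * y - 1) := by
            have := (he y (x - 1) y rfl (by omega)).2.2
            rwa [sub_add_cancel] at this
          have ih' := ih (x - 1) (y + 1) (by omega) (by omega)
          -- The upper right brick of the box on the left is complete either because of the box
          -- above it, treated earlier on this diagonal, or because the region ends there.
          have k11 : IsFull (readTile T) T (2 * (x - 1), 2 * y) := by
            by_cases hG : (x - 1, y + 1) ∈ G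
            · exact ih'.2.1 y hG (by ring)
            · exact (he y (x - 1) y rfl (by omega)).2.1 hG
          have k01 := isFull_upperLeft hθ k11 ih'.2.2
            (ho (x - 1) (x - 1) y rfl (by omega)).2.2 k00
          by_cases hG : (x, y) ∈ G
          · have := isFull_lowerRight hθ hG k00 k01 (ho x x (y - 1) rfl (by omega)).1
              (he (y - 1) x (y - 1) rfl (by omega)).1
            exact ⟨k01, fun y' _ hy' => hy' ▸ this.2, this.1⟩
          · exact ⟨k01, fun _ h => absurd h hG, .of_notMem (by rwa [boxOf_lowerRight])⟩
      refine ⟨int_induction N ?_ ?_, ho'⟩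
      · intro n hn x y hy hxy
        have h1 : (x, y) ∉ G := fun h => by have := hN _ _ h; omega
        have h2 : (x + 1, y) ∉ G := fun h => by have := hN _ _ h; omega
        exact ⟨fun h => absurd h h1, fun _ => .of_notMem (by rwa [boxOf_upperRight]),
          .of_notMem (by rwa [boxOf_lowerLeft])⟩
      · intro n ih x y hy hxy
        have o := ho' x x y rfl hxy
        have k00 : IsFull (readTile T) T (2 * x - 1, 2 * y - 1) := by
          have := (he y (x - 1) y rfl (by omega)).2.2
          rwa [sub_add_cancel] at this
        have k11 : IsFull (readTile T) T (2 * x, 2 * (y - 1)) := by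
          by_cases hG : (x, y) ∈ G
          · exact o.2.1 _ hG rfl
          · exact (he (y - 1) x (y - 1) rfl (by omega)).2.1 (by rwa [sub_add_cancel])
        have k00' := isFull_lowerLeft (x := x + 1) (y := y) hθ readTile_of_mem
          (by rw [add_sub_cancel_right]; exact o.2.2)
          (ho' (x + 1) (x + 1) (y - 1) rfl (by omega)).1
          (by rw [add_sub_cancel_right]; exact k11) (ih (x + 1) (y - 1) (by omega) (by omega)).1
        have := isWeak_upperRight hθ o.1 o.2.2 k00 k00'
        exact ⟨this.1, this.2, k00'⟩
  obtain ⟨a, b⟩ := c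
  have ha : (∃ x, a = 2 * x) ∨ ∃ x, a = 2 * x - 1 := by
    rcases Int.emod_two_eq a with h | h
    · exact Or.inl ⟨a / 2, by omega⟩
    · exact Or.inr ⟨(a + 1) / 2, by omega⟩
  have hb : (∃ x, b = 2 * x) ∨ ∃ x, b = 2 * x - 1 := by
    rcases Int.emod_two_eq b with h | h
    · exact Or.inl ⟨b / 2, by omega⟩
    · exact Or.inr ⟨(b + 1) / 2, by omega⟩
  rcases ha with ⟨x, rfl⟩ | ⟨x, rfl⟩ <;> rcases hb with ⟨y, rfl⟩ | ⟨y, rfl⟩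
  · by_cases hG : (x, y + 1) ∈ G
    · exact ((all (x + (y + 1))).2 x x (y + 1) rfl rfl).2.1 y hG (by ring)
    · exact ((all (x + y)).1 y x y rfl rfl).2.1 hG
  · exact ((all (x + y)).2 x x y rfl rfl).2.2
  · exact ((all (x + y)).2 x x y rfl rfl).1
  · have := ((all (x - 1 + y)).1 y (x - 1) y rfl rfl).2.2
    rwa [sub_add_cancel] at this

-- The lower left and the upper right brick of a box together have all four midpoints of its sides
-- among their corners.
variable (T) in
theorem readTile_edges {x y : ℤ} {w : ω} (hw : readTile T (x, y) = some w) :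
    (x, y) ∈ G ∧
    edgeL E tc (readTile T) (x, y) = some (tc w .left) ∧
    edgeL E tc (readTile T) (x + 1, y) = some (tc w .right) ∧
    edgeB E tc (readTile T) (x, y) = some (tc w .down) ∧
    edgeB E tc (readTile T) (x, y + 1) = some (tc w .up) := by
  have hG : (x, y) ∈ G := by
    by_contra h
    rw [readTile_of_notMem _ h] at hw
    simp at hw
  have key : ∀ c, boxOf c = (x, y) → ∀ u, Incident u c →
      vertexContent E tc (readTile T) u = tileContent tc w (u.1 - 2 * x, u.2 - 2 * y) := by
    intro c hc
    obtain ⟨w', hw', h, -⟩ := isFull_readTile T c (by rwa [hc])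
    rw [hc] at hw' h
    obtain rfl : w' = w := Option.some.inj (hw'.symm.trans hw)
    exact h
  have h1 := key _ (boxOf_lowerLeft x y) (2 * x - 1, 2 * y)
    ⟨Or.inl rfl, Or.inr (by dsimp only; ring)⟩
  have h2 := key _ (boxOf_lowerLeft x y) (2 * x, 2 * y - 1)
    ⟨Or.inr (by dsimp only; ring), Or.inl rfl⟩
  have h3 := key _ (boxOf_upperRight x y) (2 * (x + 1) - 1, 2 * y)
    ⟨Or.inr (by dsimp only; ring), Or.inl rfl⟩
  have h4 := key _ (boxOf_upperRight x y) (2 * x, 2 * (y + 1) - 1)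
    ⟨Or.inl rfl, Or.inr (by dsimp only; ring)⟩
  rw [vertexContent_left, tileContent_left (by dsimp only; omega) (by dsimp only; omega)] at h1
  rw [vertexContent_bot, tileContent_down (by dsimp only; omega) (by dsimp only; omega)] at h2
  rw [vertexContent_left, tileContent_right (by dsimp only; omega) (by dsimp only; omega)] at h3
  rw [vertexContent_bot, tileContent_up (by dsimp only; omega) (by dsimp only; omega)] at h4
  exact ⟨hG, map_inl_eq h1, map_inl_eq h3, map_inl_eq h2, map_inl_eq h4⟩

-- Neighboring tiles match since both agree with what their common side shows.
variable (T) in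
theorem isWangMap_readTile : IsWangMap E tc (readTile T) where
  isSome_iff := by
    rintro ⟨x, y⟩
    constructor
    · intro h
      obtain ⟨w, hw⟩ := Option.isSome_iff_exists.1 h
      exact (readTile_edges T hw).1
    · intro h
      obtain ⟨w, hw, -⟩ := isFull_readTile T (2 * x - 1, 2 * y - 1) (by rwa [boxOf_lowerLeft])
      rw [boxOf_lowerLeft] at hw
      simp [hw]
  right := by
    intro x y w w' hw hw'
    have h1 := (readTile_edges T hw).2.2.1
    have h2 := (readTile_edges T hw').2.1
    exact Option.some.inj (h1.symm.trans h2)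
  up := by
    intro x y w w' hw hw'
    have h1 := (readTile_edges T hw).2.2.2.2
    have h2 := (readTile_edges T hw').2.2.2.1
    exact Option.some.inj (h1.symm.trans h2)
  boundary := by
    rintro ⟨x, y⟩ w d b hw hb
    obtain ⟨hG, h1, h2, h3, h4⟩ := readTile_edges T hw
    have hs := ((E.isSome_iff (x, y) d).1 (by simp [hb])).2
    cases d
    · rw [edgeB_of_up_notMem hG hs, hb] at h4
      exact (Option.some.inj h4).symm
    · rw [edgeL_of_right_notMem hG hs, hb] at h2
      exact (Option.some.inj h2).symm
    · rw [edgeB_of_notMem hG hs, hb] at h3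
      exact (Option.some.inj h3).symm
    · rw [edgeL_of_notMem hG hs, hb] at h1
      exact (Option.some.inj h1).symm

theorem RectTiling.ext_tiles {R : Finset RectTile} {H : Finset Cell} {T T' : RectTiling R H}
    (h : T.tiles = T'.tiles) : T = T' := by
  cases T
  cases T'
  congr

/-- Two tilings of the same region are equal if all tiles of the one belong to the other. -/
theorem RectTiling.eq_of_subset {R : Finset RectTile} {H : Finset Cell} {T T' : RectTiling R H}
    (h : T.tiles ⊆ T'.tiles) : T = T' := by
  refine RectTiling.ext_tiles (h.antisymm fun t ht => ?_)
  obtain ⟨r, x, y⟩ := t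
  have hm : (x, y) ∈ r.cellsAt (x, y) := mem_cellsAt.2 ⟨⟨le_rfl, by simp⟩, le_rfl, by simp⟩
  obtain ⟨t', ht', hz⟩ := (T.covers (x, y)).1 ((T'.covers (x, y)).2 ⟨_, ht, hm⟩)
  rwa [T'.eq_of_mem ht (h ht') hm hz]

theorem rectTiling_readTile : (isWangMap_readTile T).rectTiling = T := by
  refine RectTiling.eq_of_subset ?_
  rintro t ⟨c, w, hw, rfl⟩
  obtain ⟨w', hw', -, ht⟩ := isFull_readTile T c ((isWangMap_readTile T).mem hw)
  obtain rfl : w' = w := Option.some.inj (hw'.symm.trans hw)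
  exact ht

/-- The rectangle at the reading point of a box is its lower left brick for both maps, and the
height of this brick contains the code of the tile. -/
theorem rectTiling_injective {θ' : Cell → Option ω} (h : IsWangMap E tc θ)
    (h' : IsWangMap E tc θ') (e : h.rectTiling = h'.rectTiling) : θ = θ' := by
  have key : ∀ {θ : Cell → Option ω} (h : IsWangMap E tc θ) {x y : ℤ} {w : ω},
      θ (x, y) = some w → ∃ pos, (rectOf tc w (2 * x - 1, 2 * y - 1), pos) ∈ h.rectTiling.tiles ∧
        (mesh κ ω * (2 * x - 1) + maxCode κ ω, mesh κ ω * (2 * y - 1) + maxCode κ ω) ∈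
        (rectOf tc w (2 * x - 1, 2 * y - 1)).cellsAt pos := by
    intro θ h x y w hw
    have hw' : θ (boxOf (2 * x - 1, 2 * y - 1)) = some w := by rwa [boxOf_lowerLeft]
    refine ⟨brickCorner E tc θ (2 * x - 1, 2 * y - 1), ⟨_, w, hw', rfl⟩, ?_⟩
    rw [cellsAt_rectOf fun u => h.vertexContent_eq hw']
    have := maxCode_lt_mesh κ ω
    exact mem_brick_of_bounds (offsetsIn_vertexOffset E tc θ) le_rfl
      (by rw [mul_add, mul_one]; omega) le_rfl (by rw [mul_add, mul_one]; omega)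
  funext ⟨x, y⟩
  by_cases hG : (x, y) ∈ G
  · obtain ⟨w, hw⟩ := Option.isSome_iff_exists.1 ((h.isSome_iff _).2 hG)
    obtain ⟨w', hw'⟩ := Option.isSome_iff_exists.1 ((h'.isSome_iff _).2 hG)
    obtain ⟨pos, h1, h2⟩ := key h hw
    obtain ⟨pos', h1', h2'⟩ := key h' hw'
    rw [e] at h1
    have := congrArg (fun t : RectTile × Cell => (t.1.height : ℤ))
      (RectTiling.eq_of_mem _ h1 h1' h2 h2')
    dsimp only at this
    rw [height_rectOf_even tc w (by omega), height_rectOf_even tc w' (by omega), boxOf_lowerLeft,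
      show 2 * x - 1 + 1 = 2 * x by ring, show 2 * y - 1 + 1 = 2 * y by ring, tileOffset_center,
      tileOffset_center, tileOffset_corner w (by omega) (by omega),
      tileOffset_corner w' (by omega) (by omega)] at this
    have hs := (state_eq (code_injective (κ := κ) (ω := ω)
      (s := (vclass (2 * x, 2 * y), some (.inr w))) (by linarith))).2.2
    simp only [Option.some.injEq, Sum.inr.injEq] at hs
    rw [hw, hw', hs]
  · have h1 := mt (h.isSome_iff _).1 hG
    have h2 := mt (h'.isSome_iff _).1 hG
    simp only [Option.not_isSome_iff_eq_none] at h1 h2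
    rw [h1, h2]

variable (E tc) in
/-- The tilings of the region of boxes correspond to the Wang tilings. -/
noncomputable def wangMapEquiv :
    {θ // IsWangMap E tc θ} ≃ RectTiling (rects tc) (boxRegion E tc) :=
  Equiv.ofBijective (fun θ => θ.2.rectTiling)
    ⟨fun _ _ e => Subtype.ext (rectTiling_injective _ _ e),
      fun T => ⟨⟨_, isWangMap_readTile T⟩, rectTiling_readTile⟩⟩

end

/-! ### From colored regions to regions of boxes -/

section
variable {C : Type} {B : Finset C} {W : Finset (WangTile C)}

open scoped Classical in
variable (B W) in
/-- The colors of the boundary and of the tiles. -/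
noncomputable def colors : Finset C :=
  B ∪ W.biUnion fun w => {w .up, w .right, w .down, w .left}

theorem mem_colors_of_mem {b : C} (h : b ∈ B) : b ∈ colors B W := by
  classical
  exact Finset.mem_union_left _ h

theorem mem_colors_tile {w : WangTile C} (h : w ∈ W) (d : Dir) : w d ∈ colors B W := by
  classical
  refine Finset.mem_union_right _ (Finset.mem_biUnion.2 ⟨w, h, ?_⟩)
  cases d <;> simp

variable (W) in
/-- A boundary color as an element of the set of all colors. -/
noncomputable def boundaryColor (b : B) : colors B W := ⟨b, mem_colors_of_mem b.2⟩

variable (B W) in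
/-- The colors of the tiles. -/
noncomputable def tileColor (w : W) (d : Dir) : colors B W := ⟨w.1 d, mem_colors_tile w.2 d⟩

variable (W) in
/-- The coloring of the boundary of a region. -/
noncomputable def ColoredRegion.edgeColoring (G : ColoredRegion B) :
    EdgeColoring (colors B W) G.cells where
  col p d := (G.col p d).map (boundaryColor W)
  isSome_iff p d := by simpa using G.isSome_col_iff p d

variable (W) in
/-- The region of boxes for a colored region. -/
noncomputable def ColoredRegion.toRegion (G : ColoredRegion B) : Region :=
  ⟨boxRegion (G.edgeColoring W) (tileColor B W),
    isSimplyConnectedRegion_brickRegion (maxCode_lt_mesh _ _) (maxCode_pos _ _).le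
      (offsetsIn_vertexOffset _ _ _) G.isSimplyConnected⟩

open scoped Classical in
/-- A Wang tiling as a partial function on the lattice. -/
noncomputable def WangTiling.toMap {G : ColoredRegion B} (t : WangTiling W G) (p : Cell) :
    Option W :=
  if h : p ∈ G.cells then some ⟨t.tile ⟨p, h⟩, t.tile_mem _⟩ else none

theorem WangTiling.toMap_of_mem {G : ColoredRegion B} (t : WangTiling W G) {p : Cell}
    (h : p ∈ G.cells) : t.toMap p = some ⟨t.tile ⟨p, h⟩, t.tile_mem _⟩ := dif_pos h

theorem WangTiling.toMap_of_notMem {G : ColoredRegion B} (t : WangTiling W G) {p : Cell}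
    (h : p ∉ G.cells) : t.toMap p = none := dif_neg h

theorem WangTiling.toMap_eq_some {G : ColoredRegion B} (t : WangTiling W G) {p : Cell} {w : W}
    (h : t.toMap p = some w) : ∃ hp : p ∈ G.cells, w.1 = t.tile ⟨p, hp⟩ := by
  by_cases hp : p ∈ G.cells
  · rw [t.toMap_of_mem hp] at h
    exact ⟨hp, by rw [← Option.some.inj h]⟩
  · rw [t.toMap_of_notMem hp] at h
    simp at h

theorem WangTiling.isWangMap {G : ColoredRegion B} (t : WangTiling W G) :
    IsWangMap (G.edgeColoring W) (tileColor B W) t.toMap where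
  isSome_iff p := by
    by_cases hp : p ∈ G.cells
    · simp [t.toMap_of_mem hp, hp]
    · simp [t.toMap_of_notMem hp, hp]
  right x y w w' hw hw' := by
    obtain ⟨h1, e1⟩ := t.toMap_eq_some hw
    obtain ⟨h2, e2⟩ := t.toMap_eq_some hw'
    refine Subtype.ext ?_
    simp only [tileColor, e1, e2]
    exact t.interior ⟨_, h1⟩ ⟨_, h2⟩ .right rfl
  up x y w w' hw hw' := by
    obtain ⟨h1, e1⟩ := t.toMap_eq_some hw
    obtain ⟨h2, e2⟩ := t.toMap_eq_some hw'
    refine Subtype.ext ?_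
    simp only [tileColor, e1, e2]
    exact t.interior ⟨_, h1⟩ ⟨_, h2⟩ .up rfl
  boundary p w d b hw hb := by
    obtain ⟨h1, e1⟩ := t.toMap_eq_some hw
    simp only [ColoredRegion.edgeColoring, Option.map_eq_some_iff] at hb
    obtain ⟨b', hb', rfl⟩ := hb
    refine Subtype.ext ?_
    simp only [tileColor, e1, boundaryColor]
    exact t.boundary ⟨_, h1⟩ d b' hb'

/-- The Wang tiling given by a partial function on the lattice. -/
noncomputable def IsWangMap.wangTiling {G : ColoredRegion B} {θ : Cell → Option W}
    (h : IsWangMap (G.edgeColoring W) (tileColor B W) θ) : WangTiling W G where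
  tile p := ((θ p).get ((h.isSome_iff p).2 p.2)).1
  tile_mem p := ((θ p).get ((h.isSome_iff p).2 p.2)).2
  interior := by
    rintro ⟨⟨x, y⟩, hp⟩ ⟨q, hq⟩ d e
    obtain ⟨w, hw⟩ := Option.isSome_iff_exists.1 ((h.isSome_iff _).2 hp)
    obtain ⟨w', hw'⟩ := Option.isSome_iff_exists.1 ((h.isSome_iff _).2 hq)
    dsimp only at e
    subst e
    simp only [hw, hw', Option.get_some]
    cases d
    · exact congrArg Subtype.val (h.up x y w w' hw hw')
    · exact congrArg Subtype.val (h.right x y w w' hw hw')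
    · exact congrArg Subtype.val (h.up x (y - 1) w' w hw' (by simpa using hw)).symm
    · exact congrArg Subtype.val (h.right (x - 1) y w' w hw' (by simpa using hw)).symm
  boundary := by
    rintro ⟨p, hp⟩ d b hb
    obtain ⟨w, hw⟩ := Option.isSome_iff_exists.1 ((h.isSome_iff _).2 hp)
    simp only [hw, Option.get_some]
    exact congrArg Subtype.val (h.boundary p w d (boundaryColor W b) hw
      (by simp only [ColoredRegion.edgeColoring, hb, Option.map_some]))

variable (W) in
/-- Wang tilings as partial functions on the lattice. -/
noncomputable def wangTilingEquiv (G : ColoredRegion B) :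
    WangTiling W G ≃ {θ // IsWangMap (G.edgeColoring W) (tileColor B W) θ} where
  toFun t := ⟨t.toMap, t.isWangMap⟩
  invFun θ := θ.2.wangTiling
  left_inv t := by
    have : (t.isWangMap).wangTiling.tile = t.tile := by
      funext ⟨p, hp⟩
      simp only [IsWangMap.wangTiling, t.toMap_of_mem hp, Option.get_some]
    cases t
    simp only [IsWangMap.wangTiling, WangTiling.mk.injEq]
    exact this
  right_inv θ := by
    refine Subtype.ext (funext fun p => ?_)
    by_cases hp : p ∈ G.cells
    · simp [WangTiling.toMap_of_mem _ hp, IsWangMap.wangTiling]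
    · have := mt (θ.2.isSome_iff p).1 hp
      simp only [Option.not_isSome_iff_eq_none] at this
      dsimp only
      rw [WangTiling.toMap_of_notMem _ hp, this]

end

/-! ### Binary numbers -/

open Computability in
-- The recursion for binary digits, least significant first. Zero has no digits, so leading zeros
-- never occur.
theorem encodeNat_bit (b : Bool) (m : ℕ) :
    encodeNat (2 * m + b.toNat) = if m = 0 ∧ b = false then [] else b :: encodeNat m := by
  have h : ((2 * m + b.toNat : ℕ) : Num) = cond b (Num.bit1 (m : Num)) (Num.bit0 (m : Num)) := by
    have := Num.ofNat'_bit b m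
    rw [Num.ofNat'_eq, Num.ofNat'_eq, Nat.bit_val] at this
    rw [this]
    cases b <;> rfl
  unfold encodeNat
  rw [h]
  have h0 : (m : Num) = 0 ↔ m = 0 := by
    constructor
    · intro e
      have := congrArg (fun n : Num => (n : ℕ)) e
      simpa using this
    · rintro rfl
      rfl
  rcases hm : (m : Num) with _ | p
  · have : m = 0 := h0.1 hm
    cases b <;> simp [this] <;> rfl
  · have : m ≠ 0 := fun e => by
      rw [h0.2 e] at hm
      cases hm
    simp only [this, false_and, if_false]
    cases b <;> rfl

theorem encodeNat_zero : Computability.encodeNat 0 = [] := rfl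

/-- The value of a list of binary digits, least significant first. -/
def ofBits : List Bool → ℕ
  | [] => 0
  | b :: l => 2 * ofBits l + b.toNat

theorem ofBits_encodeNat (n : ℕ) : ofBits (Computability.encodeNat n) = n := by
  induction n using Nat.strong_induction_on with
  | _ n ih =>
    obtain ⟨m, b, rfl⟩ : ∃ (m : ℕ) (b : Bool), n = 2 * m + b.toNat := by
      refine ⟨n / 2, decide (n % 2 = 1), ?_⟩
      by_cases h : n % 2 = 1 <;> simp [h] <;> omega
    rw [encodeNat_bit]
    split_ifs with h
    · obtain ⟨rfl, rfl⟩ := h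
      rfl
    · rw [ofBits, ih m]
      by_contra hlt
      apply h
      cases b <;> simp at hlt ⊢ <;> omega

/-- Digits `(b, b')` where the digits `b` are given, and `b'` are those of the number minus the
borrow `c`. -/
def withBorrow : Bool → List Bool → List (Bool × Bool)
  | _, [] => []
  | c, b :: l => (b, xor b c) :: withBorrow (c && !b) l

theorem map_fst_withBorrow (c : Bool) (l : List Bool) : (withBorrow c l).map Prod.fst = l := by
  induction l generalizing c with
  | nil => rfl
  | cons b l ih => simp [withBorrow, ih]

/-- The borrow passes over zeros until the first digit one. The result can have a leading zero, so
it is described by its value and not by its list of digits. -/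
theorem ofBits_map_snd_withBorrow (c : Bool) (l : List Bool) (h : c.toNat ≤ ofBits l) :
    ofBits ((withBorrow c l).map Prod.snd) = ofBits l - c.toNat := by
  induction l generalizing c with
  | nil => simp [withBorrow, ofBits]
  | cons b l ih =>
    simp only [withBorrow, List.map_cons, ofBits] at h ⊢
    rw [ih _ (by cases b <;> cases c <;> simp at h ⊢; omega)]
    cases b <;> cases c <;> simp at h ⊢
    omega

theorem length_withBorrow (c : Bool) (l : List Bool) : (withBorrow c l).length = l.length := by
  induction l generalizing c with
  | nil => rfl
  | cons b l ih => simp [withBorrow, ih]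

/-! ### The squares of a box -/

theorem brick_congr {S : ℤ} {v v' : Cell → ℤ} {c : Cell} (h : ∀ u, Incident u c → v u = v' u) :
    brick S v c = brick S v' c := by
  obtain ⟨a, b⟩ := c
  have h1 := h (a, b) ⟨Or.inl rfl, Or.inl rfl⟩
  have h2 := h (a + 1, b) ⟨Or.inr rfl, Or.inl rfl⟩
  have h3 := h (a, b + 1) ⟨Or.inl rfl, Or.inr rfl⟩
  have h4 := h (a + 1, b + 1) ⟨Or.inr rfl, Or.inr rfl⟩
  ext ⟨x, y⟩
  rcases Int.emod_two_eq (a + b) with par | par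
  · rw [mem_brick_even par rfl rfl, mem_brick_even par rfl rfl, h1, h2, h3, h4]
  · rw [mem_brick_odd par rfl rfl, mem_brick_odd par rfl rfl, h1, h2, h3, h4]

section
variable {κ ω : Type} {G : Finset Cell} {E : EdgeColoring κ G} {tc : ω → Dir → κ}

/-- What a box with the boundary colors `lab` shows at the vertex with coordinates `d` relative to
the center of the box. -/
def labelContent (ω : Type) (lab : Dir → Option κ) (d : Cell) : Option (κ ⊕ ω) :=
  (if d.1 = 0 then
    if d.2 = 0 then none else if d.2 = 1 then lab .up else lab .down
  else if d.2 = 0 then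
    if d.1 = 1 then lab .right else lab .left
  else none).map .inl

/-- Without tiles, sides inside the region show nothing. Hence the shape of a box depends only on
the boundary colors of its own square, which are written next to this square in the input; no
neighbors need to be looked up. -/
theorem vertexContent_eq_labelContent {x y i j : ℤ} (hp : (x, y) ∈ G)
    (hi : 2 * x - 1 ≤ i ∧ i ≤ 2 * x + 1) (hj : 2 * y - 1 ≤ j ∧ j ≤ 2 * y + 1) :
    vertexContent E tc (fun _ => none) (i, j) =
      labelContent ω (E.col (x, y)) (i - 2 * x, j - 2 * y) := by
  have hl : edgeL E tc (fun _ => none) (x, y) = E.col (x, y) .left := by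
    by_cases h : (x - 1, y) ∈ G
    · rw [edgeL_of_mem hp h, E.eq_none (p := (x, y)) (d := .left) fun _ => h, Option.map_none]
    · exact edgeL_of_notMem hp h
  have hr : edgeL E tc (fun _ => none) (x + 1, y) = E.col (x, y) .right := by
    by_cases h : (x + 1, y) ∈ G
    · rw [edgeL_of_mem h (by simpa using hp), E.eq_none (p := (x, y)) (d := .right) fun _ => h, Option.map_none]
    · exact edgeL_of_right_notMem hp h
  have hd : edgeB E tc (fun _ => none) (x, y) = E.col (x, y) .down := by
    by_cases h : (x, y - 1) ∈ G
    · rw [edgeB_of_mem hp h, E.eq_none (p := (x, y)) (d := .down) fun _ => h, Option.map_none]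
    · exact edgeB_of_notMem hp h
  have hu : edgeB E tc (fun _ => none) (x, y + 1) = E.col (x, y) .up := by
    by_cases h : (x, y + 1) ∈ G
    · rw [edgeB_of_mem h (by simpa using hp), E.eq_none (p := (x, y)) (d := .up) fun _ => h, Option.map_none]
    · exact edgeB_of_up_notMem hp h
  have hi' : i = 2 * x - 1 ∨ i = 2 * x ∨ i = 2 * (x + 1) - 1 := by omega
  have hj' : j = 2 * y - 1 ∨ j = 2 * y ∨ j = 2 * (y + 1) - 1 := by omega
  have e1 : 2 * x - 1 - 2 * x = -1 := by ring
  have e2 : 2 * (x + 1) - 1 - 2 * x = 1 := by ring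
  have e3 : 2 * y - 1 - 2 * y = -1 := by ring
  have e4 : 2 * (y + 1) - 1 - 2 * y = 1 := by ring
  rcases hi' with rfl | rfl | rfl <;> rcases hj' with rfl | rfl | rfl
  case inr.inl.inl => rw [vertexContent_bot, hd]; simp [labelContent, e3]
  case inr.inl.inr.inl => rw [vertexContent_center]; simp [labelContent]
  case inr.inl.inr.inr => rw [vertexContent_bot, hu]; simp [labelContent, e4]
  case inl.inr.inl => rw [vertexContent_left, hl]; simp [labelContent, e1]
  case inr.inr.inr.inl => rw [vertexContent_left, hr]; simp [labelContent, e2]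
  all_goals
    rw [vertexContent_corner _ _ _ (by dsimp only; omega) (by dsimp only; omega)]
    simp [labelContent, e1, e2, e3, e4]

variable [Fintype κ] [Fintype ω]

/-- The offsets at the vertices of a box with the boundary colors `lab`. -/
noncomputable def labelOffset (ω : Type) [Fintype ω] (lab : Dir → Option κ) (p u : Cell) : ℤ :=
  code (vclass u, labelContent ω lab (u.1 - 2 * p.1, u.2 - 2 * p.2))

/-- The unit squares of a box with the boundary colors `lab`. -/
noncomputable def boxCells (ω : Type) [Fintype ω] (lab : Dir → Option κ) (p : Cell) : Finset Cell :=
  (boxBricks p).biUnion (brick (mesh κ ω) (labelOffset ω lab p))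

theorem mem_boxCells {lab : Dir → Option κ} {p z : Cell} : z ∈ boxCells ω lab p ↔
    ∃ c, boxOf c = p ∧ z ∈ brick (mesh κ ω) (labelOffset ω lab p) c := by
  simp [boxCells, mem_boxBricks]

theorem mem_boxRegion_iff {z : Cell} :
    z ∈ boxRegion E tc ↔ ∃ p ∈ G, z ∈ boxCells ω (E.col p) p := by
  have key : ∀ c, boxOf c ∈ G → brick (mesh κ ω) (vertexOffset E tc fun _ => none) c =
      brick (mesh κ ω) (labelOffset ω (E.col (boxOf c)) (boxOf c)) c := by
    intro c hc
    refine brick_congr fun u hu => ?_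
    have hb := incident_bounds hu
    rw [vertexOffset, labelOffset]
    congr 2
    exact vertexContent_eq_labelContent hc hb.1 hb.2
  rw [boxRegion, mem_brickRegion]
  constructor
  · rintro ⟨c, hc, hz⟩
    exact ⟨boxOf c, hc, mem_boxCells.2 ⟨c, rfl, by rwa [← key c hc]⟩⟩
  · rintro ⟨p, hp, hz⟩
    obtain ⟨c, rfl, hz⟩ := mem_boxCells.1 hz
    exact ⟨c, hp, by rwa [key c hp]⟩

theorem mem_brick_add {S : ℤ} {v v' : Cell → ℤ} {k l : ℤ}
    (h : ∀ i j, v' (i + 4 * k, j + 4 * l) = v (i, j)) (a b x y : ℤ) :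
    (x, y) ∈ brick S v' (a + 4 * k, b + 4 * l) ↔
      (x - S * (4 * k), y - S * (4 * l)) ∈ brick S v (a, b) := by
  rw [mem_brick, mem_brick]
  dsimp only
  rw [show a + 4 * k + 1 = a + 1 + 4 * k by ring, show b + 4 * l + 1 = b + 1 + 4 * l by ring,
    edgeX_add a b k l h, edgeX_add (a + 1) b k l h, edgeY_add a b k l h, edgeY_add a (b + 1) k l h]
  omega

theorem mem_boxCells_add (lab : Dir → Option κ) (i j k l x y : ℤ) :
    (x, y) ∈ boxCells ω lab (i + 2 * k, j + 2 * l) ↔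
      (x - mesh κ ω * (4 * k), y - mesh κ ω * (4 * l)) ∈ boxCells ω lab (i, j) := by
  have h : ∀ i' j', labelOffset ω lab (i + 2 * k, j + 2 * l) (i' + 4 * k, j' + 4 * l) =
      labelOffset ω lab (i, j) (i', j') := by
    intro i' j'
    unfold labelOffset
    congr 2
    · rw [vclass_eq_iff]
      dsimp only
      omega
    · congr 2 <;> ring
  rw [mem_boxCells, mem_boxCells]
  constructor
  · rintro ⟨⟨a, b⟩, hc, hz⟩
    refine ⟨(a - 4 * k, b - 4 * l), ?_, ?_⟩
    · rw [boxOf_eq_iff] at hc ⊢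
      dsimp only at hc ⊢
      omega
    · rw [← mem_brick_add h, sub_add_cancel, sub_add_cancel]
      exact hz
  · rintro ⟨⟨a, b⟩, hc, hz⟩
    refine ⟨(a + 4 * k, b + 4 * l), ?_, ?_⟩
    · rw [boxOf_eq_iff] at hc ⊢
      dsimp only at hc ⊢
      omega
    · rwa [mem_brick_add h]

/-- The distance of the centers of neighboring boxes is a power of two. -/
def pitchExp (κ ω : Type) [Fintype κ] [Fintype ω] : ℕ := 5 + 2 * Fintype.card (VState κ ω)

/-- A power of two makes multiplication by the pitch a mere shift of binary digits. -/
theorem two_mul_mesh (κ ω : Type) [Fintype κ] [Fintype ω] :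
    2 * mesh κ ω = ((2 ^ pitchExp κ ω : ℕ) : ℤ) := by
  unfold mesh maxCode pitchExp
  push_cast
  rw [pow_add, pow_mul]
  ring

theorem bounds_of_mem_boxCells {lab : Dir → Option κ} {i j x y : ℤ}
    (h : (x, y) ∈ boxCells ω lab (i, j)) :
    (-(2 * mesh κ ω) < x - 2 * mesh κ ω * i ∧ x - 2 * mesh κ ω * i < 2 * mesh κ ω) ∧
      -(2 * mesh κ ω) < y - 2 * mesh κ ω * j ∧ y - 2 * mesh κ ω * j < 2 * mesh κ ω := by
  obtain ⟨⟨a, b⟩, hc, hz⟩ := mem_boxCells.1 h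
  rw [boxOf_eq_iff] at hc
  rw [mem_brick] at hz
  dsimp only at hc hz
  have hv : OffsetsIn (maxCode κ ω) (labelOffset ω lab (i, j)) := fun _ => code_bounds _
  have h1 := edgeX_bounds (S := mesh κ ω) hv a b
  have h2 := edgeX_bounds (S := mesh κ ω) hv (a + 1) b
  have h3 := edgeY_bounds (S := mesh κ ω) hv a b
  have h4 := edgeY_bounds (S := mesh κ ω) hv a (b + 1)
  have g0 := maxCode_pos κ ω
  have gS := maxCode_lt_mesh κ ω
  have e1 : 2 * mesh κ ω * i = mesh κ ω * (2 * i) := by ring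
  have e2 : 2 * mesh κ ω * j = mesh κ ω * (2 * j) := by ring
  have e3 : mesh κ ω * (2 * i - 1) = mesh κ ω * (2 * i) - mesh κ ω := by ring
  have e4 : mesh κ ω * (2 * j - 1) = mesh κ ω * (2 * j) - mesh κ ω := by ring
  rw [mul_add, mul_one] at h2 h4
  have ha : a = 2 * i - 1 ∨ a = 2 * i := by omega
  have hb : b = 2 * j - 1 ∨ b = 2 * j := by omega
  rcases ha with rfl | rfl <;> rcases hb with rfl | rfl <;> omega

/-- The unit square with coordinates `u` relative to the center belongs to a box with the given
boundary colors and parities of the coordinates. -/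
def InTemplate (ω : Type) [Fintype ω] (lab : Dir → Option κ) (i j : ℤ) (u : Cell) : Prop :=
  (2 * mesh κ ω * i + u.1, 2 * mesh κ ω * j + u.2) ∈ boxCells ω lab (i, j)

/-- Boxes with equal labels and equal parities of coordinates are translates of each other, so
finitely many templates describe all of them. -/
theorem mem_boxCells_iff {lab : Dir → Option κ} {x y : ℤ} {z : Cell} : z ∈ boxCells ω lab (x, y) ↔
    InTemplate ω lab (x % 2) (y % 2) (z.1 - 2 * mesh κ ω * x, z.2 - 2 * mesh κ ω * y) := by
  have := mem_boxCells_add (ω := ω) lab (x % 2) (y % 2) (x / 2) (y / 2) z.1 z.2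
  rw [Int.emod_add_mul_ediv, Int.emod_add_mul_ediv] at this
  rw [this, InTemplate]
  have e : ∀ a : ℤ, 2 * mesh κ ω * (a % 2) = 2 * mesh κ ω * a - mesh κ ω * (4 * (a / 2)) := by
    intro a
    have : a % 2 = a - 2 * (a / 2) := by omega
    rw [this]
    ring
  rw [e x, e y]
  dsimp only
  rw [show ∀ a b c : ℤ, a - b + (c - a) = c - b by intros; ring,
    show ∀ a b c : ℤ, a - b + (c - a) = c - b by intros; ring]

end

/-! ### A machine that writes the squares of boxes -/

open Turing

/-- The stacks of the machine: input, output, the digits of the first and the second coordinate of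
the current square, and a stack for digits in transit. -/
inductive Stack : Type
  | inp | out | num (x : Bool) | back
  deriving DecidableEq

/-- The symbols on the stacks. -/
abbrev StackSym (L : Type) : Stack → Type
  | .inp => Sym L
  | .out => Sym Empty
  | .num _ => Bool × Bool
  | .back => Bool × Bool

/-- The labels of the program. -/
inductive Label : Type
  | read (x : Bool) | labels | next | copy (x : Bool) | restore (x : Bool) | clear (x : Bool)

/-- The internal memory: for both coordinates the sign, whether the digits read are none, and the
last digit; the borrow; the labels of the square; the number of offsets that are left; whether a
digit has been written; the symbol and the pair of digits just read. -/
structure Memory (L : Type) (M : ℕ) : Type where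
  neg : Bool → Bool
  zero : Bool → Bool
  odd : Bool → Bool
  borrow : Bool
  lab : Dir → L
  idx : Fin (M + 1)
  started : Bool
  sym : Option (Sym L)
  dig : Option (Bool × Bool)

section
variable {L : Type}

/-- The contents of the stacks. -/
def contents (i : List (Sym L)) (o : List (Sym Empty)) (f : Bool → List (Bool × Bool))
    (b : List (Bool × Bool)) : ∀ k, List (StackSym L k)
  | .inp => i
  | .out => o
  | .num x => f x
  | .back => b

theorem update_contents_inp (i i' : List (Sym L)) (o : List (Sym Empty)) (f : Bool → List (Bool × Bool))
    (b : List (Bool × Bool)) :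
    Function.update (contents i o f b) .inp i' = contents i' o f b := by
  funext k
  cases k <;> rfl

theorem update_contents_out (i : List (Sym L)) (o o' : List (Sym Empty)) (f : Bool → List (Bool × Bool))
    (b : List (Bool × Bool)) :
    Function.update (contents i o f b) .out o' = contents i o' f b := by
  funext k
  cases k <;> rfl

theorem update_contents_back (i : List (Sym L)) (o : List (Sym Empty)) (f : Bool → List (Bool × Bool))
    (b b' : List (Bool × Bool)) :
    Function.update (contents i o f b) .back b' = contents i o f b' := by
  funext k
  cases k <;> rfl

theorem update_contents_num (i : List (Sym L)) (o : List (Sym Empty)) (f : Bool → List (Bool × Bool))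
    (b l : List (Bool × Bool)) (x : Bool) :
    Function.update (contents i o f b) (.num x) l = contents i o (Function.update f x l) b := by
  funext k
  rcases k with _ | _ | y | _
  · rfl
  · rfl
  · by_cases h : y = x
    · subst h
      simp [contents]
    · simp [contents, h]
  · rfl

end

section
variable {L : Type} [Inhabited L] {M : ℕ}

/-- The initial memory. -/
def Memory.init (L : Type) [Inhabited L] (M : ℕ) : Memory L M where
  neg _ := false
  zero _ := true
  odd _ := false
  borrow := true
  lab _ := default
  idx := 0
  started := false
  sym := none
  dig := none

/-- The digit in the register for symbols. -/
def Memory.bit (s : Memory L M) : Bool :=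
  match s.sym with
  | some (.bit b) => b
  | _ => false

def Memory.isBit (s : Memory L M) : Bool :=
  match s.sym with
  | some (.bit _) => true
  | _ => false

def Memory.isMinus (s : Memory L M) : Bool :=
  match s.sym with
  | some .minus => true
  | _ => false

def Memory.isComma (s : Memory L M) : Bool :=
  match s.sym with
  | some .comma => true
  | _ => false

/-- The effect of a digit of the coordinate `x` on the memory. -/
def Memory.readBit (x : Bool) (s : Memory L M) : Memory L M :=
  { s with
    odd := if s.zero x then Function.update s.odd x s.bit else s.odd
    zero := Function.update s.zero x false
    borrow := s.borrow && !s.bit }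

open scoped Classical in
/-- Store the label of one side. -/
noncomputable def Memory.setLabel (d : Dir) (s : Memory L M) (o : Option (Sym L)) : Memory L M :=
  { s with
    lab := Function.update s.lab d
      (match o with
      | some (.label a) => a
      | _ => default) }

/-- The data of the machine: the exponent of the pitch, the possible offsets of squares, and which
of them occur, depending on the labels and the parities of the coordinates. -/
structure BoxData (L : Type) (M : ℕ) : Type where
  exp : ℕ
  offset : ℕ → Bool → ℤ
  active : (Dir → L) → Bool → Bool → ℕ → Bool

variable (D : BoxData L M)

/-- The current offset of the coordinate `x`. -/
def BoxData.off (s : Memory L M) (x : Bool) : ℤ := D.offset s.idx x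

/-- The sign of the coordinate to be written. -/
def BoxData.sign (s : Memory L M) (x : Bool) : Bool :=
  s.neg x || (s.zero x && decide (D.off s x < 0))

/-- The current offset, relative to the sign. -/
def BoxData.relOff (s : Memory L M) (x : Bool) : ℤ :=
  if D.sign s x then -D.off s x else D.off s x

/-- The digit of the number to be written. -/
def BoxData.digit (s : Memory L M) (x : Bool) (d : Bool × Bool) : Bool :=
  if D.relOff s x < 0 then d.2 else d.1

/-- The lower digits of the number to be written. -/
def BoxData.low (s : Memory L M) (x : Bool) : ℕ :=
  (if D.relOff s x < 0 then 2 ^ D.exp + D.relOff s x else D.relOff s x).toNat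

open TM2.Stmt

/-- The statements of the machine. -/
abbrev Program (L : Type) (M : ℕ) : Type := TM2.Stmt (StackSym L) Label (Memory L M)

/-- Write the digits below position `j` of the lower part. -/
def BoxData.writeLow (x : Bool) (q : Program L M) : ℕ → Program L M
  | 0 => q
  | j + 1 =>
    branch (fun s => s.started || (D.low s x).testBit j)
      (push .out (fun s => (Sym.bit ((D.low s x).testBit j) : Sym Empty))
        (load (fun s => { s with started := true }) (writeLow x q j)))
      (writeLow x q j)

/-- The program. -/
noncomputable def BoxData.program : Label → Program L M
  | .read x =>
    pop .inp (fun s o => { s with sym := o }) <|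
    branch Memory.isBit
      -- The second component is the digit of the absolute value minus one, computed with the borrow
      -- in the same pass.
      (push (.num x) (fun s => (s.bit, xor s.bit s.borrow)) <|
        load (Memory.readBit x) <| goto fun _ => .read x) <|
    branch Memory.isMinus
      (load (fun s => { s with neg := Function.update s.neg x true }) <| goto fun _ => .read x) <|
    branch Memory.isComma
      (load (fun s => { s with borrow := true, sym := none }) <|
        goto fun _ => if x then .read false else .labels)
      halt
  | .labels =>
    pop .inp (Memory.setLabel .up) <| pop .inp (Memory.setLabel .right) <|
    pop .inp (Memory.setLabel .down) <| pop .inp (Memory.setLabel .left) <|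
    load (fun s => { s with idx := Fin.last M }) <| goto fun _ => .next
  | .next =>
    branch (fun s => decide (s.idx = 0)) (goto fun _ => .clear true) <|
    load (fun s => { s with idx := ⟨s.idx - 1, by omega⟩ }) <|
    branch (fun s => D.active s.lab (s.odd true) (s.odd false) s.idx)
      -- The output is a stack and is therefore written backwards: the comma first, then the second
      -- coordinate before the first, and each from its most significant digit to its sign.
      (push .out (fun _ => (Sym.comma : Sym Empty)) <| goto fun _ => .copy false)
      (goto fun _ => .next)
  | .copy x =>
    pop (.num x) (fun s o => { s with dig := o }) <|
    branch (fun s => s.dig.isSome)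
      (push .back (fun s => s.dig.getD (false, false)) <|
        -- Leading zeros are suppressed, both here and in the lower part.
        branch (fun s => s.started || D.digit s x (s.dig.getD (false, false)))
          (push .out (fun s => (Sym.bit (D.digit s x (s.dig.getD (false, false))) : Sym Empty)) <|
            load (fun s => { s with started := true }) <| goto fun _ => .copy x)
          (goto fun _ => .copy x)) <|
    D.writeLow x
      (load (fun s => { s with started := false }) <|
        branch (fun s => D.sign s x)
          (push .out (fun _ => (Sym.minus : Sym Empty)) <| goto fun _ => .restore x)
          (goto fun _ => .restore x)) D.exp
  | .restore x =>
    pop .back (fun s o => { s with dig := o }) <|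
    branch (fun s => s.dig.isSome)
      (push (.num x) (fun s => s.dig.getD (false, false)) <| goto fun _ => .restore x) <|
    branch (fun _ => x) (goto fun _ => .next) <|
    push .out (fun _ => (Sym.comma : Sym Empty)) <| goto fun _ => .copy true
  | .clear x =>
    pop (.num x) (fun s o => { s with dig := o }) <|
    branch (fun s => s.dig.isSome) (goto fun _ => .clear x) <|
    branch (fun _ => x) (goto fun _ => .clear false) <|
    -- Each square starts from the initial memory, which is also the memory required of a halting
    -- configuration.
    load (fun _ => Memory.init L M) <| goto fun _ => .read true

/-! ### Runs of the machine -/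

/-- A configuration of the machine. -/
abbrev Config (L : Type) (M : ℕ) : Type := TM2.Cfg (StackSym L) Label (Memory L M)

/-- The machine gets from `c` to `c'` in at most `n` steps. -/
def Reaches (c c' : Config L M) (n : ℕ) : Prop :=
  ∃ k ≤ n, (flip bind (TM2.step D.program))^[k] (some c) = some c'

variable {D}

theorem Reaches.refl (c : Config L M) (n : ℕ) : Reaches D c c n := ⟨0, Nat.zero_le _, rfl⟩

theorem Reaches.of_step {c c' : Config L M} (h : TM2.step D.program c = some c') :
    Reaches D c c' 1 := ⟨1, le_rfl, h⟩

theorem Reaches.trans {c c' c'' : Config L M} {n m : ℕ} (h : Reaches D c c' n)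
    (h' : Reaches D c' c'' m) : Reaches D c c'' (n + m) := by
  obtain ⟨k, hk, e⟩ := h
  obtain ⟨l, hl, e'⟩ := h'
  refine ⟨l + k, by omega, ?_⟩
  rw [Function.iterate_add_apply, e, e']

theorem Reaches.mono {c c' : Config L M} {n m : ℕ} (h : Reaches D c c' n) (hnm : n ≤ m) :
    Reaches D c c' m := by
  obtain ⟨k, hk, e⟩ := h
  exact ⟨k, hk.trans hnm, e⟩

theorem Reaches.congr {c c' d d' : Config L M} {n : ℕ} (h : Reaches D c c' n) (hc : c = d)
    (hc' : c' = d') : Reaches D d d' n := hc ▸ hc' ▸ h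

theorem reaches_read_bit (x b : Bool) (s : Memory L M) (i : List (Sym L)) (o : List (Sym Empty))
    (f : Bool → List (Bool × Bool)) (k : List (Bool × Bool)) :
    Reaches D ⟨some (.read x), s, contents (.bit b :: i) o f k⟩
      ⟨some (.read x), Memory.readBit x { s with sym := some (.bit b) },
        contents i o (Function.update f x ((b, xor b s.borrow) :: f x)) k⟩ 1 := by
  refine Reaches.of_step ?_
  simp only [TM2.step, BoxData.program, TM2.stepAux, update_contents_inp, update_contents_num,
    contents, List.head?_cons, List.tail_cons, Memory.isBit, cond_true, Memory.bit]

theorem reaches_read_minus (x : Bool) (s : Memory L M) (i : List (Sym L)) (o : List (Sym Empty))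
    (f : Bool → List (Bool × Bool)) (k : List (Bool × Bool)) :
    Reaches D ⟨some (.read x), s, contents (.minus :: i) o f k⟩
      ⟨some (.read x), { s with sym := some .minus, neg := Function.update s.neg x true },
        contents i o f k⟩ 1 := by
  refine Reaches.of_step ?_
  simp only [TM2.step, BoxData.program, TM2.stepAux, update_contents_inp,
    contents, List.head?_cons, List.tail_cons, Memory.isBit, Memory.isMinus, cond_true, cond_false]

theorem reaches_read_comma (x : Bool) (s : Memory L M) (i : List (Sym L)) (o : List (Sym Empty))
    (f : Bool → List (Bool × Bool)) (k : List (Bool × Bool)) :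
    Reaches D ⟨some (.read x), s, contents (.comma :: i) o f k⟩
      ⟨some (if x then .read false else .labels), { s with borrow := true, sym := none },
        contents i o f k⟩ 1 := by
  refine Reaches.of_step ?_
  simp only [TM2.step, BoxData.program, TM2.stepAux, update_contents_inp,
    contents, List.head?_cons, List.tail_cons, Memory.isBit, Memory.isMinus, Memory.isComma,
    cond_true, cond_false]

end

section
variable {L : Type} {M : ℕ} {D : BoxData L M}

/-- The memory after some digits have been read. -/
def Memory.readBits (x : Bool) : Memory L M → List Bool → Memory L M
  | s, [] => s
  | s, b :: l => Memory.readBits x (Memory.readBit x { s with sym := some (.bit b) }) l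

/-- After the first digit, reading affects only the borrow and the register for symbols, and the
comma resets both. -/
theorem readBits_of_not_zero (x : Bool) (l : List Bool) (s : Memory L M) (h : s.zero x = false) :
    { s.readBits x l with borrow := true, sym := none } = { s with borrow := true, sym := none } := by
  induction l generalizing s with
  | nil => rfl
  | cons b l ih =>
    rw [Memory.readBits, ih _ (by simp [Memory.readBit])]
    have : Function.update s.zero x false = s.zero := by rw [← h, Function.update_eq_self]
    simp [Memory.readBit, h, this]

theorem readBits_encodeNat (x : Bool) (n : ℕ) (s : Memory L M) (h : s.zero x = true)
    (h' : s.odd x = false) :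
    { s.readBits x (Computability.encodeNat n) with borrow := true, sym := none } =
      { s with
        zero := Function.update s.zero x (decide (n = 0))
        odd := Function.update s.odd x (decide (n % 2 = 1))
        borrow := true
        sym := none } := by
  obtain ⟨m, b, rfl⟩ : ∃ (m : ℕ) (b : Bool), n = 2 * m + b.toNat := by
    refine ⟨n / 2, decide (n % 2 = 1), ?_⟩
    by_cases h : n % 2 = 1 <;> simp [h] <;> omega
  rw [encodeNat_bit]
  split_ifs with hb
  · obtain ⟨rfl, rfl⟩ := hb
    have e1 : Function.update s.zero x true = s.zero := by rw [← h, Function.update_eq_self]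
    have e2 : Function.update s.odd x false = s.odd := by rw [← h', Function.update_eq_self]
    simp [Memory.readBits, e1, e2]
  · rw [Memory.readBits, readBits_of_not_zero _ _ _ (by simp [Memory.readBit])]
    have e1 : decide (2 * m + b.toNat = 0) = false := by
      cases b <;> simp at hb ⊢
      omega
    have e2 : decide ((2 * m + b.toNat) % 2 = 1) = b := by
      cases b <;> simp
    rw [e1, e2]
    simp [Memory.readBit, Memory.bit, h]

theorem div_two_pow (Z j : ℕ) : Z / 2 ^ j = 2 * (Z / 2 ^ (j + 1)) + (Z.testBit j).toNat := by
  rw [Nat.testBit_eq_decide_div_mod_eq, pow_succ, ← Nat.div_div_eq_div_mul]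
  by_cases h : Z / 2 ^ j % 2 = 1 <;> simp [h] <;> omega

/-- One step of Horner's scheme on the output stack; a digit has been written exactly if the number
so far is not zero. -/
theorem encodeNat_step {m m' : ℕ} {b : Bool} (h : m' = 2 * m + b.toNat) {o : List (Sym Empty)} :
    (if decide (m ≠ 0) || b then Sym.bit b :: ((Computability.encodeNat m).map Sym.bit ++ o) else
      (Computability.encodeNat m).map Sym.bit ++ o) =
        (Computability.encodeNat m').map Sym.bit ++ o ∧
      (decide (m ≠ 0) || b) = decide (m' ≠ 0) := by
  subst h
  rw [encodeNat_bit]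
  by_cases hm : m = 0
  · subst hm
    cases b <;> simp [encodeNat_zero]
  · cases b <;> simp [hm]

/-- The invariant: before position `j` is passed, the output shows the digits of `Z / 2 ^ j`, and
`started` records whether this number is nonzero. -/
theorem stepAux_writeLow (x : Bool) (q : Program L M) (i : List (Sym L)) (o : List (Sym Empty))
    (f : Bool → List (Bool × Bool)) (k : List (Bool × Bool)) (Z j : ℕ) (s : Memory L M)
    (h : ∀ j' < j, (D.low s x).testBit j' = Z.testBit j')
    (hs : s.started = decide (Z / 2 ^ j ≠ 0)) :
    TM2.stepAux (D.writeLow x q j) s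
        (contents i ((Computability.encodeNat (Z / 2 ^ j)).map .bit ++ o) f k) =
      TM2.stepAux q { s with started := decide (Z ≠ 0) }
        (contents i ((Computability.encodeNat Z).map .bit ++ o) f k) := by
  induction j generalizing s with
  | zero =>
    rw [pow_zero, Nat.div_one] at hs ⊢
    rw [BoxData.writeLow, ← hs]
  | succ j ih =>
    have e := encodeNat_step (div_two_pow Z j) (o := o)
    have ih' := ih { s with started := decide (Z / 2 ^ j ≠ 0) } (fun j' hj => h j' (by omega)) rfl
    simp only [BoxData.writeLow, TM2.stepAux, hs, h j (Nat.lt_succ_self j)]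
    rw [e.2]
    by_cases hb : Z / 2 ^ j ≠ 0
    · have hb' : (decide (Z / 2 ^ (j + 1) ≠ 0) || Z.testBit j) = true := by rw [e.2]; simpa using hb
      rw [hb', if_pos rfl] at e
      have hd : decide (Z / 2 ^ j ≠ 0) = true := decide_eq_true hb
      rw [hd] at ih' ⊢
      rw [cond_true, update_contents_out, ← ih', ← e.1]
      rfl
    · have hb' : (decide (Z / 2 ^ (j + 1) ≠ 0) || Z.testBit j) = false := by rw [e.2]; simpa using hb
      rw [hb', if_neg (by simp)] at e
      have hs' : s.started = false := by
        rw [hs]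
        simp only [Bool.or_eq_false_iff] at hb'
        exact hb'.1
      have hd : decide (Z / 2 ^ j ≠ 0) = false := decide_eq_false hb
      rw [hd, ← hs'] at ih'
      rw [hd, cond_false, e.1, ← ih']

theorem testBit_add_of_lt {h r n j : ℕ} (hj : j < r) :
    (2 ^ r * h + n).testBit j = n.testBit j := by
  rw [Nat.testBit_eq_decide_div_mod_eq, Nat.testBit_eq_decide_div_mod_eq, decide_eq_decide]
  obtain ⟨d, rfl⟩ : ∃ d, r = j + 1 + d := ⟨r - j - 1, by omega⟩
  rw [show 2 ^ (j + 1 + d) * h + n = n + 2 ^ j * (2 * (2 ^ d * h)) by ring,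
    Nat.add_mul_div_left _ _ (by positivity)]
  omega

variable [Inhabited L]

theorem reaches_read_bits (x : Bool) (i : List (Sym L)) (o : List (Sym Empty))
    (k : List (Bool × Bool)) (l : List Bool) (s : Memory L M) (f : Bool → List (Bool × Bool)) :
    Reaches D ⟨some (.read x), s, contents (l.map .bit ++ i) o f k⟩
      ⟨some (.read x), s.readBits x l,
        contents i o (Function.update f x ((withBorrow s.borrow l).reverse ++ f x)) k⟩ l.length := by
  induction l generalizing s f with
  | nil => simpa [withBorrow, Memory.readBits] using Reaches.refl _ _
  | cons b l ih =>
    have h1 := reaches_read_bit (D := D) x b s (l.map .bit ++ i) o f k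
    have h2 := ih (Memory.readBit x { s with sym := some (.bit b) })
      (Function.update f x ((b, xor b s.borrow) :: f x))
    have := h1.trans h2
    rw [Nat.add_comm] at this
    simpa [Memory.readBits, withBorrow, Memory.readBit, Memory.bit] using this

/-- Reading a coordinate. -/
theorem reaches_readInt (x : Bool) (z : ℤ) (s : Memory L M) (i : List (Sym L))
    (o : List (Sym Empty)) (f : Bool → List (Bool × Bool)) (k : List (Bool × Bool))
    (h1 : s.borrow = true) (h2 : s.zero x = true) (h3 : s.neg x = false) (h4 : s.odd x = false)
    (h5 : f x = []) :
    Reaches D ⟨some (.read x), s, contents (encodeInt L z ++ i) o f k⟩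
      ⟨some (if x then .read false else .labels),
        { s with
          neg := Function.update s.neg x (decide (z < 0))
          zero := Function.update s.zero x (decide (z = 0))
          odd := Function.update s.odd x (decide (z % 2 = 1))
          borrow := true
          sym := none },
        contents i o (Function.update f x
          (withBorrow true (Computability.encodeNat z.natAbs)).reverse) k⟩
      (encodeInt L z).length := by
  have e0 : decide (z.natAbs = 0) = decide (z = 0) := by simp
  have e1 : decide (z.natAbs % 2 = 1) = decide (z % 2 = 1) := by
    rw [decide_eq_decide]
    omega
  have key : ∀ s : Memory L M, s.borrow = true → s.zero x = true → s.odd x = false →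
      Reaches D ⟨some (.read x), s, contents
        ((Computability.encodeNat z.natAbs).map .bit ++ .comma :: i) o f k⟩
      ⟨some (if x then .read false else .labels),
        { s with
          zero := Function.update s.zero x (decide (z = 0))
          odd := Function.update s.odd x (decide (z % 2 = 1))
          borrow := true
          sym := none },
        contents i o (Function.update f x
          (withBorrow true (Computability.encodeNat z.natAbs)).reverse) k⟩
      ((Computability.encodeNat z.natAbs).length + 1) := by
    intro s h1 h2 h4
    have := (reaches_read_bits (D := D) x (.comma :: i) o k (Computability.encodeNat z.natAbs) s
      f).trans (reaches_read_comma x _ _ _ _ _)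
    rwa [readBits_encodeNat x _ s h2 h4, h1, h5, List.append_nil, e0, e1] at this
  unfold encodeInt
  by_cases hz : z < 0
  · have := (reaches_read_minus (D := D) x s
      ((Computability.encodeNat z.natAbs).map .bit ++ .comma :: i) o f k).trans
        (key { s with sym := some .minus, neg := Function.update s.neg x true } h1 h2 h4)
    simp only [hz, if_true, decide_true]
    refine Reaches.mono ?_ (le_of_eq ?_) (n := 1 + ((Computability.encodeNat z.natAbs).length + 1))
    · simpa using this
    · simp
      omega
  · have := key s h1 h2 h4
    have e2 : Function.update s.neg x false = s.neg := by rw [← h3, Function.update_eq_self]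
    simp only [hz, if_false, decide_false, e2]
    simpa using this

theorem reaches_labels (s : Memory L M) (lab : Dir → L) (i : List (Sym L)) (o : List (Sym Empty))
    (f : Bool → List (Bool × Bool)) (k : List (Bool × Bool)) :
    Reaches D ⟨some .labels, s, contents (.label (lab .up) :: .label (lab .right) ::
        .label (lab .down) :: .label (lab .left) :: i) o f k⟩
      ⟨some .next, { s with lab := lab, idx := Fin.last M }, contents i o f k⟩ 1 := by
  refine Reaches.of_step ?_
  simp only [TM2.step, BoxData.program, TM2.stepAux, update_contents_inp,
    contents, List.head?_cons, List.tail_cons, Memory.setLabel]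
  congr
  funext d
  cases d <;> simp

/-! ### Writing a coordinate -/

/-- Copying the digits of a coordinate to the output. -/
theorem reaches_copy (x : Bool) (i : List (Sym L)) (o : List (Sym Empty)) (A : List (Bool × Bool))
    (m : ℕ) (s : Memory L M) (f : Bool → List (Bool × Bool)) (k : List (Bool × Bool))
    (hf : f x = A) (hs : s.started = decide (m ≠ 0)) (hlow : D.low s x < 2 ^ D.exp) :
    Reaches D ⟨some (.copy x), s, contents i ((Computability.encodeNat m).map .bit ++ o) f k⟩
      ⟨some (.restore x), { s with dig := none, started := false },
        contents i ((if D.sign s x then [Sym.minus] else []) ++ ((Computability.encodeNat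
          (2 ^ D.exp * A.foldl (fun m d => 2 * m + (D.digit s x d).toNat) m + D.low s x)).map .bit
            ++ o)) (Function.update f x []) (A.reverse ++ k)⟩ (A.length + 1) := by
  induction A generalizing m s f k with
  | nil =>
    refine Reaches.of_step ?_
    simp only [TM2.step, BoxData.program, TM2.stepAux, contents, hf, List.head?_nil,
      Option.isSome_none, cond_false, List.tail_nil, update_contents_num, List.foldl_nil,
      List.reverse_nil, List.nil_append]
    have hZ : (2 ^ D.exp * m + D.low s x) / 2 ^ D.exp = m := by
      rw [Nat.mul_add_div (by positivity), Nat.div_eq_of_lt hlow, add_zero]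
    have := stepAux_writeLow (D := D) x
      (.load (fun s => { s with started := false }) <|
        .branch (fun s => D.sign s x)
          (.push .out (fun _ => (Sym.minus : Sym Empty)) <| .goto fun _ => .restore x)
          (.goto fun _ => .restore x)) i o (Function.update f x []) k
      (2 ^ D.exp * m + D.low s x) D.exp { s with dig := none }
      (fun j hj => (testBit_add_of_lt hj).symm) (by rw [hZ]; exact hs)
    rw [hZ] at this
    rw [this]
    simp only [TM2.stepAux, update_contents_out]
    have e : D.sign { s with dig := none, started := false } x = D.sign s x := rfl
    rw [e]
    cases D.sign s x <;> rfl
  | cons d A ih =>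
    have e := encodeNat_step (m := m) (b := D.digit s x d) rfl (o := o)
    have ih' := ih (2 * m + (D.digit s x d).toNat)
      { s with dig := some d, started := decide (2 * m + (D.digit s x d).toNat ≠ 0) }
      (Function.update f x A) (d :: k) (by simp) rfl hlow
    have h1 : Reaches D
        ⟨some (.copy x), s, contents i ((Computability.encodeNat m).map .bit ++ o) f k⟩
        ⟨some (.copy x),
          { s with dig := some d, started := decide (2 * m + (D.digit s x d).toNat ≠ 0) },
          contents i ((Computability.encodeNat (2 * m + (D.digit s x d).toNat)).map .bit ++ o)
            (Function.update f x A) (d :: k)⟩ 1 := by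
      refine Reaches.of_step ?_
      have ed : ∀ t, D.digit { s with dig := some d, started := t } x d = D.digit s x d :=
        fun _ => rfl
      simp only [TM2.step, BoxData.program, TM2.stepAux, contents, hf, List.head?_cons,
        Option.isSome_some, cond_true, List.tail_cons, update_contents_num, update_contents_back,
        update_contents_out, Option.getD_some, ed, hs, e.2]
      rw [← e.1, e.2]
      by_cases hb : 2 * m + (D.digit s x d).toNat ≠ 0
      · have hd : decide (2 * m + (D.digit s x d).toNat ≠ 0) = true := decide_eq_true hb
        simp only [hd, cond_true, if_true]
      · have hs' : decide (m ≠ 0) = false := by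
          simp only [decide_eq_false_iff_not]
          omega
        have hd : decide (2 * m + (D.digit s x d).toNat ≠ 0) = false := decide_eq_false hb
        simp only [hd, cond_false, hs', Bool.false_eq_true, if_false]
    rw [Function.update_idem] at ih'
    rw [List.reverse_cons, List.append_assoc]
    exact (h1.trans ih').mono (by simp; omega)

/-- Restoring the digits of a coordinate. -/
theorem reaches_restore (x : Bool) (i : List (Sym L)) (o : List (Sym Empty))
    (k : List (Bool × Bool)) (s : Memory L M) (f : Bool → List (Bool × Bool)) :
    Reaches D ⟨some (.restore x), s, contents i o f k⟩
      ⟨some (if x then .next else .copy true), { s with dig := none },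
        contents i ((if x then [] else [Sym.comma]) ++ o)
          (Function.update f x (k.reverse ++ f x)) []⟩ (k.length + 1) := by
  induction k generalizing s f with
  | nil =>
    refine Reaches.of_step ?_
    simp only [TM2.step, BoxData.program, TM2.stepAux, contents, List.head?_nil,
      Option.isSome_none, cond_false, List.tail_nil, update_contents_back, update_contents_out,
      List.reverse_nil, List.nil_append, Function.update_eq_self]
    cases x <;> rfl
  | cons d k ih =>
    have h1 : Reaches D ⟨some (.restore x), s, contents i o f (d :: k)⟩
        ⟨some (.restore x), { s with dig := some d },
          contents i o (Function.update f x (d :: f x)) k⟩ 1 := by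
      refine Reaches.of_step ?_
      simp only [TM2.step, BoxData.program, TM2.stepAux, contents, List.head?_cons,
        Option.isSome_some, cond_true, List.tail_cons, update_contents_back, update_contents_num,
        Option.getD_some]
    have := h1.trans (ih { s with dig := some d } (Function.update f x (d :: f x)))
    rw [Nat.add_comm] at this
    simpa [List.reverse_cons, List.append_assoc] using this

theorem reaches_clear (x : Bool) (i : List (Sym L)) (o : List (Sym Empty))
    (k A : List (Bool × Bool)) (s : Memory L M) (f : Bool → List (Bool × Bool)) (hf : f x = A) :
    Reaches D ⟨some (.clear x), s, contents i o f k⟩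
      ⟨some (if x then .clear false else .read true),
        if x then { s with dig := none } else Memory.init L M,
        contents i o (Function.update f x []) k⟩ (A.length + 1) := by
  induction A generalizing s f with
  | nil =>
    refine Reaches.of_step ?_
    simp only [TM2.step, BoxData.program, TM2.stepAux, contents, hf, List.head?_nil,
      Option.isSome_none, cond_false, List.tail_nil, update_contents_num]
    cases x <;> rfl
  | cons d A ih =>
    have h1 : Reaches D ⟨some (.clear x), s, contents i o f k⟩
        ⟨some (.clear x), { s with dig := some d }, contents i o (Function.update f x A) k⟩ 1 := by
      refine Reaches.of_step ?_
      simp only [TM2.step, BoxData.program, TM2.stepAux, contents, hf, List.head?_cons,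
        Option.isSome_some, cond_true, List.tail_cons, update_contents_num]
    have := h1.trans (ih { s with dig := some d } (Function.update f x A) (by simp))
    rw [Nat.add_comm] at this
    simpa using this

end

section
variable {L : Type} {M : ℕ} {D : BoxData L M}

/-- The memory while the squares of the box with the center `z` and the labels `lab` are written. -/
def boxMemory (z : Bool → ℤ) (lab : Dir → L) (j : Fin (M + 1)) : Memory L M where
  neg x := decide (z x < 0)
  zero x := decide (z x = 0)
  odd x := decide (z x % 2 = 1)
  borrow := true
  lab := lab
  idx := j
  started := false
  sym := none
  dig := none

/-- The digits of a coordinate, and of its absolute value minus one, on the stack. -/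
def digits (z : Bool → ℤ) (x : Bool) : List (Bool × Bool) :=
  (withBorrow true (Computability.encodeNat (z x).natAbs)).reverse

theorem foldl_reverse_eq_ofBits (g : Bool × Bool → Bool) (l : List (Bool × Bool)) :
    l.reverse.foldl (fun m d => 2 * m + (g d).toNat) 0 = ofBits (l.map g) := by
  rw [List.foldl_reverse]
  induction l with
  | nil => rfl
  | cons d l ih => simp [ofBits, ih]

/-- The offsets are smaller than the pitch. -/
def BoxData.Bounded (D : BoxData L M) : Prop :=
  ∀ j x, -(2 ^ D.exp : ℤ) < D.offset j x ∧ D.offset j x < 2 ^ D.exp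

theorem BoxData.Bounded.low_lt (hD : D.Bounded) (s : Memory L M) (x : Bool) :
    D.low s x < 2 ^ D.exp := by
  have h := hD s.idx x
  have h' : -(2 ^ D.exp : ℤ) < D.relOff s x ∧ D.relOff s x < 2 ^ D.exp := by
    unfold BoxData.relOff BoxData.off
    split_ifs <;> omega
  have : (D.low s x : ℤ) < 2 ^ D.exp := by
    unfold BoxData.low
    split_ifs <;> omega
  exact_mod_cast this

theorem foldl_digits (z : Bool → ℤ) (x : Bool) (s : Memory L M)
    (h : D.relOff s x < 0 → z x ≠ 0) :
    (digits z x).foldl (fun m d => 2 * m + (D.digit s x d).toNat) 0 =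
      if D.relOff s x < 0 then (z x).natAbs - 1 else (z x).natAbs := by
  rw [digits, foldl_reverse_eq_ofBits]
  unfold BoxData.digit
  split_ifs with hr
  · have := h hr
    rw [ofBits_map_snd_withBorrow, ofBits_encodeNat]
    · rfl
    · rw [ofBits_encodeNat, Bool.toNat_true]
      omega
  · rw [map_fst_withBorrow, ofBits_encodeNat]

/-- If the offset `t` has the sign of `z`, then `|2 ^ r * z + t| = 2 ^ r * |z| + |t|`; for opposite
signs it is `2 ^ r * (|z| - 1) + (2 ^ r - |t|)`. For `z = 0` the sign of `t` is used, so that the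
second case, which needs `|z| - 1`, does not arise. -/
theorem encodeInt_eq (hD : D.Bounded) (z : Bool → ℤ) (lab : Dir → L) (j : Fin (M + 1)) (x : Bool)
    (o : List (Sym Empty)) :
    (if D.sign (boxMemory z lab j) x then [Sym.minus] else []) ++ ((Computability.encodeNat
      (2 ^ D.exp * (digits z x).foldl
        (fun m d => 2 * m + (D.digit (boxMemory z lab j) x d).toNat) 0 +
          D.low (boxMemory z lab j) x)).map .bit ++ Sym.comma :: o) =
      encodeInt Empty (2 ^ D.exp * z x + D.offset j x) ++ o := by
  have hb := hD j x
  have hoff : D.off (boxMemory z lab j) x = D.offset j x := rfl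
  have hsign : D.sign (boxMemory z lab j) x = decide (z x < 0 ∨ z x = 0 ∧ D.offset j x < 0) := by
    rw [BoxData.sign, hoff, Bool.decide_or, Bool.decide_and]
    rfl
  have hrel : D.relOff (boxMemory z lab j) x =
      if z x < 0 ∨ z x = 0 ∧ D.offset j x < 0 then -D.offset j x else D.offset j x := by
    simp only [BoxData.relOff, hsign, hoff, decide_eq_true_eq]
  have hne : D.relOff (boxMemory z lab j) x < 0 → z x ≠ 0 := by
    rw [hrel]
    intro h e
    simp only [e, lt_irrefl, false_or, true_and] at h
    split_ifs at h <;> omega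
  rw [foldl_digits z x _ hne]
  unfold BoxData.low
  set r := D.relOff (boxMemory z lab j) x
  set t := D.offset j x
  generalize hN : (2 ^ D.exp : ℤ) = N at hb ⊢
  have hN' : ((2 ^ D.exp : ℕ) : ℤ) = N := by rw [← hN]; push_cast; rfl
  have habs : ∀ a : ℕ, a ≠ 0 → N ≤ N * a ∧ N * ((a - 1 : ℕ) : ℤ) = N * a - N := by
    intro a ha
    obtain ⟨a, rfl⟩ := Nat.exists_eq_succ_of_ne_zero ha
    have : 0 ≤ N * a := mul_nonneg (by omega) (by positivity)
    push_cast
    simp only [mul_add, mul_one]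
    constructor <;> omega
  have key : (N * z x + t < 0 ↔ z x < 0 ∨ z x = 0 ∧ t < 0) ∧ (N * z x + t).natAbs =
      2 ^ D.exp * (if r < 0 then (z x).natAbs - 1 else (z x).natAbs) +
        (if r < 0 then N + r else r).toNat := by
    have hz : N * z x = if z x < 0 then -(N * (z x).natAbs) else N * (z x).natAbs := by
      split_ifs with h
      · rw [← mul_neg]; congr 1; omega
      · congr 1; omega
    rw [← Int.natCast_inj (m := (N * z x + t).natAbs), Nat.cast_add, Nat.cast_mul, hN']
    by_cases h0 : z x = 0
    · have hr : ¬ r < 0 := fun h => hne h h0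
      have hr' : r = if t < 0 then -t else t := by
        rw [hrel]; simp [h0]
      rw [if_neg hr, if_neg hr, h0, mul_zero, zero_add, Int.natAbs_zero, Nat.cast_zero, mul_zero,
        zero_add]
      split_ifs at hr' <;> omega
    · have := habs (z x).natAbs (by omega)
      have hr' : r = if z x < 0 then -t else t := by
        rw [hrel]; simp [h0]
      split_ifs at hr' hz <;> split_ifs <;> omega
  rw [hsign, key.2.symm]
  unfold encodeInt
  simp only [decide_eq_true_eq, ← key.1]
  simp

/-- The square with offset number `j` of the box with the center `z`. -/
def BoxData.cell (D : BoxData L M) (z : Bool → ℤ) (j : ℕ) : Cell :=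
  (2 ^ D.exp * z true + D.offset j true, 2 ^ D.exp * z false + D.offset j false)

/-- The squares of a box with offset number less than `j`. -/
def BoxData.cells (D : BoxData L M) (z : Bool → ℤ) (lab : Dir → L) (j : ℕ) : List Cell :=
  ((List.range j).filter (D.active lab (decide (z true % 2 = 1)) (decide (z false % 2 = 1)))).map
    (D.cell z)

theorem BoxData.cells_succ (z : Bool → ℤ) (lab : Dir → L) (j : ℕ) :
    D.cells z lab (j + 1) = D.cells z lab j ++
      if D.active lab (decide (z true % 2 = 1)) (decide (z false % 2 = 1)) j then [D.cell z j]
      else [] := by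
  unfold BoxData.cells
  rw [List.range_succ, List.filter_append, List.map_append]
  split_ifs with h <;> simp [h]

variable [Inhabited L]

/-- Writing a coordinate. -/
theorem reaches_coordinate (hD : D.Bounded) (z : Bool → ℤ) (lab : Dir → L) (j : Fin (M + 1))
    (x : Bool) (i : List (Sym L)) (o : List (Sym Empty)) :
    Reaches D ⟨some (.copy x), boxMemory z lab j, contents i (.comma :: o) (digits z) []⟩
      ⟨some (if x then .next else .copy true), boxMemory z lab j,
        contents i ((if x then [] else [Sym.comma]) ++
          (encodeInt Empty (2 ^ D.exp * z x + D.offset j x) ++ o)) (digits z) []⟩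
      (2 * (digits z x).length + 2) := by
  have h1 := reaches_copy (D := D) x i (.comma :: o) (digits z x) 0 (boxMemory z lab j) (digits z)
    [] rfl rfl (hD.low_lt _ _)
  rw [encodeInt_eq hD] at h1
  have h2 := h1.trans (reaches_restore (D := D) x _ _ _ _ _)
  refine Reaches.mono (n := (digits z x).length + 1 + (((digits z x).reverse ++ []).length + 1)) ?_
    (by simp; omega)
  have e : Function.update (Function.update (digits z) x []) x
      (((digits z x).reverse ++ []).reverse ++ Function.update (digits z) x [] x) = digits z := by
    simp
  rw [e] at h2
  exact h2

theorem encodeCells_append (l l' : List Cell) :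
    encodeCells (l ++ l') = encodeCells l ++ encodeCells l' := List.flatMap_append

/-- Writing the squares of a box. -/
theorem reaches_next (hD : D.Bounded) (z : Bool → ℤ) (lab : Dir → L) (i : List (Sym L)) (j : ℕ)
    (hj : j < M + 1) (o : List (Sym Empty)) :
    Reaches D ⟨some .next, boxMemory z lab ⟨j, hj⟩, contents i o (digits z) []⟩
      ⟨some (.clear true), boxMemory z lab 0,
        contents i (encodeCells (D.cells z lab j) ++ o) (digits z) []⟩
      (j * (2 * (digits z true).length + 2 * (digits z false).length + 5) + 1) := by
  induction j generalizing o with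
  | zero =>
    refine Reaches.mono (n := 1) (Reaches.of_step ?_) (by omega)
    simp only [TM2.step, BoxData.program, TM2.stepAux]
    rfl
  | succ j ih =>
    rw [BoxData.cells_succ, encodeCells_append, List.append_assoc]
    have h0 : decide ((⟨j + 1, hj⟩ : Fin (M + 1)) = 0) = false := by
      simp [Fin.ext_iff]
    by_cases h : D.active lab (decide (z true % 2 = 1)) (decide (z false % 2 = 1)) j = true
    · have h1 : Reaches D ⟨some .next, boxMemory z lab ⟨j + 1, hj⟩, contents i o (digits z) []⟩
          ⟨some (.copy false), boxMemory z lab ⟨j, by omega⟩,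
            contents i (.comma :: o) (digits z) []⟩ 1 := by
        refine Reaches.of_step ?_
        simp only [TM2.step, BoxData.program, TM2.stepAux, boxMemory, h0, cond_false,
          Nat.add_sub_cancel, h, cond_true, update_contents_out]
        rfl
      have h2 := reaches_coordinate hD z lab ⟨j, by omega⟩ false i o
      have h3 := reaches_coordinate hD z lab ⟨j, by omega⟩ true i
        (encodeInt Empty (2 ^ D.exp * z false + D.offset j false) ++ o)
      have h4 := ((h1.trans h2).trans h3).trans (ih (by omega) _)
      refine Reaches.mono (h4.congr rfl ?_) (by ring_nf; omega)
      simp [h, encodeCells, encodeCell, BoxData.cell]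
    · have h' : D.active lab (decide (z true % 2 = 1)) (decide (z false % 2 = 1)) j = false := by
        simpa using h
      have h1 : Reaches D ⟨some .next, boxMemory z lab ⟨j + 1, hj⟩, contents i o (digits z) []⟩
          ⟨some .next, boxMemory z lab ⟨j, by omega⟩, contents i o (digits z) []⟩ 1 := by
        refine Reaches.of_step ?_
        simp only [TM2.step, BoxData.program, TM2.stepAux, boxMemory, h0, cond_false,
          Nat.add_sub_cancel, h']
      have h4 := h1.trans (ih (by omega) o)
      refine Reaches.mono (h4.congr rfl ?_) (by ring_nf; omega)
      simp [h', encodeCells]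

/-- The coordinates of a square. -/
def coords (p : Cell) (x : Bool) : ℤ := if x then p.1 else p.2

theorem length_digits_le (L : Type) (z : Bool → ℤ) (x : Bool) :
    (digits z x).length ≤ (encodeInt L (z x)).length := by
  simp only [digits, List.length_reverse, length_withBorrow, encodeInt, List.length_append,
    List.length_map]
  omega

/-- Reading a square and writing the squares of its box. -/
theorem reaches_square (hD : D.Bounded) (p : Cell) (lab : Dir → L) (i : List (Sym L))
    (o : List (Sym Empty)) :
    Reaches D ⟨some (.read true), Memory.init L M, contents (encodeCell L p ++
        (.label (lab .up) :: .label (lab .right) :: .label (lab .down) :: .label (lab .left) :: i))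
          o (fun _ => []) []⟩
      ⟨some (.read true), Memory.init L M, contents i
        (encodeCells (D.cells (coords p) lab M) ++ o) (fun _ => []) []⟩
      ((5 * M + 4) * ((encodeCell L p).length + 4)) := by
  have h1 := reaches_readInt (D := D) true p.1 (Memory.init L M) (encodeInt L p.2 ++
    (.label (lab .up) :: .label (lab .right) :: .label (lab .down) :: .label (lab .left) :: i))
    o (fun _ => []) [] rfl rfl rfl rfl rfl
  have h2 := h1.trans (reaches_readInt (D := D) false p.2 _ _ _ _ _ rfl rfl rfl rfl rfl)
  have h3 := h2.trans (reaches_labels (D := D) _ lab i _ _ _)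
  have e1 : Function.update (Function.update (fun _ => []) true
      (withBorrow true (Computability.encodeNat p.1.natAbs)).reverse) false
      (withBorrow true (Computability.encodeNat p.2.natAbs)).reverse = digits (coords p) := by
    funext x
    cases x <;> rfl
  rw [e1] at h3
  have h4 := reaches_next hD (coords p) lab i M (Nat.lt_succ_self M) o
  have h5 := h4.trans (reaches_clear (D := D) true i _ [] _ (boxMemory (coords p) lab 0)
    (digits (coords p)) rfl)
  have h6 := h5.trans (reaches_clear (D := D) false i _ [] (digits (coords p) false) _ _ rfl)
  have e2 : Function.update (Function.update (digits (coords p)) true []) false [] =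
      fun _ => [] := by
    funext x
    cases x <;> rfl
  rw [e2] at h6
  have h7 := (h3.congr rfl ?_).trans h6
  · refine Reaches.mono (h7.congr ?_ rfl) ?_
    · simp [encodeCell]
    · have l1 := length_digits_le L (coords p) true
      have l2 := length_digits_le L (coords p) false
      have l3 : (encodeCell L p).length = (encodeInt L (coords p true)).length +
        (encodeInt L (coords p false)).length := by simp [encodeCell, coords]
      have l4 : M * (2 * (digits (coords p) true).length + 2 * (digits (coords p) false).length + 5)
          ≤ M * (5 * ((encodeCell L p).length + 4)) := Nat.mul_le_mul_left _ (by omega)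
      have l5 : (5 * M + 4) * ((encodeCell L p).length + 4) =
        M * (5 * ((encodeCell L p).length + 4)) + 4 * ((encodeCell L p).length + 4) := by ring
      rw [l5]
      have l6 : (encodeInt L p.1).length + (encodeInt L p.2).length = (encodeCell L p).length := by
        simp [encodeCell]
      omega
  · congr 1
    simp only [Memory.init, boxMemory]
    congr 1 <;> funext x <;> cases x <;> rfl

end

/-! ### The machine -/

instance : Fintype Stack :=
  ⟨{.inp, .out, .num true, .num false, .back}, by rintro (_ | _ | _ | _) <;> simp⟩

instance : Finite Label :=
  Finite.of_surjective
    (fun t : Fin 6 × Bool => match t.1 with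
      | 0 => Label.read t.2
      | 1 => .labels
      | 2 => .next
      | 3 => .copy t.2
      | 4 => .restore t.2
      | _ => .clear t.2)
    fun l => by
      rcases l with x | _ | _ | x | x | x
      exacts [⟨(0, x), rfl⟩, ⟨(1, true), rfl⟩, ⟨(2, true), rfl⟩, ⟨(3, x), rfl⟩, ⟨(4, x), rfl⟩,
        ⟨(5, x), rfl⟩]

instance : Finite Dir :=
  Finite.of_surjective
    (fun t : Fin 4 => match t with
      | 0 => Dir.up
      | 1 => .right
      | 2 => .down
      | 3 => .left)
    fun d => by
      cases d
      exacts [⟨0, rfl⟩, ⟨1, rfl⟩, ⟨2, rfl⟩, ⟨3, rfl⟩]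

instance {L : Type} [Finite L] : Finite (Sym L) :=
  Finite.of_surjective
    (fun t : Bool ⊕ Bool ⊕ L => match t with
      | .inl b => Sym.bit b
      | .inr (.inl true) => .minus
      | .inr (.inl false) => .comma
      | .inr (.inr a) => .label a)
    fun s => by
      rcases s with b | _ | _ | a
      exacts [⟨.inl b, rfl⟩, ⟨.inr (.inl true), rfl⟩, ⟨.inr (.inl false), rfl⟩,
        ⟨.inr (.inr a), rfl⟩]

instance {L : Type} [Finite L] {M : ℕ} : Finite (Memory L M) :=
  Finite.of_injective
    (fun s : Memory L M =>
      ((s.neg, s.zero, s.odd, s.borrow), (s.lab, s.idx), s.started, s.sym, s.dig))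
    fun s t h => by
      cases s
      cases t
      simp only [Prod.mk.injEq] at h
      simp only [Memory.mk.injEq]
      tauto

section
variable {C : Type} {B : Finset C} {M : ℕ} {D : BoxData (Option B) M}

/-- The squares of the boxes of a list of squares. -/
def BoxData.allCells (D : BoxData (Option B) M) (l : List (Cell × (Dir → Option B))) : List Cell :=
  l.reverse.flatMap fun s => D.cells (coords s.1) s.2 M

theorem reaches_squares (hD : D.Bounded) (l : List (Cell × (Dir → Option B)))
    (o : List (Sym Empty)) :
    Reaches D ⟨some (.read true), Memory.init _ M,
        contents (l.flatMap encodeColoredSquare) o (fun _ => []) []⟩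
      ⟨some (.read true), Memory.init _ M,
        contents [] (encodeCells (D.allCells l) ++ o) (fun _ => []) []⟩
      ((5 * M + 4) * (l.flatMap encodeColoredSquare).length) := by
  induction l generalizing o with
  | nil => exact Reaches.refl _ _
  | cons s l ih =>
    have h := (reaches_square hD s.1 s.2 (l.flatMap encodeColoredSquare) o).trans (ih _)
    refine (h.congr ?_ ?_).mono ?_
    · simp [encodeColoredSquare]
    · simp [BoxData.allCells, encodeCells_append]
    · rw [List.flatMap_cons, List.length_append, ← Nat.mul_add, encodeColoredSquare,
        List.length_append]
      rfl

theorem reaches_halt (o : List (Sym Empty)) :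
    Reaches D ⟨some (.read true), Memory.init _ M, contents [] o (fun _ => []) []⟩
      ⟨none, Memory.init _ M, contents [] o (fun _ => []) []⟩ 1 := by
  refine Reaches.of_step ?_
  simp only [TM2.step, BoxData.program, TM2.stepAux, contents, List.head?_nil, List.tail_nil,
    update_contents_inp, Memory.isBit, Memory.isMinus, Memory.isComma, cond_false]
  rfl

/-- The machine that writes the squares of the boxes of a list of squares. -/
noncomputable def BoxData.machine (D : BoxData (Option B) M) : FinTM2 :=
  haveI : Fintype Label := Fintype.ofFinite _
  haveI : Fintype (Memory (Option B) M) := Fintype.ofFinite _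
  haveI : Fintype (StackSym (Option B) .inp) := Fintype.ofFinite (Sym (Option B))
  { K := Stack
    k₀ := .inp
    k₁ := .out
    Γ := StackSym (Option B)
    Λ := Label
    main := .read true
    σ := Memory (Option B) M
    initialState := Memory.init _ M
    m := D.program }

theorem initList_machine (i : List (Sym (Option B))) :
    initList D.machine i =
      (⟨some (.read true), Memory.init _ M, contents i [] (fun _ => []) []⟩ :
        Config (Option B) M) := by
  unfold initList
  congr 1
  funext k
  cases k <;> rfl

theorem haltList_machine (o : List (Sym Empty)) :
    haltList D.machine o =
      (⟨none, Memory.init _ M, contents [] o (fun _ => []) []⟩ : Config (Option B) M) := by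
  unfold haltList
  congr 1
  funext k
  cases k <;> rfl

theorem exists_run (hD : D.Bounded) (l : List (Cell × (Dir → Option B))) :
    ∃ k ≤ (5 * M + 5) * ((l.flatMap encodeColoredSquare).length + 1),
      (flip bind D.machine.step)^[k] (some (initList D.machine (l.flatMap encodeColoredSquare))) =
        some (haltList D.machine (encodeCells (D.allCells l))) := by
  have h := (reaches_squares hD l []).trans (reaches_halt _)
  rw [List.append_nil] at h
  obtain ⟨k, hk, e⟩ := h.mono (m := (5 * M + 5) * ((l.flatMap encodeColoredSquare).length + 1))
    (by ring_nf; omega)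
  refine ⟨k, hk, ?_⟩
  exact (congrArg (fun c : Config (Option B) M => (flip bind (TM2.step D.program))^[k] (some c))
    (initList_machine _)).trans (e.trans (congrArg some (haltList_machine _).symm))

/-- The listing of the boxes is computed in linear time. -/
noncomputable def BoxData.computable (hD : D.Bounded) :
    TM2ComputableInTime (ColoredListing.encode (B := B)) encodeCells
      (fun l => D.allCells l.squares) where
  tm := D.machine
  inputAlphabet := Equiv.refl _
  outputAlphabet := Equiv.refl _
  time n := (5 * M + 5) * (n + 1)
  outputsFun l :=
    { steps := (exists_run hD l.squares).choose
      evals_in_steps := by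
        have := (exists_run hD l.squares).choose_spec.2
        have e1 : ∀ l : List (Sym (Option B)), l.map (Equiv.refl (Sym (Option B))).invFun = l :=
          fun l => List.map_id l
        have e2 : ∀ l : List (Sym Empty), l.map (Equiv.refl (Sym Empty)).invFun = l :=
          fun l => List.map_id l
        refine Eq.trans ?_ (this.trans ?_)
        · congr 3
          exact e1 _
        · rw [Option.map_some]
          congr 2
          exact (e2 _).symm
      steps_le_m := (exists_run hD l.squares).choose_spec.1 }

end

/-! ### The reduction is computable in linear time -/

/-- A numbering of all relative positions within one pitch. Indices beyond the list give `0`, which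
also satisfies the bounds. -/
theorem exists_offsets (N : ℕ) (hN : 0 < N) : ∃ (M : ℕ) (u : ℕ → Cell),
    (∀ j, (-(N : ℤ) < (u j).1 ∧ (u j).1 < N) ∧ -(N : ℤ) < (u j).2 ∧ (u j).2 < N) ∧
      ∀ a b : ℤ, -(N : ℤ) < a → a < N → -(N : ℤ) < b → b < N → ∃ j < M, u j = (a, b) := by
  let l : List Cell := (Finset.Ioo (-(N : ℤ)) N ×ˢ Finset.Ioo (-(N : ℤ)) N).toList
  have hl : ∀ v : Cell, v ∈ l ↔
      (-(N : ℤ) < v.1 ∧ v.1 < N) ∧ -(N : ℤ) < v.2 ∧ v.2 < N := by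
    intro v
    simp [l]
  refine ⟨l.length, fun j => l.getD j 0, fun j => ?_, fun a b h1 h2 h3 h4 => ?_⟩
  · dsimp only
    by_cases hj : j < l.length
    · rw [← hl, List.getD_eq_getElem _ _ hj]
      exact List.getElem_mem hj
    · rw [List.getD_eq_default _ _ (by omega)]
      simp only [Prod.fst_zero, Prod.snd_zero]
      omega
  · obtain ⟨j, hj, e⟩ := List.getElem_of_mem ((hl (a, b)).2 ⟨⟨h1, h2⟩, h3, h4⟩)
    exact ⟨j, hj, by rw [← e]; exact List.getD_eq_getElem _ _ hj⟩

section
variable {C : Type} {B : Finset C} (W : Finset (WangTile C))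

open scoped Classical in
/-- The data of the machine for the boxes of colored regions, with the offsets `u`. -/
noncomputable def boxData (B : Finset C) (M : ℕ) (u : ℕ → Cell) : BoxData (Option B) M where
  exp := pitchExp (colors B W) W
  offset j := coords (u j)
  active lab a b j := decide (InTemplate W (fun d => (lab d).map (boundaryColor W))
    (if a then 1 else 0) (if b then 1 else 0) (u j))

theorem emod_two_eq_ite (a : ℤ) : a % 2 = if decide (a % 2 = 1) then 1 else 0 := by
  rcases Int.emod_two_eq a with h | h <;> simp [h]

theorem mem_cells_boxData {M : ℕ} {u : ℕ → Cell}
    (hu : ∀ a b : ℤ, -(2 ^ pitchExp (colors B W) W : ℤ) < a → a < 2 ^ pitchExp (colors B W) W →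
      -(2 ^ pitchExp (colors B W) W : ℤ) < b → b < 2 ^ pitchExp (colors B W) W →
        ∃ j < M, u j = (a, b))
    (p z : Cell) (lab : Dir → Option B) :
    z ∈ (boxData W B M u).cells (coords p) lab M ↔
      z ∈ boxCells W (fun d => (lab d).map (boundaryColor W)) p := by
  obtain ⟨x, y⟩ := p
  have hm := two_mul_mesh (colors B W) W
  push_cast at hm
  rw [mem_boxCells_iff, hm, emod_two_eq_ite x, emod_two_eq_ite y]
  have hact : ∀ a b j, (boxData W B M u).active lab a b j = true ↔
      InTemplate W (fun d => (lab d).map (boundaryColor W)) (if a then 1 else 0)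
        (if b then 1 else 0) (u j) := by
    classical
    exact fun _ _ _ => decide_eq_true_iff
  simp only [BoxData.cells, List.mem_map, List.mem_filter, List.mem_range, hact]
  constructor
  · rintro ⟨j, ⟨-, hj⟩, rfl⟩
    have e : (((boxData W B M u).cell (coords (x, y)) j).1 - 2 ^ pitchExp (colors B W) W * x,
        ((boxData W B M u).cell (coords (x, y)) j).2 - 2 ^ pitchExp (colors B W) W * y) = u j := by
      simp [BoxData.cell, boxData, coords]
    rw [e]
    exact hj
  · intro h
    have hz : z ∈ boxCells W (fun d => (lab d).map (boundaryColor W)) (x, y) := by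
      rw [mem_boxCells_iff, hm, emod_two_eq_ite x, emod_two_eq_ite y]
      exact h
    have hb := bounds_of_mem_boxCells (x := z.1) (y := z.2) hz
    rw [hm] at hb
    obtain ⟨j, hj, e⟩ := hu _ _ hb.1.1 hb.1.2 hb.2.1 hb.2.2
    refine ⟨j, ⟨hj, ?_⟩, ?_⟩
    · rw [e]
      exact h
    · simp [BoxData.cell, boxData, coords, e]

theorem isLinearTime_toRegion : IsLinearTime (ColoredRegion.toRegion (B := B) W) := by
  obtain ⟨M, u, hu, hu'⟩ := exists_offsets (2 ^ pitchExp (colors B W) W) (by positivity)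
  push_cast at hu hu'
  have hD : (boxData W B M u).Bounded := by
    intro j x
    cases x
    · exact (hu j).2
    · exact (hu j).1
  refine ⟨fun l => (boxData W B M u).allCells l.squares, fun l z => ?_,
    BoxData.computable hD, 5 * M + 5, fun n => le_rfl⟩
  have h : z ∈ (l.region.toRegion W).1 ↔
      ∃ p ∈ l.region.cells, z ∈ boxCells W ((l.region.edgeColoring W).col p) p :=
    mem_boxRegion_iff
  rw [h]
  simp only [BoxData.allCells, List.mem_flatMap, List.mem_reverse, mem_cells_boxData W hu']
  constructor
  · rintro ⟨s, hs, hz⟩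
    obtain ⟨h1, h2⟩ := (l.mem_squares_iff s).1 hs
    rw [h2] at hz
    exact ⟨s.1, h1, hz⟩
  · rintro ⟨p, hp, hz⟩
    exact ⟨(p, l.region.col p), (l.mem_squares_iff _).2 ⟨hp, rfl⟩, hz⟩

end

/-! ### Boundary edges -/

/-- The right side of a rightmost square is a boundary edge and has a color. -/
theorem ColoredRegion.nonempty_colors {C : Type} {B : Finset C} (G : ColoredRegion B) :
    B.Nonempty := by
  obtain ⟨⟨p, hp⟩⟩ := G.isSimplyConnected.connected.nonempty
  obtain ⟨q, hq, hmax⟩ := G.cells.exists_max_image (fun p => p.1) ⟨p, hp⟩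
  have hn : Cell.step q .right ∉ G.cells := by
    intro h
    have := hmax _ h
    simp only [Cell.step] at this
    omega
  obtain ⟨b, -⟩ := Option.isSome_iff_exists.1 ((G.isSome_col_iff q .right).2 ⟨hq, hn⟩)
  exact ⟨b, b.2⟩

end WangRect

open WangRect in
theorem lemma3p3 (C : Type) (B : Finset C) (W : Finset (WangTile C)) (k c : ℕ)
    (hW : W.card ≤ k) (hB : B.card = c) :
    ∃ R : Finset RectTile, R.card ≤ 8 * (k + 4 * c) ^ 2 ∧
      ∃ F : ColoredRegion B → Region,
        (∀ G : ColoredRegion B, Nonempty (WangTiling W G) ↔ Nonempty (RectTiling R (F G).1)) ∧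
        (∀ G : ColoredRegion B, Nonempty (WangTiling W G ≃ RectTiling R (F G).1)) ∧
        IsLinearTime F := by
  -- Without boundary colors there are no colored regions, and the empty set of rectangles will do;
  -- this case is separate because `16 * k` can exceed `8 * k ^ 2`. For `c ≥ 1` the bound `16 * k ≤
  -- 8 * (k + 4 * c) ^ 2` holds.
  rcases Nat.eq_zero_or_pos c with rfl | hc
  · have hG : ColoredRegion B → False := fun G =>
      G.nonempty_colors.ne_empty (Finset.card_eq_zero.1 hB)
    exact ⟨∅, Nat.zero_le _, ColoredRegion.toRegion W, fun G => (hG G).elim,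
      fun G => (hG G).elim, isLinearTime_toRegion W⟩
  · let e : ∀ G : ColoredRegion B,
        WangTiling W G ≃ RectTiling (rects (tileColor B W)) (G.toRegion W).1 := fun G =>
      (wangTilingEquiv W G).trans (wangMapEquiv (G.edgeColoring W) (tileColor B W))
    refine ⟨rects (tileColor B W), ?_, ColoredRegion.toRegion W, fun G => (e G).nonempty_congr,
      fun G => ⟨e G⟩, isLinearTime_toRegion W⟩
    have h := card_rects_le (tileColor B W)
    rw [Fintype.card_coe] at h
    nlinarith
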